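/- **Theorem (Recognition of full binary trees).** *Graphs and rules.* A graph is a finite directed multigraph $G=(V,E,s,t,l,m,p)$ with a partial node labelling $l:V\rightharpoonup\{\square,\triangle\}$, a total edge labelling $m:E\to\{\square\}$ and a partial rootedness function $p:V\rightharpoonup\{0,1\}$ ($1$ = rooted); it is a TLRG if $l$ and $p$ are total. Morphisms preserve sources, targets, edge labels, and node labels and rootedness wherever these are defined. A rule $L\leftarrow K\rightarrow R$ consists of TLRGs $L,R$, a graph $K$ and injective morphisms $K\to L$, $K\to R$. A match in a TLRG $G$ is an injective morphism $g:L\to G$ such that no edge of $G$ outside $g(L)$ is incident to a node of $g(L\setminus K)$. Applying the rule deletes $g(L\setminus K)$, adds $R\setminus K$ disjointly, and gives the image of every node of $K$ whose label (rootedness) is undefined in $K$ the label (rootedness) it has in $R$. $G\Rightarrow H$ means that $H$ is isomorphic to the result of applying one of the rules to $G$; $\Rightarrow^*$ allows any number of steps (zero steps: isomorphism). $H$ is a normal form of $G$ if $G\Rightarrow^*H$ and no rule is applicable to $H$. *The system.* All edges are labelled $\square$; all nodes are unrooted unless called rooted. Let $\mathcal R=\{r_0,\dots,r_4\}$, where the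 interfaces consist of the numbered nodes only, with undefined label and rootedness and without edges: - $r_0$: left, a rooted $\square$ with edges to two $\square$-nodes; right, a single rooted $\square$; empty interface. - $r_1$: left, a node 1 labelled $\square$ with an edge to a rooted $\square$, which has edges to two further $\square$-nodes; right, node 1 as a rooted $\square$ with an edge to a $\square$-node. - $r_2$: as $r_1$, except that node 1 is labelled $\triangle$ on the left. - $r_3$: left, a path $1\to2\to3$ of $\square$-nodes with 1 rooted; right, the path $1\to2\to3$ with 1 labelled $\triangle$, 2 and 3 labelled $\square$, and 2 rooted. - $r_4$: left, a node 1 labelled $\square$ with an edge to a rooted $\square$; right, node 1 as a rooted $\square$ with an edge to a $\square$-node. *Input graphs and full binary trees.* An input graph is a TLRG with exactly one rooted node and all nodes and edges labelled $\square$. $G^{\ominus}$ is $G$ with every node unrooted and everything labelled $\square$. A full binary tree is a non-empty connected graph without undirected cycles (closed undirected walks of positive length that repeat no edge; loops and parallel edges give such cycles) in which every node has at most one incoming edge, at most two outgoing edges, and either $0$ or $2$ children. *Claim.* 1. There is a constant $c$ such that every derivation from an input graph $G$ has length at most $c\,|V_G|$. In particular there is no infinite derivation from $G$, and $G$ has a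 normal form. 2. For every input graph $G$ and every normal form $H$ of $G$: $H$ is isomorphic to the graph consisting of a single rooted $\square$-node and no edges if and only if $G^{\ominus}$ is a full binary tree. 3. On input graphs of bounded degree, rewriting to a normal form takes linear time. Precisely: consider programs on a stored graph with finitely many node registers, edge registers and flags, built with sequencing, conditionals and while-loops, where one step is charged for following an edge to its source or target, testing labels, rootedness, equality, in- or outdegree, $|V|$ or $|E|$ against a constant, copying a register, setting a flag, and creating or deleting an edge or a node (only isolated nodes may be deleted); changing the label or rootedness of a node costs one step plus the current number of rooted nodes; looping over the edges with a given source (or target), or over the rooted nodes with a given label, costs one step plus the size of that set, and over the unrooted nodes with a given label one step plus $|V|$, in addition to the time spent in the loop body. Then there is a single program $B$ such that for every $b$ there are constants $k,C$ for which the following holds for every input graph $G$ all of whose nodes have degree at most $b$: (i) started on any stored copy of any $H$ with $G\Rightarrow^*H$, with any contents of the registers and flags, $B$ halts within $k$ steps and either replaces $H$ by some $H'$ with $H\Rightarrow H'$ and leaves a designated flag up, or, if $H$ is in normal form, leaves a copy of $H$ in the store and takes the flag down; (ii) repeating $B$ while the flag is up, started on any stored copy of $G$ with any contents of the registers and flags,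 halts after at most $C\,|V_G|$ steps with a normal form of $G$ in the store. -/

import Mathlib

/-! ## Graphs with partial node labels and partial rootedness -/

/-- A finite directed multigraph over the label alphabet `(LV, LE)`: the vertex labelling `l` and
the rootedness `p` are partial functions (`none` means undefined; `some true` means rooted and
`some false` means unrooted), the edge labelling `m` is total. -/
structure RGraph (LV LE : Type) where
  V : Type
  E : Type
  finV : Finite V
  finE : Finite E
  s : E → V
  t : E → V
  l : V → Option LV
  m : E → LE
  p : V → Option Bool

namespace RGraph

variable {LV LE : Type}

/-- Totally labelled and totally rooted graphs. -/
def IsTLRG (G : RGraph LV LE) : Prop :=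
  (∀ v, G.l v ≠ none) ∧ (∀ v, G.p v ≠ none)

/-- Graph morphisms preserve sources, targets, edge labels, and those node labels and rootedness
values that are defined. -/
structure Hom (G H : RGraph LV LE) where
  onV : G.V → H.V
  onE : G.E → H.E
  map_s : ∀ e, onV (G.s e) = H.s (onE e)
  map_t : ∀ e, onV (G.t e) = H.t (onE e)
  map_m : ∀ e, G.m e = H.m (onE e)
  map_l : ∀ v, G.l v ≠ none → G.l v = H.l (onV v)
  map_p : ∀ v, G.p v ≠ none → G.p v = H.p (onV v)

def Hom.Injective {G H : RGraph LV LE} (f : Hom G H) : Prop :=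
  Function.Injective f.onV ∧ Function.Injective f.onE

/-- Isomorphic graphs: there are mutually inverse morphisms. -/
def Isomorphic (G H : RGraph LV LE) : Prop :=
  ∃ (f : Hom G H) (g : Hom H G),
    Function.LeftInverse g.onV f.onV ∧ Function.RightInverse g.onV f.onV ∧
    Function.LeftInverse g.onE f.onE ∧ Function.RightInverse g.onE f.onE

/-- The number of vertices. -/
noncomputable def order (G : RGraph LV LE) : ℕ := Nat.card G.V

noncomputable def indeg (G : RGraph LV LE) (v : G.V) : ℕ := Nat.card {e : G.E // G.t e = v}

noncomputable def outdeg (G : RGraph LV LE) (v : G.V) : ℕ := Nat.card {e : G.E // G.s e = v}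

/-- The degree of a vertex; a loop counts twice. -/
noncomputable def deg (G : RGraph LV LE) (v : G.V) : ℕ := G.indeg v + G.outdeg v

/-- Every vertex has degree at most `b`. -/
def DegreeBounded (G : RGraph LV LE) (b : ℕ) : Prop := ∀ v, G.deg v ≤ b

/-- The children of a vertex: the targets of its outgoing edges. -/
def children (G : RGraph LV LE) (v : G.V) : Set G.V := {w | ∃ e, G.s e = v ∧ G.t e = w}

/-- `G.UWalk u v es`: the edge sequence `es` is an undirected walk from `u` to `v`. -/
inductive UWalk (G : RGraph LV LE) : G.V → G.V → List G.E → Prop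
  | nil (v : G.V) : UWalk G v v []
  | fwd (e : G.E) (w : G.V) (es : List G.E) :
      UWalk G (G.t e) w es → UWalk G (G.s e) w (e :: es)
  | bwd (e : G.E) (w : G.V) (es : List G.E) :
      UWalk G (G.s e) w es → UWalk G (G.t e) w (e :: es)

def Connected (G : RGraph LV LE) : Prop := ∀ u v, ∃ es, G.UWalk u v es

/-- There is an undirected cycle: a closed undirected walk with at least one edge that uses no edge
twice. Loops and pairs of parallel edges are such cycles. -/
def HasUCycle (G : RGraph LV LE) : Prop :=
  ∃ (v : G.V) (es : List G.E), es ≠ [] ∧ es.Nodup ∧ G.UWalk v v es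

def IsTree (G : RGraph LV LE) : Prop :=
  Nonempty G.V ∧ G.Connected ∧ ¬ G.HasUCycle ∧ ∀ v, G.indeg v ≤ 1

def IsBinaryTree (G : RGraph LV LE) : Prop := G.IsTree ∧ ∀ v, G.outdeg v ≤ 2

def IsFullBinaryTree (G : RGraph LV LE) : Prop :=
  G.IsBinaryTree ∧ ∀ v, (G.children v).ncard = 0 ∨ (G.children v).ncard = 2

end RGraph

/-! ## Rules and derivations -/

/-- A rule `L ← K → R`: `L` and `R` are totally labelled and totally rooted, the interface `K` may
be partially labelled and rooted, and both maps are injective morphisms. -/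
structure RRule (LV LE : Type) where
  L : RGraph LV LE
  K : RGraph LV LE
  R : RGraph LV LE
  left : RGraph.Hom K L
  right : RGraph.Hom K R
  left_inj : left.Injective
  right_inj : right.Injective
  L_total : L.IsTLRG
  R_total : R.IsTLRG

namespace RRule

variable {LV LE : Type}

/-- A match of `r` in `G`: an injective morphism `L → G` such that no edge of `G` outside the image
of `L` is incident to the image of a node of `L` outside `K` (the dangling condition). -/
structure Match (r : RRule LV LE) (G : RGraph LV LE) where
  g : RGraph.Hom r.L G
  inj : g.Injective
  dangling : ∀ e : G.E, e ∉ Set.range g.onE → ∀ x : r.L.V, x ∉ Set.range r.left.onV →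
    G.s e ≠ g.onV x ∧ G.t e ≠ g.onV x

namespace Match

variable {r : RRule LV LE} {G : RGraph LV LE} (M : r.Match G)

/-- The vertices in the image of `L` minus `K`. -/
def DelV (v : G.V) : Prop := ∃ x, x ∉ Set.range r.left.onV ∧ M.g.onV x = v

/-- The edges in the image of `L` minus `K`. -/
def DelE (e : G.E) : Prop := ∃ x, x ∉ Set.range r.left.onE ∧ M.g.onE x = e

/-- The vertex of `G` that is the image of a vertex of the interface. -/
def ofK (k : r.K.V) : G.V := M.g.onV (r.left.onV k)

theorem not_delV_ofK (k : r.K.V) : ¬ M.DelV (M.ofK k) := by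
  rintro ⟨x, hx, h⟩
  exact hx ⟨k, (M.inj.1 h).symm⟩

theorem not_delV_s (e : G.E) (he : ¬ M.DelE e) : ¬ M.DelV (G.s e) := by
  rintro ⟨x, hx, h⟩
  by_cases hr : e ∈ Set.range M.g.onE
  · obtain ⟨y, rfl⟩ := hr
    by_cases hy : y ∈ Set.range r.left.onE
    · obtain ⟨k, rfl⟩ := hy
      rw [← M.g.map_s, ← r.left.map_s] at h
      exact hx ⟨_, (M.inj.1 h).symm⟩
    · exact he ⟨y, hy, rfl⟩
  · exact (M.dangling e hr x hx).1 h.symm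

theorem not_delV_t (e : G.E) (he : ¬ M.DelE e) : ¬ M.DelV (G.t e) := by
  rintro ⟨x, hx, h⟩
  by_cases hr : e ∈ Set.range M.g.onE
  · obtain ⟨y, rfl⟩ := hr
    by_cases hy : y ∈ Set.range r.left.onE
    · obtain ⟨k, rfl⟩ := hy
      rw [← M.g.map_t, ← r.left.map_t] at h
      exact hx ⟨_, (M.inj.1 h).symm⟩
    · exact he ⟨y, hy, rfl⟩
  · exact (M.dangling e hr x hx).2 h.symm

open Classical in
/-- The intermediate graph: delete the image of `L` minus `K`, and make the images of unlabelled
nodes of `K` unlabelled and of nodes of `K` with undefined rootedness undefined in rootedness. -/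
noncomputable def intermediate : RGraph LV LE where
  V := {v : G.V // ¬ M.DelV v}
  E := {e : G.E // ¬ M.DelE e}
  finV := by
    have := G.finV
    infer_instance
  finE := by
    have := G.finE
    infer_instance
  s e := ⟨G.s e.1, M.not_delV_s e.1 e.2⟩
  t e := ⟨G.t e.1, M.not_delV_t e.1 e.2⟩
  l v := if ∃ k, r.K.l k = none ∧ M.ofK k = v.1 then none else G.l v.1
  m e := G.m e.1
  p v := if ∃ k, r.K.p k = none ∧ M.ofK k = v.1 then none else G.p v.1

open Classical in
/-- The vertex of the result graph to which a vertex of `R` is sent. -/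
noncomputable def comatchV (x : r.R.V) :
    M.intermediate.V ⊕ {x : r.R.V // x ∉ Set.range r.right.onV} :=
  if h : ∃ k, r.right.onV k = x then Sum.inl ⟨M.ofK h.choose, M.not_delV_ofK _⟩
  else Sum.inr ⟨x, h⟩

open Classical in
/-- The result graph: add `R` minus `K` disjointly to the intermediate graph, and give the images of
the unlabelled nodes of `K` (and those with undefined rootedness) the label (the rootedness) they
have in `R`. -/
noncomputable def result : RGraph LV LE where
  V := M.intermediate.V ⊕ {x : r.R.V // x ∉ Set.range r.right.onV}
  E := M.intermediate.E ⊕ {x : r.R.E // x ∉ Set.range r.right.onE}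
  finV := by
    have := M.intermediate.finV
    have := r.R.finV
    infer_instance
  finE := by
    have := M.intermediate.finE
    have := r.R.finE
    infer_instance
  s := Sum.elim (fun e => Sum.inl (M.intermediate.s e)) (fun e => M.comatchV (r.R.s e.1))
  t := Sum.elim (fun e => Sum.inl (M.intermediate.t e)) (fun e => M.comatchV (r.R.t e.1))
  l := Sum.elim
    (fun v => if h : ∃ k, r.K.l k = none ∧ M.ofK k = v.1 then r.R.l (r.right.onV h.choose)
      else M.intermediate.l v)
    (fun x => r.R.l x.1)
  m := Sum.elim M.intermediate.m (fun e => r.R.m e.1)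
  p := Sum.elim
    (fun v => if h : ∃ k, r.K.p k = none ∧ M.ofK k = v.1 then r.R.p (r.right.onV h.choose)
      else M.intermediate.p v)
    (fun x => r.R.p x.1)

end Match

end RRule

namespace RGraph

variable {LV LE : Type}

/-- `H` is directly derived from the totally labelled, totally rooted graph `G` by one of the rules
in `rules`; results are taken up to isomorphism. -/
def DirectlyDerives (rules : Set (RRule LV LE)) (G H : RGraph LV LE) : Prop :=
  G.IsTLRG ∧ ∃ r ∈ rules, ∃ M : r.Match G, M.result.Isomorphic H

/-- `DerivesIn rules n G H`: there is a derivation of length `n` from `G` to `H`. -/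
inductive DerivesIn (rules : Set (RRule LV LE)) : ℕ → RGraph LV LE → RGraph LV LE → Prop
  | zero {G H : RGraph LV LE} : G.Isomorphic H → DerivesIn rules 0 G H
  | succ {n : ℕ} {G H H' : RGraph LV LE} :
      DerivesIn rules n G H → DirectlyDerives rules H H' → DerivesIn rules (n + 1) G H'

def Derives (rules : Set (RRule LV LE)) (G H : RGraph LV LE) : Prop := ∃ n, DerivesIn rules n G H

def InNormalForm (rules : Set (RRule LV LE)) (H : RGraph LV LE) : Prop :=
  ∀ H', ¬ DirectlyDerives rules H H'

/-- `H` is a normal form of `G`. -/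
def IsNormalFormOf (rules : Set (RRule LV LE)) (H G : RGraph LV LE) : Prop :=
  Derives rules G H ∧ InNormalForm rules H

end RGraph

/-! ## The full binary tree system -/

/-- Node labels: the square and the triangle. -/
inductive NLabel
  | box
  | tri
  deriving DecidableEq

/-- Edge labels: only the square. -/
inductive ELabel
  | box
  deriving DecidableEq

/-- The graph with vertices `Fin n` and edges `Fin k`, all edges labelled by the square. -/
def finRGraph (n k : ℕ) (s t : Fin k → Fin n) (l : Fin n → Option NLabel)
    (p : Fin n → Option Bool) : RGraph NLabel ELabel where
  V := Fin n
  E := Fin k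
  finV := inferInstance
  finE := inferInstance
  s := s
  t := t
  l := l
  m := fun _ => ELabel.box
  p := p

/-- The interface with `n` unlabelled nodes of undefined rootedness and without edges. -/
def blankRGraph (n : ℕ) : RGraph NLabel ELabel :=
  finRGraph n 0 Fin.elim0 Fin.elim0 (fun _ => none) (fun _ => none)

/-- Morphisms out of a blank interface are arbitrary maps of nodes. -/
def blankHom {n : ℕ} (G : RGraph NLabel ELabel) (f : Fin n → G.V) :
    RGraph.Hom (blankRGraph n) G where
  onV := f
  onE := fun e => Fin.elim0 e
  map_s := fun e => Fin.elim0 e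
  map_t := fun e => Fin.elim0 e
  map_m := fun e => Fin.elim0 e
  map_l := fun _ h => absurd rfl h
  map_p := fun _ h => absurd rfl h

theorem blankHom_injective {n : ℕ} (G : RGraph NLabel ELabel) (f : Fin n → G.V)
    (hf : Function.Injective f) : (blankHom G f).Injective :=
  ⟨hf, fun e => Fin.elim0 e⟩

/-- A rule with blank interface on the nodes `0, …, n - 1`, which keep their number on both sides.
-/
def blankRule (n a b c d : ℕ) (hL : n ≤ a) (hR : n ≤ c)
    (sL tL : Fin b → Fin a) (lL : Fin a → NLabel) (pL : Fin a → Bool)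
    (sR tR : Fin d → Fin c) (lR : Fin c → NLabel) (pR : Fin c → Bool) :
    RRule NLabel ELabel where
  L := finRGraph a b sL tL (fun v => some (lL v)) (fun v => some (pL v))
  K := blankRGraph n
  R := finRGraph c d sR tR (fun v => some (lR v)) (fun v => some (pR v))
  left := blankHom _ (Fin.castLE hL)
  right := blankHom _ (Fin.castLE hR)
  left_inj := blankHom_injective _ _ (Fin.castLE_injective hL)
  right_inj := blankHom_injective _ _ (Fin.castLE_injective hR)
  L_total := ⟨fun _ => Option.some_ne_none _, fun _ => Option.some_ne_none _⟩
  R_total := ⟨fun _ => Option.some_ne_none _, fun _ => Option.some_ne_none _⟩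

namespace FBT

open NLabel

/-- Left: a rooted square with two unrooted square children. Empty interface. Right: a rooted
square. -/
def r0 : RRule NLabel ELabel :=
  blankRule 0 3 2 1 0 (by decide) (by decide)
    ![0, 0] ![1, 2] ![box, box, box] ![true, false, false]
    ![] ![] ![box] ![true]

/-- Left: an unrooted node `0` labelled `x`, its child, a rooted square, and two unrooted square
children of the latter. Interface: the node `0`. Right: the node `0`, now a rooted square, with an
unrooted square child. -/
def prune (x : NLabel) : RRule NLabel ELabel :=
  blankRule 1 4 3 2 1 (by decide) (by decide)
    ![0, 1, 1] ![1, 2, 3] ![x, box, box, box] ![false, true, false, false]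
    ![0] ![1] ![box, box] ![true, false]

def r1 : RRule NLabel ELabel := prune box

def r2 : RRule NLabel ELabel := prune tri

/-- A directed path `0 → 1 → 2` of squares; the root moves from `0` to `1`, and `0` becomes a
triangle. Interface: all three nodes. -/
def r3 : RRule NLabel ELabel :=
  blankRule 3 3 2 3 2 (by decide) (by decide)
    ![0, 1] ![1, 2] ![box, box, box] ![true, false, false]
    ![0, 1] ![1, 2] ![tri, box, box] ![false, true, false]

/-- An edge `0 → 1` between squares; the root moves from `1` to `0`. Interface: the node `0`. -/
def r4 : RRule NLabel ELabel :=
  blankRule 1 2 1 2 1 (by decide) (by decide)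
    ![0] ![1] ![box, box] ![false, true]
    ![0] ![1] ![box, box] ![true, false]

def rules : Set (RRule NLabel ELabel) := {r0, r1, r2, r3, r4}

/-- The graph with a single node, a rooted square, and no edges. -/
def single : RGraph NLabel ELabel :=
  finRGraph 1 0 Fin.elim0 Fin.elim0 (fun _ => some box) (fun _ => some true)

/-- Input graphs: exactly one root, and all nodes and edges labelled by the square. -/
def IsInput (G : RGraph NLabel ELabel) : Prop :=
  G.IsTLRG ∧ (∃! v, G.p v = some true) ∧ (∀ v, G.l v = some box) ∧ ∀ e, G.m e = ELabel.box

/-- The underlying unlabelled graph: every node unrooted, everything labelled by the square. -/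
def unlabelled (G : RGraph NLabel ELabel) : RGraph NLabel ELabel where
  V := G.V
  E := G.E
  finV := G.finV
  finE := G.finE
  s := G.s
  t := G.t
  l := fun _ => some box
  m := fun _ => ELabel.box
  p := fun _ => some false

end FBT

/-! ## A step-counting machine on stored graphs

A stored graph has natural numbers as names of nodes and edges. A program is a finite command over
finitely many node registers, edge registers and Boolean flags; it cannot compute with names, only
follow them and test them for equality. Elementary operations take one step, except that changing
the label or the rootedness of a node costs one further step for each rooted node (the lists of
rooted nodes are kept in the order of their names; new names are always the largest ones). Listing a
set of nodes or edges takes a number of steps linear in the size of the set (for unrooted nodes: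
linear in the number of all nodes). -/

namespace GraphMachine

/-- A graph in memory. The functions are only meaningful on the present nodes and edges. -/
structure Store (LV LE : Type) where
  nodes : Finset ℕ
  edges : Finset ℕ
  src : ℕ → ℕ
  tgt : ℕ → ℕ
  lab : ℕ → LV
  edgeLab : ℕ → LE
  root : ℕ → Bool

namespace Store

variable {LV LE : Type}

/-- The store holds a copy of `G`, under arbitrary names. -/
def Represents (S : Store LV LE) (G : RGraph LV LE) : Prop :=
  ∃ (f : G.V → ℕ) (h : G.E → ℕ), Function.Injective f ∧ Function.Injective h ∧
    Set.range f = ↑S.nodes ∧ Set.range h = ↑S.edges ∧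
    (∀ e, S.src (h e) = f (G.s e)) ∧ (∀ e, S.tgt (h e) = f (G.t e)) ∧
    (∀ e, S.edgeLab (h e) = G.m e) ∧
    (∀ v, G.l v = some (S.lab (f v))) ∧ (∀ v, G.p v = some (S.root (f v)))

/-- The edges with source `v`, in the order of their names. -/
def outEdges (S : Store LV LE) (v : ℕ) : List ℕ :=
  (S.edges.filter (fun e => S.src e = v)).sort (· ≤ ·)

/-- The edges with target `v`, in the order of their names. -/
def inEdges (S : Store LV LE) (v : ℕ) : List ℕ :=
  (S.edges.filter (fun e => S.tgt e = v)).sort (· ≤ ·)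

/-- The nodes with label `a` and rootedness `b`, in the order of their names. -/
def nodesWith [DecidableEq LV] (S : Store LV LE) (a : LV) (b : Bool) : List ℕ :=
  (S.nodes.filter (fun v => S.lab v = a ∧ S.root v = b)).sort (· ≤ ·)

/-- The number of rooted nodes. -/
def numRooted (S : Store LV LE) : ℕ := (S.nodes.filter (fun v => S.root v = true)).card

/-- A name larger than all names in use. -/
def fresh (A : Finset ℕ) : ℕ := A.sup id + 1

end Store

/-- The atomic tests; arguments are indices of registers or flags, labels, and numerals. -/
inductive Test (LV LE : Type)
  | flag (b : ℕ)
  | sameNode (x y : ℕ)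
  | sameEdge (e f : ℕ)
  | hasLabel (x : ℕ) (a : LV)
  | hasEdgeLabel (e : ℕ) (a : LE)
  | isRoot (x : ℕ)
  | indegEq (x k : ℕ)
  | outdegEq (x k : ℕ)
  | numNodesEq (k : ℕ)
  | numEdgesEq (k : ℕ)

/-- The commands; arguments `x y` are node registers, `e` is an edge register, `b` a flag. -/
inductive Cmd (LV LE : Type)
  | skip
  | setFlag (b : ℕ) (c : Bool)
  | copyNode (x y : ℕ)
  | copyEdge (e f : ℕ)
  | source (x e : ℕ)
  | target (x e : ℕ)
  | relabel (x : ℕ) (a : LV)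
  | setRoot (x : ℕ) (c : Bool)
  | newNode (x : ℕ) (a : LV) (c : Bool)
  | newEdge (e x y : ℕ) (a : LE)
  | delNode (x : ℕ)
  | delEdge (e : ℕ)
  | seq (P Q : Cmd LV LE)
  | ite (T : Test LV LE) (P Q : Cmd LV LE)
  | while (T : Test LV LE) (P : Cmd LV LE)
  | forNodes (x : ℕ) (a : LV) (c : Bool) (P : Cmd LV LE)
  | forOut (e x : ℕ) (P : Cmd LV LE)
  | forIn (e x : ℕ) (P : Cmd LV LE)

/-- A machine state: the stored graph and the contents of the registers and flags. -/
structure State (LV LE : Type) where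
  store : Store LV LE
  nreg : ℕ → ℕ
  ereg : ℕ → ℕ
  flag : ℕ → Bool

namespace State

variable {LV LE : Type}

def setNode (σ : State LV LE) (x v : ℕ) : State LV LE :=
  { σ with nreg := Function.update σ.nreg x v }

def setEdge (σ : State LV LE) (e v : ℕ) : State LV LE :=
  { σ with ereg := Function.update σ.ereg e v }

end State

def Test.Holds {LV LE : Type} (σ : State LV LE) : Test LV LE → Prop
  | .flag b => σ.flag b = true
  | .sameNode x y => σ.nreg x = σ.nreg y
  | .sameEdge e f => σ.ereg e = σ.ereg f
  | .hasLabel x a => σ.store.lab (σ.nreg x) = a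
  | .hasEdgeLabel e a => σ.store.edgeLab (σ.ereg e) = a
  | .isRoot x => σ.store.root (σ.nreg x) = true
  | .indegEq x k => (σ.store.inEdges (σ.nreg x)).length = k
  | .outdegEq x k => (σ.store.outEdges (σ.nreg x)).length = k
  | .numNodesEq k => σ.store.nodes.card = k
  | .numEdgesEq k => σ.store.edges.card = k

/-- The time to list the nodes of a given label and rootedness `c`: linear in the size of the list
for rooted nodes, linear in the number of all nodes for unrooted ones. -/
def listTime {LV LE : Type} [DecidableEq LV] (S : Store LV LE) (a : LV) (c : Bool) : ℕ :=
  if c then (S.nodesWith a c).length else S.nodes.card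

mutual

/-- `Exec P σ t σ'`: started in the state `σ`, the command `P` halts in the state `σ'` after exactly
`t` steps. The semantics is deterministic. Updates of absent nodes or edges, and the deletion of a
node that is incident to an edge, are not executable. Loops over a set of nodes or edges use the
list as it is when the loop is entered. -/
inductive Exec {LV LE : Type} [DecidableEq LV] :
    Cmd LV LE → State LV LE → ℕ → State LV LE → Prop
  | skip (σ : State LV LE) : Exec .skip σ 1 σ
  | setFlag (σ : State LV LE) (b : ℕ) (c : Bool) :
      Exec (.setFlag b c) σ 1 { σ with flag := Function.update σ.flag b c }
  | copyNode (σ : State LV LE) (x y : ℕ) :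
      Exec (.copyNode x y) σ 1 (σ.setNode x (σ.nreg y))
  | copyEdge (σ : State LV LE) (e f : ℕ) :
      Exec (.copyEdge e f) σ 1 (σ.setEdge e (σ.ereg f))
  | source (σ : State LV LE) (x e : ℕ) :
      Exec (.source x e) σ 1 (σ.setNode x (σ.store.src (σ.ereg e)))
  | target (σ : State LV LE) (x e : ℕ) :
      Exec (.target x e) σ 1 (σ.setNode x (σ.store.tgt (σ.ereg e)))
  | relabel (σ : State LV LE) (x : ℕ) (a : LV) :
      σ.nreg x ∈ σ.store.nodes →
      Exec (.relabel x a) σ (1 + σ.store.numRooted)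
        { σ with store :=
          { σ.store with lab := Function.update σ.store.lab (σ.nreg x) a } }
  | setRoot (σ : State LV LE) (x : ℕ) (c : Bool) :
      σ.nreg x ∈ σ.store.nodes →
      Exec (.setRoot x c) σ (1 + σ.store.numRooted)
        { σ with store :=
          { σ.store with root := Function.update σ.store.root (σ.nreg x) c } }
  | newNode (σ : State LV LE) (x : ℕ) (a : LV) (c : Bool) (v : ℕ) :
      v = Store.fresh σ.store.nodes →
      Exec (.newNode x a c) σ 1
        { σ with
          nreg := Function.update σ.nreg x v
          store :=
            { σ.store with
              nodes := insert v σ.store.nodes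
              lab := Function.update σ.store.lab v a
              root := Function.update σ.store.root v c } }
  | newEdge (σ : State LV LE) (e x y : ℕ) (a : LE) (d : ℕ) :
      d = Store.fresh σ.store.edges →
      σ.nreg x ∈ σ.store.nodes → σ.nreg y ∈ σ.store.nodes →
      Exec (.newEdge e x y a) σ 1
        { σ with
          ereg := Function.update σ.ereg e d
          store :=
            { σ.store with
              edges := insert d σ.store.edges
              src := Function.update σ.store.src d (σ.nreg x)
              tgt := Function.update σ.store.tgt d (σ.nreg y)
              edgeLab := Function.update σ.store.edgeLab d a } }
  | delNode (σ : State LV LE) (x : ℕ) :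
      σ.nreg x ∈ σ.store.nodes →
      (∀ d ∈ σ.store.edges, σ.store.src d ≠ σ.nreg x ∧ σ.store.tgt d ≠ σ.nreg x) →
      Exec (.delNode x) σ 1
        { σ with store := { σ.store with nodes := σ.store.nodes.erase (σ.nreg x) } }
  | delEdge (σ : State LV LE) (e : ℕ) :
      σ.ereg e ∈ σ.store.edges →
      Exec (.delEdge e) σ 1
        { σ with store := { σ.store with edges := σ.store.edges.erase (σ.ereg e) } }
  | seq (P Q : Cmd LV LE) (σ σ' σ'' : State LV LE) (t t' : ℕ) :
      Exec P σ t σ' → Exec Q σ' t' σ'' → Exec (.seq P Q) σ (t + t') σ''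
  | iteTrue (T : Test LV LE) (P Q : Cmd LV LE) (σ σ' : State LV LE) (t : ℕ) :
      T.Holds σ → Exec P σ t σ' → Exec (.ite T P Q) σ (1 + t) σ'
  | iteFalse (T : Test LV LE) (P Q : Cmd LV LE) (σ σ' : State LV LE) (t : ℕ) :
      ¬ T.Holds σ → Exec Q σ t σ' → Exec (.ite T P Q) σ (1 + t) σ'
  | whileTrue (T : Test LV LE) (P : Cmd LV LE) (σ σ' σ'' : State LV LE) (t t' : ℕ) :
      T.Holds σ → Exec P σ t σ' → Exec (.while T P) σ' t' σ'' →
      Exec (.while T P) σ (1 + t + t') σ''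
  | whileFalse (T : Test LV LE) (P : Cmd LV LE) (σ : State LV LE) :
      ¬ T.Holds σ → Exec (.while T P) σ 1 σ
  | forNodes (x : ℕ) (a : LV) (c : Bool) (P : Cmd LV LE) (σ σ' : State LV LE) (t : ℕ) :
      ExecNodes x P (σ.store.nodesWith a c) σ t σ' →
      Exec (.forNodes x a c P) σ (1 + listTime σ.store a c + t) σ'
  | forOut (e x : ℕ) (P : Cmd LV LE) (σ σ' : State LV LE) (t : ℕ) :
      ExecEdges e P (σ.store.outEdges (σ.nreg x)) σ t σ' →
      Exec (.forOut e x P) σ (1 + (σ.store.outEdges (σ.nreg x)).length + t) σ'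
  | forIn (e x : ℕ) (P : Cmd LV LE) (σ σ' : State LV LE) (t : ℕ) :
      ExecEdges e P (σ.store.inEdges (σ.nreg x)) σ t σ' →
      Exec (.forIn e x P) σ (1 + (σ.store.inEdges (σ.nreg x)).length + t) σ'

/-- Execute `P` once for each entry of a list, with the entry in the node register `x`. -/
inductive ExecNodes {LV LE : Type} [DecidableEq LV] :
    ℕ → Cmd LV LE → List ℕ → State LV LE → ℕ → State LV LE → Prop
  | nil (x : ℕ) (P : Cmd LV LE) (σ : State LV LE) : ExecNodes x P [] σ 0 σ
  | cons (x : ℕ) (P : Cmd LV LE) (v : ℕ) (vs : List ℕ) (σ σ' σ'' : State LV LE) (t t' : ℕ) :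
      Exec P (σ.setNode x v) t σ' → ExecNodes x P vs σ' t' σ'' →
      ExecNodes x P (v :: vs) σ (t + t') σ''

/-- Execute `P` once for each entry of a list, with the entry in the edge register `e`. -/
inductive ExecEdges {LV LE : Type} [DecidableEq LV] :
    ℕ → Cmd LV LE → List ℕ → State LV LE → ℕ → State LV LE → Prop
  | nil (e : ℕ) (P : Cmd LV LE) (σ : State LV LE) : ExecEdges e P [] σ 0 σ
  | cons (e : ℕ) (P : Cmd LV LE) (d : ℕ) (ds : List ℕ) (σ σ' σ'' : State LV LE) (t t' : ℕ) :
      Exec P (σ.setEdge e d) t σ' → ExecEdges e P ds σ' t' σ'' →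
      ExecEdges e P (d :: ds) σ (t + t') σ''

end

/-- Raise the flag `0`, then repeat `B` as long as this flag is up. -/
def loop {LV LE : Type} (B : Cmd LV LE) : Cmd LV LE :=
  .seq (.setFlag 0 true) (.while (.flag 0) B)

/-- On every stored copy of `H` and for all register contents, `B` halts within `k` steps; it either
replaces `H` by a graph directly derived from it and leaves the flag `0` up, or, if `H` is in normal
form, leaves `H` in the store and takes the flag `0` down. -/
def PerformsStepWithin {LV LE : Type} [DecidableEq LV] (rules : Set (RRule LV LE))
    (B : Cmd LV LE) (k : ℕ) (H : RGraph LV LE) : Prop :=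
  ∀ σ : State LV LE, σ.store.Represents H →
    ∃ (t : ℕ) (σ' : State LV LE), Exec B σ t σ' ∧ t ≤ k ∧
      ((σ'.flag 0 = true ∧ ∃ H', H.DirectlyDerives rules H' ∧ σ'.store.Represents H') ∨
       (σ'.flag 0 = false ∧ H.InNormalForm rules ∧ σ'.store.Represents H))

end GraphMachine

/-! ## Rules with blank interface: matches and results -/

-- Every right-hand side embeds into its left-hand side over the interface, so a step only deletes
-- (nothing, or two leaves with their edges), moves the root and resets one label. On graphs with a
-- single, square root the rules become local moves at the root `v` (`directlyDerives_iff`). A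
-- cherry at `v` is pruned if `v` has at most one incoming edge, and the root goes to the parent, if
-- any, which becomes a square. Along a path of three squares the root descends by one edge and
-- leaves a triangle. From a childless `v` with a single, square parent it ascends. This is a
-- depth-first search in which triangles mark the way back.
--
-- Length: pruning and descending lower the number of squares, while ascending keeps it. Ascending
-- needs a root without exit, that is, childless and with an incoming edge; but every step leaves a
-- root with an exit (`IsReduct.isMarkedAt`). So only the first step can ascend, and a derivation
-- has length at most |V| + 1.
--
-- Correctness: the leaves of a cherry have no further incident edges, so removing them neither
-- creates nor destroys a full binary tree, and the other steps keep the underlying graph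
-- (`IsReduct.isRankedTree_iff`). Thus an input is a full binary tree iff its normal form is, and it
-- remains to see that a normal form that is a full binary tree is a single node
-- (`isomorphic_single`). From each triangle an edge leads to a triangle or to the root, so in a
-- tree no triangle lies below the root. Hence a root with a grandchild can descend, and a root with
-- two leaf children can be pruned. A childless root with a parent has no exit, so there are no
-- triangles and it can ascend. For these arguments trees are described by unique incoming edges and
-- a rank that grows along edges (`isFullBinaryTree_iff`).
--
-- Time: the root is the only rooted node, so it is listed in constant time, and everything that
-- decides about a step lies within distance two of it. Degree bounds pass to derived graphs, so
-- `stepCmd` needs a number of steps quadratic in `b`, and the linear length bound does the rest.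

section BlankRule

variable {n a b c d : ℕ} {hL : n ≤ a} {hR : n ≤ c} {sL tL : Fin b → Fin a} {lL : Fin a → NLabel}
  {pL : Fin a → Bool} {sR tR : Fin d → Fin c} {lR : Fin c → NLabel} {pR : Fin c → Bool}
  {G : RGraph NLabel ELabel}

/-- The maps `gV`, `gE` are a match in `G` of a rule with blank interface on the nodes below `n` and
with the given left-hand side. -/
structure IsBlankMatch (n : ℕ) (sL tL : Fin b → Fin a) (lL : Fin a → NLabel) (pL : Fin a → Bool)
    (G : RGraph NLabel ELabel) (gV : Fin a → G.V) (gE : Fin b → G.E) : Prop where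
  injV : Function.Injective gV
  injE : Function.Injective gE
  map_s : ∀ e, gV (sL e) = G.s (gE e)
  map_t : ∀ e, gV (tL e) = G.t (gE e)
  map_l : ∀ i, G.l (gV i) = some (lL i)
  map_p : ∀ i, G.p (gV i) = some (pL i)
  dangling : ∀ f, f ∉ Set.range gE → ∀ i : Fin a, n ≤ i.1 → G.s f ≠ gV i ∧ G.t f ≠ gV i

/-- The maps `φ`, `ψ` exhibit `H` as the graph that arises from `G` by deleting the nodes of `gV` and
the edges of `gE` outside `ρ` and `ρE`, and labelling and rooting the nodes of `gV ∘ ρ`. -/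
structure IsBlankResult (G H : RGraph NLabel ELabel) (gV : Fin a → G.V) (gE : Fin b → G.E)
    (ρ : Fin c → Fin a) (ρE : Fin d → Fin b) (lR : Fin c → NLabel) (pR : Fin c → Bool)
    (φ : H.V → G.V) (ψ : H.E → G.E) : Prop where
  injV : Function.Injective φ
  injE : Function.Injective ψ
  rangeV : ∀ w, w ∈ Set.range φ ↔ ∀ i, gV i = w → i ∈ Set.range ρ
  rangeE : ∀ f, f ∈ Set.range ψ ↔ ∀ i, gE i = f → i ∈ Set.range ρE
  map_s : ∀ e, φ (H.s e) = G.s (ψ e)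
  map_t : ∀ e, φ (H.t e) = G.t (ψ e)
  labels : ∀ w x, φ w = gV (ρ x) → H.l w = some (lR x) ∧ H.p w = some (pR x)
  labels_of_ne : ∀ w, (∀ x, φ w ≠ gV (ρ x)) → H.l w = G.l (φ w) ∧ H.p w = G.p (φ w)

/-- The match given by its two component maps. -/
def blankMatch {gV : Fin a → G.V} {gE : Fin b → G.E} (h : IsBlankMatch n sL tL lL pL G gV gE) :
    (blankRule n a b c d hL hR sL tL lL pL sR tR lR pR).Match G where
  g :=
    { onV := gV
      onE := gE
      map_s := h.map_s
      map_t := h.map_t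
      map_m := fun _ => rfl
      map_l := fun i _ => (h.map_l i).symm
      map_p := fun i _ => (h.map_p i).symm }
  inj := ⟨h.injV, h.injE⟩
  dangling := fun e he i hi => h.dangling e he i (by
    by_contra hn
    exact hi ⟨(⟨i.1, not_le.1 hn⟩ : Fin n), rfl⟩)

theorem isBlankMatch (M : (blankRule n a b c d hL hR sL tL lL pL sR tR lR pR).Match G) :
    IsBlankMatch n sL tL lL pL G M.g.onV M.g.onE where
  injV := M.inj.1
  injE := M.inj.2
  map_s := M.g.map_s
  map_t := M.g.map_t
  map_l i := (M.g.map_l i (Option.some_ne_none _)).symm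
  map_p i := (M.g.map_p i (Option.some_ne_none _)).symm
  dangling f hf i hi := M.dangling f hf i (by
    rintro ⟨k, rfl⟩
    exact absurd k.2 (not_lt.2 hi))

/-- If the right-hand side of a rule with blank interface embeds into the left-hand side over the
interface, then the result embeds into the host graph. -/
theorem exists_embedding_result
    (M : (blankRule n a b c d hL hR sL tL lL pL sR tR lR pR).Match G)
    (ρ : Fin c → Fin a) (ρE : Fin d → Fin b) (hρ : Function.Injective ρ)
    (hρE : Function.Injective ρE) (hs : ∀ e, ρ (sR e) = sL (ρE e))
    (ht : ∀ e, ρ (tR e) = tL (ρE e)) (hK : ∀ i, ρ (Fin.castLE hR i) = Fin.castLE hL i) :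
    ∃ (φ : M.result.V → G.V) (ψ : M.result.E → G.E),
      IsBlankResult G M.result M.g.onV M.g.onE ρ ρE lR pR φ ψ := by
  -- Right-hand nodes outside the interface sit over deleted nodes. This allows each new node to be
  -- identified with the deleted node that it replaces.
  have hout : ∀ x, x ∉ Set.range (Fin.castLE hR) → ρ x ∉ Set.range (Fin.castLE hL) := by
    rintro x hx ⟨i, hi⟩
    exact hx ⟨i, hρ (by rw [hK, hi])⟩
  -- The interface has no edges, so every matched edge is deleted and the edges of the right-hand
  -- side are new copies.
  have hdelE : ∀ f, M.DelE f ↔ f ∈ Set.range M.g.onE := by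
    intro f
    constructor
    · rintro ⟨x, -, h⟩
      exact ⟨x, h⟩
    · rintro ⟨x, h⟩
      refine ⟨x, ?_, h⟩
      rintro ⟨k, -⟩
      exact Fin.elim0 k
  have hdelV : ∀ i, M.DelV (M.g.onV i) ↔ i ∉ Set.range (Fin.castLE hL) := by
    intro i
    constructor
    · rintro ⟨x, hx, h⟩
      rwa [M.inj.1 h] at hx
    · intro h
      exact ⟨i, h, rfl⟩
  let φ : M.result.V → G.V := Sum.elim (fun v => v.1) (fun x => M.g.onV (ρ x.1))
  let ψ : M.result.E → G.E := Sum.elim (fun e => e.1) (fun x => M.g.onE (ρE x.1))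
  have hco : ∀ x : Fin c, φ (M.comatchV x) = M.g.onV (ρ x) := by
    intro x
    unfold RRule.Match.comatchV
    split_ifs with h
    · have h1 := h.choose_spec
      exact congrArg M.g.onV ((hK h.choose).symm.trans (congrArg ρ h1))
    · rfl
  refine ⟨φ, ψ, ⟨?_, ?_, ?_, ?_, ?_, ?_, ?_, ?_⟩⟩
  · rintro (⟨v, hv⟩ | ⟨x, hx⟩) (⟨w, hw⟩ | ⟨y, hy⟩) h
    · exact congrArg Sum.inl (Subtype.ext h)
    · change v = M.g.onV (ρ y) at h
      exact absurd ((hdelV _).2 (hout y hy)) (h ▸ hv)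
    · change M.g.onV (ρ x) = w at h
      exact absurd ((hdelV _).2 (hout x hx)) (h ▸ hw)
    · exact congrArg Sum.inr (Subtype.ext (hρ (M.inj.1 h)))
  · rintro (⟨v, hv⟩ | ⟨x, hx⟩) (⟨w, hw⟩ | ⟨y, hy⟩) h
    · exact congrArg Sum.inl (Subtype.ext h)
    · change v = M.g.onE (ρE y) at h
      exact absurd ((hdelE _).2 ⟨_, h.symm⟩) hv
    · change M.g.onE (ρE x) = w at h
      exact absurd ((hdelE _).2 ⟨_, h⟩) hw
    · exact congrArg Sum.inr (Subtype.ext (hρE (M.inj.2 h)))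
  · intro w
    constructor
    · rintro ⟨⟨v, hv⟩ | ⟨x, hx⟩, h⟩ i hi
      · change v = w at h
        subst h
        subst hi
        obtain ⟨k, hk⟩ := not_not.1 ((not_congr (hdelV i)).1 hv)
        exact ⟨_, (hK k).trans hk⟩
      · change M.g.onV (ρ x) = w at h
        exact ⟨x, M.inj.1 (h.trans hi.symm)⟩
    · intro h
      by_cases hw : M.DelV w
      · obtain ⟨i, hi, hiw⟩ := hw
        obtain ⟨x, hx⟩ := h i hiw
        refine ⟨Sum.inr ⟨x, ?_⟩, ?_⟩
        · rintro ⟨k, hk⟩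
          refine hi ⟨k, ?_⟩
          exact ((hK k).symm.trans (congrArg ρ hk)).trans hx
        · change M.g.onV (ρ x) = w
          rw [hx, hiw]
      · exact ⟨Sum.inl ⟨w, hw⟩, rfl⟩
  · intro f
    constructor
    · rintro ⟨⟨v, hv⟩ | ⟨x, hx⟩, h⟩ i hi
      · change v = f at h
        subst h
        exact absurd ((hdelE _).2 ⟨_, hi⟩) hv
      · change M.g.onE (ρE x) = f at h
        exact ⟨x, M.inj.2 (h.trans hi.symm)⟩
    · intro h
      by_cases hw : M.DelE f
      · obtain ⟨i, hi, hiw⟩ := hw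
        obtain ⟨x, hx⟩ := h i hiw
        refine ⟨Sum.inr ⟨x, ?_⟩, ?_⟩
        · rintro ⟨k, hk⟩
          exact Fin.elim0 k
        · change M.g.onE (ρE x) = f
          rw [hx, hiw]
      · exact ⟨Sum.inl ⟨f, hw⟩, rfl⟩
  · rintro (e | ⟨x, hx⟩)
    · rfl
    · change φ (M.comatchV (sR x)) = G.s (M.g.onE (ρE x))
      exact ((hco _).trans (congrArg M.g.onV (hs x))).trans (M.g.map_s _)
  · rintro (e | ⟨x, hx⟩)
    · rfl
    · change φ (M.comatchV (tR x)) = G.t (M.g.onE (ρE x))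
      exact ((hco _).trans (congrArg M.g.onV (ht x))).trans (M.g.map_t _)
  · rintro (⟨v, hv⟩ | ⟨y, hy⟩) x h
    · change v = M.g.onV (ρ x) at h
      subst h
      obtain ⟨k, hk⟩ := not_not.1 ((not_congr (hdelV (ρ x))).1 hv)
      have hx : x = Fin.castLE hR k := hρ (by rw [hK, hk])
      -- The result takes its label from a chosen interface node over the given one; by injectivity
      -- there is only one candidate.
      have key : ∀ k' : Fin n, M.ofK k' = M.g.onV (ρ x) → Fin.castLE hR k' = x := by
        intro k' hk'
        have : Fin.castLE hL k' = ρ x := M.inj.1 hk'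
        exact hρ (by rw [hK, this])
      have hex : ∃ k' : Fin n, (none : Option NLabel) = none ∧ M.ofK k' = M.g.onV (ρ x) :=
        ⟨k, rfl, congrArg M.g.onV hk⟩
      have hex' : ∃ k' : Fin n, (none : Option Bool) = none ∧ M.ofK k' = M.g.onV (ρ x) :=
        ⟨k, rfl, congrArg M.g.onV hk⟩
      constructor
      · refine (dif_pos hex).trans ?_
        change some (lR (Fin.castLE hR hex.choose)) = _
        rw [key _ hex.choose_spec.2]
      · refine (dif_pos hex').trans ?_
        change some (pR (Fin.castLE hR hex'.choose)) = _
        rw [key _ hex'.choose_spec.2]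
    · change M.g.onV (ρ y) = M.g.onV (ρ x) at h
      obtain rfl := hρ (M.inj.1 h)
      exact ⟨rfl, rfl⟩
  · rintro (⟨v, hv⟩ | ⟨y, hy⟩) h
    · have key : ∀ k' : Fin n, M.ofK k' ≠ v := by
        intro k' hk'
        refine h (Fin.castLE hR k') ?_
        rw [hK]
        exact hk'.symm
      have hex : ¬ ∃ k' : Fin n, (none : Option NLabel) = none ∧ M.ofK k' = v :=
        fun ⟨k, _, hk⟩ => key k hk
      have hex' : ¬ ∃ k' : Fin n, (none : Option Bool) = none ∧ M.ofK k' = v :=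
        fun ⟨k, _, hk⟩ => key k hk
      exact ⟨(dif_neg hex).trans (if_neg hex), (dif_neg hex').trans (if_neg hex')⟩
    · exact absurd rfl (h y)

end BlankRule

/-! ## Reducts -/

namespace RGraph

open Classical in
/-- The maps `φ`, `ψ` exhibit `H` as the graph that arises from `G` by deleting the nodes `D` and the
edges `F`, making `r` the only root, and labelling `z` by `a`. -/
structure IsReduct (G H : RGraph NLabel ELabel) (D : Set G.V) (F : Set G.E) (r z : G.V)
    (a : NLabel) (φ : H.V → G.V) (ψ : H.E → G.E) : Prop where
  injV : Function.Injective φ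
  injE : Function.Injective ψ
  rangeV : Set.range φ = Dᶜ
  rangeE : Set.range ψ = Fᶜ
  map_s : ∀ e, φ (H.s e) = G.s (ψ e)
  map_t : ∀ e, φ (H.t e) = G.t (ψ e)
  map_l : ∀ w, H.l w = if φ w = z then some a else G.l (φ w)
  map_p : ∀ w, H.p w = some (decide (φ w = r))

/-- Isomorphisms as bijections. -/
theorem isomorphic_of_bijective {LV LE : Type} {G H : RGraph LV LE} (f : G.V → H.V) (h : G.E → H.E)
    (hf : Function.Bijective f) (hh : Function.Bijective h)
    (hs : ∀ e, f (G.s e) = H.s (h e)) (ht : ∀ e, f (G.t e) = H.t (h e))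
    (hm : ∀ e, G.m e = H.m (h e)) (hl : ∀ v, G.l v = H.l (f v)) (hp : ∀ v, G.p v = H.p (f v)) :
    G.Isomorphic H := by
  obtain ⟨f', hf1, hf2⟩ := Function.bijective_iff_has_inverse.1 hf
  obtain ⟨h', hh1, hh2⟩ := Function.bijective_iff_has_inverse.1 hh
  refine ⟨⟨f, h, hs, ht, hm, fun v _ => hl v, fun v _ => hp v⟩,
    ⟨f', h', ?_, ?_, ?_, ?_, ?_⟩, hf1, hf2, hh1, hh2⟩
  · intro e
    apply hf.1
    rw [hs, hf2, hh2]
  · intro e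
    apply hf.1
    rw [ht, hf2, hh2]
  · intro e
    rw [hm, hh2]
  · intro v _
    rw [hl, hf2]
  · intro v _
    rw [hp, hf2]

/-- Bijections from an isomorphism of graphs whose source is totally labelled and rooted. -/
theorem Isomorphic.exists_bijective {LV LE : Type} {G H : RGraph LV LE} (hG : G.IsTLRG)
    (hi : G.Isomorphic H) :
    ∃ (f : G.V → H.V) (h : G.E → H.E), Function.Bijective f ∧ Function.Bijective h ∧
      (∀ e, f (G.s e) = H.s (h e)) ∧ (∀ e, f (G.t e) = H.t (h e)) ∧
      (∀ e, G.m e = H.m (h e)) ∧ (∀ v, G.l v = H.l (f v)) ∧ (∀ v, G.p v = H.p (f v)) := by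
  obtain ⟨f, g, h1, h2, h3, h4⟩ := hi
  exact ⟨f.onV, f.onE, ⟨h1.injective, h2.surjective⟩, ⟨h3.injective, h4.surjective⟩, f.map_s,
    f.map_t, f.map_m, fun v => f.map_l v (hG.1 v), fun v => f.map_p v (hG.2 v)⟩

theorem Isomorphic.refl {LV LE : Type} (G : RGraph LV LE) : G.Isomorphic G :=
  isomorphic_of_bijective id id Function.bijective_id Function.bijective_id
    (fun _ => rfl) (fun _ => rfl) (fun _ => rfl) (fun _ => rfl) (fun _ => rfl)

theorem Isomorphic.symm {LV LE : Type} {G H : RGraph LV LE} (h : G.Isomorphic H) :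
    H.Isomorphic G := by
  obtain ⟨f, g, h1, h2, h3, h4⟩ := h
  exact ⟨g, f, h2, h1, h4, h3⟩

variable {G H H' : RGraph NLabel ELabel} {D : Set G.V} {F : Set G.E} {r z : G.V} {a : NLabel}

/-- Both graphs are identified with the surviving part of `G`, with labels and root prescribed by
the same data. Edge labels need no argument because there is only one. -/
theorem IsReduct.isomorphic {φ : H.V → G.V} {ψ : H.E → G.E} {φ' : H'.V → G.V} {ψ' : H'.E → G.E}
    (h : IsReduct G H D F r z a φ ψ) (h' : IsReduct G H' D F r z a φ' ψ') : H.Isomorphic H' := by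
  have hV : ∀ w, ∃ w', φ' w' = φ w := by
    intro w
    have : φ w ∈ Set.range φ' := by
      rw [h'.rangeV, ← h.rangeV]
      exact ⟨w, rfl⟩
    exact this
  have hE : ∀ e, ∃ e', ψ' e' = ψ e := by
    intro w
    have : ψ w ∈ Set.range ψ' := by
      rw [h'.rangeE, ← h.rangeE]
      exact ⟨w, rfl⟩
    exact this
  choose f hf using hV
  choose k hk using hE
  refine isomorphic_of_bijective f k ⟨?_, ?_⟩ ⟨?_, ?_⟩ ?_ ?_ (fun _ => rfl) ?_ ?_
  · intro x y hxy
    apply h.injV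
    rw [← hf, ← hf, hxy]
  · intro y
    have : φ' y ∈ Set.range φ := by
      rw [h.rangeV, ← h'.rangeV]
      exact ⟨y, rfl⟩
    obtain ⟨x, hx⟩ := this
    exact ⟨x, h'.injV (by rw [hf, hx])⟩
  · intro x y hxy
    apply h.injE
    rw [← hk, ← hk, hxy]
  · intro y
    have : ψ' y ∈ Set.range ψ := by
      rw [h.rangeE, ← h'.rangeE]
      exact ⟨y, rfl⟩
    obtain ⟨x, hx⟩ := this
    exact ⟨x, h'.injE (by rw [hk, hx])⟩
  · intro e
    apply h'.injV
    rw [hf, h.map_s, h'.map_s, hk]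
  · intro e
    apply h'.injV
    rw [hf, h.map_t, h'.map_t, hk]
  · intro v
    rw [h.map_l, h'.map_l, hf]
  · intro v
    rw [h.map_p, h'.map_p, hf]

/-- There is exactly one root, `v`; it is a square, and all labels are defined. -/
structure RootedAt (G : RGraph NLabel ELabel) (v : G.V) : Prop where
  l_ne_none : ∀ w, G.l w ≠ none
  l_root : G.l v = some NLabel.box
  p_root : G.p v = some true
  p_of_ne : ∀ w, w ≠ v → G.p w = some false

theorem RootedAt.isTLRG {v : G.V} (h : RootedAt G v) : G.IsTLRG := by
  refine ⟨h.l_ne_none, fun w => ?_⟩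
  by_cases hw : w = v
  · rw [hw, h.p_root]
    simp
  · rw [h.p_of_ne w hw]
    simp

theorem RootedAt.eq_of_p {v w : G.V} (h : RootedAt G v) (hw : G.p w = some true) : w = v := by
  by_contra hne
  rw [h.p_of_ne w hne] at hw
  simp at hw

open Classical in
theorem IsReduct.rootedAt {φ : H.V → G.V} {ψ : H.E → G.E} (h : IsReduct G H D F r z a φ ψ)
    (hl : ∀ w, G.l w ≠ none) {w : H.V} (hw : φ w = r)
    (hr : (if r = z then some a else G.l r) = some NLabel.box) : RootedAt H w := by
  refine ⟨?_, ?_, ?_, ?_⟩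
  · intro x
    rw [h.map_l]
    split_ifs
    · simp
    · exact hl _
  · rw [h.map_l, hw, ← hr]
  · rw [h.map_p, hw]
    simp
  · intro x hx
    have : φ x ≠ r := by
      rw [← hw]
      exact fun he => hx (h.injV he)
    rw [h.map_p]
    simp [this]

/-- The node `v` has exactly two outgoing edges `e₁`, `e₂`; their targets `a₁`, `a₂` are distinct
square leaves without further incoming edges. -/
structure Cherry (G : RGraph NLabel ELabel) (v a₁ a₂ : G.V) (e₁ e₂ : G.E) : Prop where
  ne : a₁ ≠ a₂
  ne₁ : v ≠ a₁
  ne₂ : v ≠ a₂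
  neE : e₁ ≠ e₂
  s₁ : G.s e₁ = v
  s₂ : G.s e₂ = v
  t₁ : G.t e₁ = a₁
  t₂ : G.t e₂ = a₂
  l₁ : G.l a₁ = some NLabel.box
  l₂ : G.l a₂ = some NLabel.box
  out : ∀ f, G.s f = v → f = e₁ ∨ f = e₂
  out₁ : ∀ f, G.s f ≠ a₁
  out₂ : ∀ f, G.s f ≠ a₂
  in₁ : ∀ f, G.t f = a₁ → f = e₁
  in₂ : ∀ f, G.t f = a₂ → f = e₂

/-- The possible steps from a graph with the single root `v`: the nodes and edges that disappear, the
new root, and the node whose label is set, with its new label. -/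
inductive Redex (G : RGraph NLabel ELabel) (v : G.V) :
    Set G.V → Set G.E → G.V → G.V → NLabel → Prop
  | top {a₁ a₂ : G.V} {e₁ e₂ : G.E} : Cherry G v a₁ a₂ e₁ e₂ → (∀ f, G.t f ≠ v) →
      Redex G v {a₁, a₂} {e₁, e₂} v v NLabel.box
  | prune {u a₁ a₂ : G.V} {e e₁ e₂ : G.E} : Cherry G v a₁ a₂ e₁ e₂ → G.s e = u → G.t e = v →
      (∀ f, G.t f = v → f = e) → Redex G v {a₁, a₂} {e₁, e₂} u u NLabel.box
  | descend {x y : G.V} {e e' : G.E} : G.s e = v → G.t e = x → G.s e' = x → G.t e' = y →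
      v ≠ x → v ≠ y → x ≠ y → G.l x = some NLabel.box → G.l y = some NLabel.box →
      Redex G v ∅ ∅ x v NLabel.tri
  | ascend {u : G.V} {e : G.E} : G.s e = u → G.t e = v → G.l u = some NLabel.box →
      (∀ f, G.s f ≠ v) → (∀ f, G.t f = v → f = e) → Redex G v ∅ ∅ u u NLabel.box

end RGraph

/-! ## The rules as redexes -/

namespace FBT

open NLabel RGraph

variable {G H : RGraph NLabel ELabel} {v : G.V}

/-- The root is deleted and recreated as the square it was, so naming it as the relabelled node
changes nothing; it only fits the common format of reducts. -/
theorem isReduct_r0 {gV : Fin 3 → G.V} {gE : Fin 2 → G.E} {φ : H.V → G.V} {ψ : H.E → G.E}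
    (hG : RootedAt G (gV 0))
    (h : IsBlankResult G H gV gE ![(0 : Fin 3)] (![] : Fin 0 → Fin 2) ![box] ![true] φ ψ) :
    IsReduct G H {gV 1, gV 2} {gE 0, gE 1} (gV 0) (gV 0) box φ ψ := by
  have hl := h.labels
  have hn := h.labels_of_ne
  simp only [Fin.forall_fin_succ, IsEmpty.forall_iff, and_true] at hl hn
  refine ⟨h.injV, h.injE, ?_, ?_, h.map_s, h.map_t, ?_, ?_⟩
  · ext w
    rw [h.rangeV]
    simp [Fin.forall_fin_succ, eq_comm]
  · ext w
    rw [h.rangeE]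
    simp [Fin.forall_fin_succ, eq_comm]
  · intro w
    split_ifs with hw
    · exact (hl w hw).1
    · exact (hn w hw).1
  · intro w
    by_cases hw : φ w = gV 0
    · simp [hw, (hl w hw).2]
    · simp [hw, (hn w hw).2, hG.p_of_ne]

/-- The old root is deleted and recreated, but it stays a square, so the parent is the only node
whose label may change. -/
theorem isReduct_prune {gV : Fin 4 → G.V} {gE : Fin 3 → G.E} {φ : H.V → G.V} {ψ : H.E → G.E}
    (hG : RootedAt G (gV 1)) (inj : Function.Injective gV)
    (h : IsBlankResult G H gV gE ![(0 : Fin 4), 1] ![(0 : Fin 3)] ![box, box] ![true, false] φ ψ) :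
    IsReduct G H {gV 2, gV 3} {gE 1, gE 2} (gV 0) (gV 0) box φ ψ := by
  have hl := h.labels
  have hn := h.labels_of_ne
  have h01 : gV 0 ≠ gV 1 := inj.ne (by decide)
  simp [Fin.forall_fin_succ] at hl hn
  refine ⟨h.injV, h.injE, ?_, ?_, h.map_s, h.map_t, ?_, ?_⟩
  · ext w
    rw [h.rangeV]
    simp [Fin.forall_fin_succ, eq_comm]
  · ext w
    rw [h.rangeE]
    simp [Fin.forall_fin_succ, eq_comm]
  · intro w
    split_ifs with hw
    · exact ((hl w).1 hw).1
    · by_cases hw1 : φ w = gV 1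
      · rw [((hl w).2 hw1).1, hw1, hG.l_root]
      · exact (hn w hw hw1).1
  · intro w
    by_cases hw : φ w = gV 0
    · simp [hw, ((hl w).1 hw).2]
    · by_cases hw1 : φ w = gV 1
      · simp [hw1, ((hl w).2 hw1).2, h01.symm]
      · simp [hw, (hn w hw hw1).2, hG.p_of_ne _ hw1]

theorem isReduct_r3 {gV : Fin 3 → G.V} {gE : Fin 2 → G.E} {φ : H.V → G.V} {ψ : H.E → G.E}
    (hG : RootedAt G (gV 0)) (inj : Function.Injective gV) (hl1 : G.l (gV 1) = some box)
    (hl2 : G.l (gV 2) = some box)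
    (h : IsBlankResult G H gV gE ![(0 : Fin 3), 1, 2] ![(0 : Fin 2), 1] ![tri, box, box]
      ![false, true, false] φ ψ) :
    IsReduct G H ∅ ∅ (gV 1) (gV 0) tri φ ψ := by
  have hl := h.labels
  have hn := h.labels_of_ne
  have h01 : gV 0 ≠ gV 1 := inj.ne (by decide)
  have h02 : gV 0 ≠ gV 2 := inj.ne (by decide)
  have h12 : gV 1 ≠ gV 2 := inj.ne (by decide)
  simp [Fin.forall_fin_succ] at hl hn
  refine ⟨h.injV, h.injE, ?_, ?_, h.map_s, h.map_t, ?_, ?_⟩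
  · ext w
    rw [h.rangeV]
    simp [Fin.forall_fin_succ]
  · ext w
    rw [h.rangeE]
    simp [Fin.forall_fin_succ]
  · intro w
    split_ifs with hw
    · exact ((hl w).1 hw).1
    · by_cases hw1 : φ w = gV 1
      · rw [((hl w).2.1 hw1).1, hw1, hl1]
      · by_cases hw2 : φ w = gV 2
        · rw [((hl w).2.2 hw2).1, hw2, hl2]
        · exact (hn w hw hw1 hw2).1
  · intro w
    by_cases hw : φ w = gV 0
    · simp [hw, ((hl w).1 hw).2, h01]
    · by_cases hw1 : φ w = gV 1
      · simp [hw1, ((hl w).2.1 hw1).2]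
      · by_cases hw2 : φ w = gV 2
        · simp [hw2, ((hl w).2.2 hw2).2, h12.symm]
        · simp [hw1, (hn w hw hw1 hw2).2, hG.p_of_ne _ hw]

theorem isReduct_r4 {gV : Fin 2 → G.V} {gE : Fin 1 → G.E} {φ : H.V → G.V} {ψ : H.E → G.E}
    (hG : RootedAt G (gV 1)) (inj : Function.Injective gV)
    (h : IsBlankResult G H gV gE ![(0 : Fin 2), 1] ![(0 : Fin 1)] ![box, box] ![true, false] φ ψ) :
    IsReduct G H ∅ ∅ (gV 0) (gV 0) box φ ψ := by
  have hl := h.labels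
  have hn := h.labels_of_ne
  have h01 : gV 0 ≠ gV 1 := inj.ne (by decide)
  simp [Fin.forall_fin_succ] at hl hn
  refine ⟨h.injV, h.injE, ?_, ?_, h.map_s, h.map_t, ?_, ?_⟩
  · ext w
    rw [h.rangeV]
    simp [Fin.forall_fin_succ]
  · ext w
    rw [h.rangeE]
    simp [Fin.forall_fin_succ]
  · intro w
    split_ifs with hw
    · exact ((hl w).1 hw).1
    · by_cases hw1 : φ w = gV 1
      · rw [((hl w).2 hw1).1, hw1, hG.l_root]
      · exact (hn w hw hw1).1
  · intro w
    by_cases hw : φ w = gV 0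
    · simp [hw, ((hl w).1 hw).2]
    · by_cases hw1 : φ w = gV 1
      · simp [hw1, ((hl w).2 hw1).2, h01.symm]
      · simp [hw, (hn w hw hw1).2, hG.p_of_ne _ hw1]

end FBT

namespace RGraph

variable {G H H' : RGraph NLabel ELabel} {D : Set G.V} {F : Set G.E} {r z : G.V} {a : NLabel}

theorem IsReduct.of_isomorphic {φ : H.V → G.V} {ψ : H.E → G.E} (h : IsReduct G H D F r z a φ ψ)
    (hl : ∀ w, G.l w ≠ none) (hi : H.Isomorphic H') :
    ∃ (φ' : H'.V → G.V) (ψ' : H'.E → G.E), IsReduct G H' D F r z a φ' ψ' := by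
  have hH : H.IsTLRG := by
    refine ⟨fun w => ?_, fun w => ?_⟩
    · rw [h.map_l]
      split_ifs
      · simp
      · exact hl _
    · rw [h.map_p]
      simp
  obtain ⟨f, k, hf, hk, hs, ht, -, hl', hp'⟩ := hi.exists_bijective hH
  obtain ⟨f', hf1, hf2⟩ := Function.bijective_iff_has_inverse.1 hf
  obtain ⟨k', hk1, hk2⟩ := Function.bijective_iff_has_inverse.1 hk
  refine ⟨φ ∘ f', ψ ∘ k', h.injV.comp hf2.injective, h.injE.comp hk2.injective, ?_, ?_, ?_, ?_,
    ?_, ?_⟩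
  · rw [hf1.surjective.range_comp, h.rangeV]
  · rw [hk1.surjective.range_comp, h.rangeE]
  · intro e
    simp only [Function.comp_apply]
    rw [← h.map_s]
    congr 1
    apply hf.1
    rw [hf2, hs, hk2]
  · intro e
    simp only [Function.comp_apply]
    rw [← h.map_t]
    congr 1
    apply hf.1
    rw [hf2, ht, hk2]
  · intro w
    have := hl' (f' w)
    rw [hf2] at this
    rw [← this, h.map_l]
    rfl
  · intro w
    have := hp' (f' w)
    rw [hf2] at this
    rw [← this, h.map_p]
    rfl

end RGraph

namespace FBT

open NLabel RGraph

-- Correspondence between matches and redexes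

variable {G H : RGraph NLabel ELabel} {v : G.V}

/-- The dangling condition is what turns the match into a cherry: an unmatched edge avoids all nodes
outside the interface, so the edges at the root and at the leaves are exactly the matched ones. -/
theorem redex_of_match_r0 (hG : RootedAt G v) {gV : Fin 3 → G.V} {gE : Fin 2 → G.E}
    (h : IsBlankMatch 0 ![0, 0] ![1, 2] ![box, box, box] ![true, false, false] G gV gE) :
    gV 0 = v ∧ Redex G v {gV 1, gV 2} {gE 0, gE 1} (gV 0) (gV 0) box := by
  have hv : gV 0 = v := hG.eq_of_p (h.map_p 0)
  subst hv
  have s0 := h.map_s 0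
  have s1 := h.map_s 1
  have t0 := h.map_t 0
  have t1 := h.map_t 1
  have h01 : gV 0 ≠ gV 1 := h.injV.ne (by decide)
  have h02 : gV 0 ≠ gV 2 := h.injV.ne (by decide)
  have h12 : gV 1 ≠ gV 2 := h.injV.ne (by decide)
  have hd : ∀ f, f = gE 0 ∨ f = gE 1 ∨
      ((G.s f ≠ gV 0 ∧ G.t f ≠ gV 0) ∧ (G.s f ≠ gV 1 ∧ G.t f ≠ gV 1) ∧
        (G.s f ≠ gV 2 ∧ G.t f ≠ gV 2)) := by
    intro f
    by_cases hf : f ∈ Set.range gE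
    · obtain ⟨i, rfl⟩ := hf
      fin_cases i <;> simp
    · exact Or.inr (Or.inr ⟨h.dangling f hf 0 (by decide), h.dangling f hf 1 (by decide),
        h.dangling f hf 2 (by decide)⟩)
  simp at s0 s1 t0 t1
  refine ⟨rfl, .top ⟨h12, h01, h02, h.injE.ne (by decide), s0.symm, s1.symm, t0.symm, t1.symm,
    h.map_l 1, h.map_l 2, ?_, ?_, ?_, ?_, ?_⟩ ?_⟩ <;> intro f <;> grind

theorem redex_of_match_prune {c : NLabel} (hG : RootedAt G v) {gV : Fin 4 → G.V}
    {gE : Fin 3 → G.E}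
    (h : IsBlankMatch 1 ![0, 1, 1] ![1, 2, 3] ![c, box, box, box] ![false, true, false, false]
      G gV gE) :
    gV 1 = v ∧ Redex G v {gV 2, gV 3} {gE 1, gE 2} (gV 0) (gV 0) box := by
  have hv : gV 1 = v := hG.eq_of_p (h.map_p 1)
  subst hv
  have s0 := h.map_s 0
  have s1 := h.map_s 1
  have s2 := h.map_s 2
  have t0 := h.map_t 0
  have t1 := h.map_t 1
  have t2 := h.map_t 2
  have h01 : gV 0 ≠ gV 1 := h.injV.ne (by decide)
  have h02 : gV 0 ≠ gV 2 := h.injV.ne (by decide)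
  have h03 : gV 0 ≠ gV 3 := h.injV.ne (by decide)
  have h12 : gV 1 ≠ gV 2 := h.injV.ne (by decide)
  have h13 : gV 1 ≠ gV 3 := h.injV.ne (by decide)
  have h23 : gV 2 ≠ gV 3 := h.injV.ne (by decide)
  have hd : ∀ f, f = gE 0 ∨ f = gE 1 ∨ f = gE 2 ∨
      ((G.s f ≠ gV 1 ∧ G.t f ≠ gV 1) ∧ (G.s f ≠ gV 2 ∧ G.t f ≠ gV 2) ∧
        (G.s f ≠ gV 3 ∧ G.t f ≠ gV 3)) := by
    intro f
    by_cases hf : f ∈ Set.range gE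
    · obtain ⟨i, rfl⟩ := hf
      fin_cases i <;> simp
    · exact Or.inr (Or.inr (Or.inr ⟨h.dangling f hf 1 (by decide), h.dangling f hf 2 (by decide),
        h.dangling f hf 3 (by decide)⟩))
  simp at s0 s1 s2 t0 t1 t2
  refine ⟨rfl, .prune (e := gE 0) ⟨h23, h12, h13, h.injE.ne (by decide), s1.symm, s2.symm, t1.symm,
    t2.symm, h.map_l 2, h.map_l 3, ?_, ?_, ?_, ?_, ?_⟩ s0.symm t0.symm ?_⟩ <;> intro f <;> grind

theorem redex_of_match_r3 (hG : RootedAt G v) {gV : Fin 3 → G.V} {gE : Fin 2 → G.E}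
    (h : IsBlankMatch 3 ![0, 1] ![1, 2] ![box, box, box] ![true, false, false] G gV gE) :
    gV 0 = v ∧ Redex G v ∅ ∅ (gV 1) (gV 0) tri := by
  have hv : gV 0 = v := hG.eq_of_p (h.map_p 0)
  subst hv
  exact ⟨rfl, .descend (h.map_s 0).symm (h.map_t 0).symm (h.map_s 1).symm (h.map_t 1).symm
    (h.injV.ne (by decide)) (h.injV.ne (by decide)) (h.injV.ne (by decide)) (h.map_l 1)
    (h.map_l 2)⟩

/-- The old root is outside the interface, so the dangling condition leaves it no incident edge but
the matched one. -/
theorem redex_of_match_r4 (hG : RootedAt G v) {gV : Fin 2 → G.V} {gE : Fin 1 → G.E}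
    (h : IsBlankMatch 1 ![0] ![1] ![box, box] ![false, true] G gV gE) :
    gV 1 = v ∧ Redex G v ∅ ∅ (gV 0) (gV 0) box := by
  have hv : gV 1 = v := hG.eq_of_p (h.map_p 1)
  subst hv
  have s0 := h.map_s 0
  have h01 : gV 0 ≠ gV 1 := h.injV.ne (by decide)
  have hd : ∀ f, f = gE 0 ∨ (G.s f ≠ gV 1 ∧ G.t f ≠ gV 1) := by
    intro f
    by_cases hf : f ∈ Set.range gE
    · obtain ⟨i, rfl⟩ := hf
      fin_cases i
      simp
    · exact Or.inr (h.dangling f hf 1 (by decide))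
  simp at s0
  refine ⟨rfl, .ascend s0.symm (h.map_t 0).symm (h.map_l 0) ?_ ?_⟩ <;> intro f <;> grind

/-- A redex accounts for every edge at a node outside the interface of the corresponding rule, which
gives the dangling condition. For `r3` this condition is vacuous. -/
theorem exists_match_of_redex (hG : RootedAt G v) {D : Set G.V} {F : Set G.E} {r z : G.V}
    {a : NLabel} (h : Redex G v D F r z a) :
    ∃ R ∈ rules, ∃ (M : R.Match G) (φ : M.result.V → G.V) (ψ : M.result.E → G.E),
      IsReduct G M.result D F r z a φ ψ := by
  cases h with
  | @top a₁ a₂ e₁ e₂ hc hin =>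
    have hm : IsBlankMatch 0 ![0, 0] ![1, 2] ![box, box, box] ![true, false, false] G
        ![v, a₁, a₂] ![e₁, e₂] := by
      have := hc.ne
      have := hc.ne₁
      have := hc.ne₂
      have := hc.neE
      refine ⟨?_, ?_, ?_, ?_, ?_, ?_, ?_⟩
      · intro i j
        fin_cases i <;> fin_cases j <;> simp <;> grind
      · intro i j
        fin_cases i <;> fin_cases j <;> simp <;> grind
      · simp [Fin.forall_fin_succ, hc.s₁, hc.s₂]
      · simp [Fin.forall_fin_succ, hc.t₁, hc.t₂]
      · simp [Fin.forall_fin_succ, hG.l_root, hc.l₁, hc.l₂]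
      · simp [Fin.forall_fin_succ, hG.p_root, hG.p_of_ne _ hc.ne₁.symm, hG.p_of_ne _ hc.ne₂.symm]
      · intro f hf
        simp at hf
        have := hc.out f
        have := hc.out₁ f
        have := hc.out₂ f
        have := hc.in₁ f
        have := hc.in₂ f
        have := hin f
        simp [Fin.forall_fin_succ]
        grind
    refine ⟨r0, by simp [rules], blankMatch hm, ?_⟩
    obtain ⟨φ, ψ, h1⟩ := exists_embedding_result (a := 3) (b := 2) (c := 1) (d := 0)
      (blankMatch hm : r0.Match G) ![0] ![] (by decide) (by decide) (by decide) (by decide) (by decide)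
    exact ⟨φ, ψ, isReduct_r0 (gV := ![v, a₁, a₂]) hG h1⟩
  | @prune _ a₁ a₂ e e₁ e₂ hc hs ht hin =>
    subst hs
    -- The label of the parent selects `r1` or `r2`; together these impose no condition on it.
    obtain ⟨c, hl⟩ := Option.ne_none_iff_exists'.1 (hG.l_ne_none (G.s e))
    -- A loop at the root would be one of the two cherry edges, but these end in leaves other than
    -- the root.
    have hsv : G.s e ≠ v := by
      intro h
      rcases hc.out e h with rfl | rfl
      · exact hc.ne₁ (ht.symm.trans hc.t₁)
      · exact hc.ne₂ (ht.symm.trans hc.t₂)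
    have hm : IsBlankMatch 1 ![0, 1, 1] ![1, 2, 3] ![c, box, box, box] ![false, true, false, false]
        G ![G.s e, v, a₁, a₂] ![e, e₁, e₂] := by
      have := hc.ne
      have := hc.ne₁
      have := hc.ne₂
      have := hc.neE
      have := hc.out₁ e
      have := hc.out₂ e
      have := hc.s₁
      have := hc.s₂
      have := hc.t₁
      have := hc.t₂
      refine ⟨?_, ?_, ?_, ?_, ?_, ?_, ?_⟩
      · intro i j
        fin_cases i <;> fin_cases j <;> simp <;> grind
      · intro i j
        fin_cases i <;> fin_cases j <;> simp <;> grind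
      · simp [Fin.forall_fin_succ, hc.s₁, hc.s₂]
      · simp [Fin.forall_fin_succ, ht, hc.t₁, hc.t₂]
      · simp [Fin.forall_fin_succ, hl, hG.l_root, hc.l₁, hc.l₂]
      · simp [Fin.forall_fin_succ, hG.p_root, hG.p_of_ne _ hc.ne₁.symm, hG.p_of_ne _ hc.ne₂.symm,
          hG.p_of_ne _ hsv]
      · intro f hf
        simp at hf
        have := hc.out f
        have := hc.out₁ f
        have := hc.out₂ f
        have := hc.in₁ f
        have := hc.in₂ f
        have := hin f
        simp [Fin.forall_fin_succ]
        grind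
    obtain ⟨φ, ψ, h1⟩ := exists_embedding_result (a := 4) (b := 3) (c := 2) (d := 1)
      (blankMatch hm : (FBT.prune c).Match G) ![0, 1] ![0] (by decide) (by decide) (by decide)
      (by decide) (by decide)
    refine ⟨FBT.prune c, by cases c <;> simp [rules, r1, r2], blankMatch hm, φ, ψ, ?_⟩
    exact isReduct_prune (gV := ![G.s e, v, a₁, a₂]) hG hm.injV h1
  | @descend _ y e e' hs ht hs' ht' hvx hvy hxy hlx hly =>
    have hm : IsBlankMatch 3 ![0, 1] ![1, 2] ![box, box, box] ![true, false, false] G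
        ![v, r, y] ![e, e'] := by
      refine ⟨?_, ?_, ?_, ?_, ?_, ?_, ?_⟩
      · intro i j
        fin_cases i <;> fin_cases j <;> simp <;> grind
      · intro i j
        fin_cases i <;> fin_cases j <;> simp <;> grind
      · simp [Fin.forall_fin_succ, hs, hs']
      · simp [Fin.forall_fin_succ, ht, ht']
      · simp [Fin.forall_fin_succ, hG.l_root, hlx, hly]
      · simp [Fin.forall_fin_succ, hG.p_root, hG.p_of_ne _ hvx.symm, hG.p_of_ne _ hvy.symm]
      · intro f hf i hi
        exact absurd i.2 (not_lt.2 hi)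
    refine ⟨r3, by simp [rules], blankMatch hm, ?_⟩
    obtain ⟨φ, ψ, h1⟩ := exists_embedding_result (a := 3) (b := 2) (c := 3) (d := 2)
      (blankMatch hm : r3.Match G) ![0, 1, 2] ![0, 1] (by decide) (by decide) (by decide) (by decide)
      (by decide)
    exact ⟨φ, ψ, isReduct_r3 (gV := ![v, r, y]) hG hm.injV hlx hly h1⟩
  | @ascend _ e hs ht hl hout hin =>
    subst hs
    have hm : IsBlankMatch 1 ![0] ![1] ![box, box] ![false, true] G ![G.s e, v] ![e] := by
      refine ⟨?_, ?_, ?_, ?_, ?_, ?_, ?_⟩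
      · intro i j
        have := hout e
        fin_cases i <;> fin_cases j <;> simp <;> grind
      · intro i j _
        exact Subsingleton.elim i j
      · simp
      · simp [ht]
      · simp [Fin.forall_fin_succ, hG.l_root, hl]
      · simp [Fin.forall_fin_succ, hG.p_root, hG.p_of_ne _ (hout e)]
      · intro f hf
        simp at hf
        have := hout f
        have := hin f
        simp [Fin.forall_fin_succ]
        grind
    refine ⟨r4, by simp [rules], blankMatch hm, ?_⟩
    obtain ⟨φ, ψ, h1⟩ := exists_embedding_result (a := 2) (b := 1) (c := 2) (d := 1)
      (blankMatch hm : r4.Match G) ![0, 1] ![0] (by decide) (by decide) (by decide) (by decide) (by decide)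
    exact ⟨φ, ψ, isReduct_r4 (gV := ![G.s e, v]) hG hm.injV h1⟩

theorem exists_redex_of_match (hG : RootedAt G v) {R : RRule NLabel ELabel} (hR : R ∈ rules)
    (M : R.Match G) :
    ∃ (D : Set G.V) (F : Set G.E) (r z : G.V) (a : NLabel) (φ : M.result.V → G.V)
      (ψ : M.result.E → G.E), Redex G v D F r z a ∧ IsReduct G M.result D F r z a φ ψ := by
  have hprune : ∀ c (M : (FBT.prune c).Match G),
      ∃ (D : Set G.V) (F : Set G.E) (r z : G.V) (a : NLabel) (φ : M.result.V → G.V)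
      (ψ : M.result.E → G.E), Redex G v D F r z a ∧ IsReduct G M.result D F r z a φ ψ := by
    intro c M
    obtain ⟨φ, ψ, h1⟩ := exists_embedding_result (a := 4) (b := 3) (c := 2) (d := 1)
      M ![0, 1] ![0] (by decide) (by decide) (by decide) (by decide) (by decide)
    obtain ⟨hv, hr⟩ := redex_of_match_prune hG (isBlankMatch M)
    subst hv
    exact ⟨_, _, _, _, _, φ, ψ, hr, isReduct_prune hG M.inj.1 h1⟩
  rcases hR with rfl | rfl | rfl | rfl | rfl
  · obtain ⟨φ, ψ, h1⟩ := exists_embedding_result (a := 3) (b := 2) (c := 1) (d := 0)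
      M ![0] ![] (by decide) (by decide) (by decide) (by decide) (by decide)
    obtain ⟨hv, hr⟩ := redex_of_match_r0 hG (isBlankMatch M)
    subst hv
    exact ⟨_, _, _, _, _, φ, ψ, hr, isReduct_r0 hG h1⟩
  · exact hprune _ M
  · exact hprune _ M
  · obtain ⟨φ, ψ, h1⟩ := exists_embedding_result (a := 3) (b := 2) (c := 3) (d := 2)
      M ![0, 1, 2] ![0, 1] (by decide) (by decide) (by decide) (by decide) (by decide)
    obtain ⟨hv, hr⟩ := redex_of_match_r3 hG (isBlankMatch M)
    subst hv
    exact ⟨_, _, _, _, _, φ, ψ, hr, isReduct_r3 hG M.inj.1 ((isBlankMatch M).map_l (1 : Fin 3))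
      ((isBlankMatch M).map_l (2 : Fin 3)) h1⟩
  · obtain ⟨φ, ψ, h1⟩ := exists_embedding_result (a := 2) (b := 1) (c := 2) (d := 1)
      M ![0, 1] ![0] (by decide) (by decide) (by decide) (by decide) (by decide)
    obtain ⟨hv, hr⟩ := redex_of_match_r4 hG (isBlankMatch M)
    subst hv
    exact ⟨_, _, _, _, _, φ, ψ, hr, isReduct_r4 hG M.inj.1 h1⟩

/-- The steps of the system from a graph with a single, square root. -/
theorem directlyDerives_iff (hG : RootedAt G v) :
    DirectlyDerives rules G H ↔
      ∃ (D : Set G.V) (F : Set G.E) (r z : G.V) (a : NLabel) (φ : H.V → G.V) (ψ : H.E → G.E),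
        Redex G v D F r z a ∧ IsReduct G H D F r z a φ ψ := by
  constructor
  · rintro ⟨-, R, hR, M, hi⟩
    obtain ⟨D, F, r, z, a, φ, ψ, h1, h2⟩ := exists_redex_of_match hG hR M
    obtain ⟨φ', ψ', h3⟩ := h2.of_isomorphic hG.l_ne_none hi
    exact ⟨D, F, r, z, a, φ', ψ', h1, h3⟩
  · rintro ⟨D, F, r, z, a, φ, ψ, h1, h2⟩
    obtain ⟨R, hR, M, φ', ψ', h3⟩ := exists_match_of_redex hG h1
    exact ⟨hG.isTLRG, R, hR, M, h3.isomorphic h2⟩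

theorem inNormalForm_iff (hG : RootedAt G v) :
    InNormalForm rules G ↔ ∀ D F r z a, ¬ Redex G v D F r z a := by
  constructor
  · intro h D F r z a hr
    obtain ⟨R, hR, M, -⟩ := exists_match_of_redex hG hr
    exact h _ ⟨hG.isTLRG, R, hR, M, Isomorphic.refl _⟩
  · intro h H hH
    obtain ⟨D, F, r, z, a, -, -, hr, -⟩ := (directlyDerives_iff hG).1 hH
    exact h _ _ _ _ _ hr

end FBT

/-! ## Full binary trees through ranks -/

namespace RGraph

section Walks

variable {LV LE : Type} {G : RGraph LV LE}

theorem UWalk.append {u v w : G.V} {es fs : List G.E} (h : G.UWalk u v es) (h' : G.UWalk v w fs) :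
    G.UWalk u w (es ++ fs) := by
  induction h with
  | nil v => exact h'
  | fwd e w es _ ih => exact .fwd e _ _ (ih h')
  | bwd e w es _ ih => exact .bwd e _ _ (ih h')

theorem UWalk.reverse {u v : G.V} {es : List G.E} (h : G.UWalk u v es) :
    G.UWalk v u es.reverse := by
  induction h with
  | nil v => exact .nil v
  | fwd e w es _ ih =>
    rw [List.reverse_cons]
    exact ih.append (.bwd e _ _ (.nil _))
  | bwd e w es _ ih =>
    rw [List.reverse_cons]
    exact ih.append (.fwd e _ _ (.nil _))

theorem UWalk.eq_of_nil {u w : G.V} (h : G.UWalk u w []) : u = w := by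
  cases h
  rfl

theorem UWalk.of_singleton {u w : G.V} {e : G.E} (h : G.UWalk u w [e]) :
    G.s e = u ∧ G.t e = w ∨ G.t e = u ∧ G.s e = w := by
  cases h with
  | fwd _ _ _ h => exact Or.inl ⟨rfl, h.eq_of_nil⟩
  | bwd _ _ _ h => exact Or.inr ⟨rfl, h.eq_of_nil⟩

/-- The nodes reachable from `u` form an edge-invariant predicate. In this form connectedness can be
pulled back along maps of nodes, including the collapse of a cherry, without handling walks. -/
theorem connected_iff_forall_invariant :
    G.Connected ↔ ∀ P : G.V → Prop, (∀ e, P (G.s e) ↔ P (G.t e)) → ∀ u w, P u → P w := by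
  constructor
  · intro h P hP u w hu
    obtain ⟨es, hw⟩ := h u w
    induction hw with
    | nil v => exact hu
    | fwd e w es _ ih => exact ih ((hP e).1 hu)
    | bwd e w es _ ih => exact ih ((hP e).2 hu)
  · intro h u w
    refine h (fun w => ∃ es, G.UWalk u w es) ?_ u w ⟨[], .nil u⟩
    intro e
    constructor
    · rintro ⟨es, he⟩
      exact ⟨_, he.append (.fwd e _ _ (.nil _))⟩
    · rintro ⟨es, he⟩
      exact ⟨_, he.append (.bwd e _ _ (.nil _))⟩

/-- If every vertex has at most one incoming edge and the rank `ρ` grows along all edges, then it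
grows along undirected trails that do not start against an edge. -/
theorem UWalk.eq_nil_or_rank_lt (hin : ∀ e e', G.t e = G.t e' → e = e') (ρ : G.V → ℕ)
    (hρ : ∀ e, ρ (G.s e) < ρ (G.t e)) {u w : G.V} {es : List G.E} (h : G.UWalk u w es)
    (hn : es.Nodup) (hh : ∀ e ∈ es.head?, G.t e ≠ u) : u = w ∧ es = [] ∨ ρ u < ρ w := by
  induction h with
  | nil v => exact Or.inl ⟨rfl, rfl⟩
  | fwd e w es _ ih =>
    right
    rw [List.nodup_cons] at hn
    -- Turning back after `e` would use the only edge into its target, which is `e` again; a trail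
    -- forbids this.
    rcases ih hn.2 (by
      intro e' he' ht
      rw [hin _ _ ht] at he'
      exact hn.1 (List.mem_of_mem_head? he')) with h | h
    · rw [← h.1]
      exact hρ e
    · exact (hρ e).trans h
  | bwd e w es _ ih => exact absurd rfl (hh e (by simp))

/-- A closed trail cannot gain rank, so both it and its reverse start against an edge into `v`. That
edge is unique, hence it is the first and the last edge of the trail. This is a repetition, unless
the trail is a single loop, which the rank excludes. -/
theorem not_hasUCycle_of_rank (hin : ∀ e e', G.t e = G.t e' → e = e') (ρ : G.V → ℕ)
    (hρ : ∀ e, ρ (G.s e) < ρ (G.t e)) : ¬ G.HasUCycle := by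
  rintro ⟨v, es, hne, hn, hw⟩
  have h1 : ∃ e ∈ es.head?, G.t e = v := by
    by_contra hc
    push Not at hc
    rcases hw.eq_nil_or_rank_lt hin ρ hρ hn hc with h | h
    · exact hne h.2
    · exact lt_irrefl _ h
  have h2 : ∃ e ∈ es.reverse.head?, G.t e = v := by
    by_contra hc
    push Not at hc
    rcases hw.reverse.eq_nil_or_rank_lt hin ρ hρ (List.nodup_reverse.2 hn) hc with h | h
    · exact hne (List.reverse_eq_nil_iff.1 h.2)
    · exact lt_irrefl _ h
  obtain ⟨e, he, hte⟩ := h1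
  obtain ⟨e', he', hte'⟩ := h2
  obtain rfl := hin _ _ (hte.trans hte'.symm)
  cases es with
  | nil => exact hne rfl
  | cons f fs =>
    simp only [List.head?_cons, Option.mem_def, Option.some.injEq] at he
    subst he
    rw [List.nodup_cons] at hn
    rw [List.head?_reverse] at he'
    cases fs with
    | nil =>
      have := hρ f
      rcases hw.of_singleton with ⟨h1, h2⟩ | ⟨h1, h2⟩ <;> rw [h1, h2] at this <;>
        exact lt_irrefl _ this
    | cons f' fs =>
      rw [List.getLast?_cons_cons] at he'
      exact hn.1 (List.mem_of_mem_getLast? he')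

/-- The edge relation. -/
def Step (G : RGraph LV LE) (u w : G.V) : Prop := ∃ e, G.s e = u ∧ G.t e = w

/-- Only the edges `f 0, …, f n` matter; a total function on `ℕ` makes it easy to cut pieces out of
the walk. -/
theorem exists_chain_of_transGen {u w : G.V} (h : Relation.TransGen G.Step u w) :
    ∃ (n : ℕ) (f : ℕ → G.E), (∀ i < n, G.t (f i) = G.s (f (i + 1))) ∧ G.s (f 0) = u ∧
      G.t (f n) = w := by
  induction h using Relation.TransGen.head_induction_on with
  | single h =>
    obtain ⟨e, hs, ht⟩ := h
    exact ⟨0, fun _ => e, by simp, hs, ht⟩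
  | head h _ ih =>
    obtain ⟨e, hs, ht⟩ := h
    obtain ⟨n, f, h1, h2, h3⟩ := ih
    refine ⟨n + 1, fun i => Nat.casesOn i e f, ?_, hs, h3⟩
    intro i hi
    cases i with
    | zero => exact ht.trans h2.symm
    | succ i => exact h1 i (by omega)

theorem uWalk_map_range (f : ℕ → G.E) (n : ℕ) (h : ∀ i < n, G.t (f i) = G.s (f (i + 1))) :
    G.UWalk (G.s (f 0)) (G.t (f n)) ((List.range (n + 1)).map f) := by
  induction n with
  | zero => exact .fwd _ _ _ (.nil _)
  | succ n ih =>
    rw [List.range_succ, List.map_append]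
    refine (ih fun i hi => h i (by omega)).append ?_
    rw [h n (by omega)]
    exact .fwd _ _ _ (.nil _)

/-- A shortest closed directed walk repeats no edge, so it is an undirected cycle. -/
theorem not_transGen_step_self (hG : ¬ G.HasUCycle) (v : G.V) : ¬ Relation.TransGen G.Step v v := by
  intro h
  have hex : ∃ (n : ℕ) (f : ℕ → G.E), (∀ i < n, G.t (f i) = G.s (f (i + 1))) ∧
      G.t (f n) = G.s (f 0) := by
    obtain ⟨n, f, h1, h2, h3⟩ := exists_chain_of_transGen h
    exact ⟨n, f, h1, h3.trans h2.symm⟩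
  classical
  obtain ⟨f, h1, h2⟩ := Nat.find_spec hex
  have hmin := fun m hm => Nat.find_min hex (m := m) hm
  set n := Nat.find hex
  have hinj : ∀ i j, i < j → j ≤ n → f i ≠ f j := by
    intro i j hij hj he
    -- If the edges at positions `i < j` agree, then those at `i, …, j - 1` already close up: the
    -- last of them ends where the edge at `j`, hence the one at `i`, starts.
    refine hmin (j - 1 - i) (by omega) ⟨fun k => f (i + k), ?_, ?_⟩
    · intro k hk
      exact h1 (i + k) (by omega)
    · have := h1 (j - 1) (by omega)
      beta_reduce
      rw [show i + (j - 1 - i) = j - 1 by omega, this, show j - 1 + 1 = j by omega, ← he]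
      rfl
  refine hG ⟨G.s (f 0), (List.range (n + 1)).map f, by simp, ?_, ?_⟩
  · refine List.Nodup.map_on ?_ List.nodup_range
    intro i hi j hj hf
    rw [List.mem_range] at hi hj
    rcases lt_trichotomy i j with hl | hl | hl
    · exact absurd hf (hinj i j hl (by omega))
    · exact hl
    · exact absurd hf.symm (hinj j i hl (by omega))
  · have := uWalk_map_range f n h1
    rwa [h2] at this

/-- The rank of a node is its number of proper ancestors. Along an edge the ancestors are inherited
and the source is added, which by acyclicity is not its own ancestor. -/
theorem exists_rank (hG : ¬ G.HasUCycle) : ∃ ρ : G.V → ℕ, ∀ e, ρ (G.s e) < ρ (G.t e) := by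
  have := G.finV
  refine ⟨fun v => {u | Relation.TransGen G.Step u v}.ncard, fun e => ?_⟩
  have he : G.Step (G.s e) (G.t e) := ⟨e, rfl, rfl⟩
  refine Set.ncard_lt_ncard ⟨fun u hu => Relation.TransGen.tail hu he, fun h => ?_⟩
  exact not_transGen_step_self hG (G.s e) (h (Relation.TransGen.single he))

/-- Full binary trees, with connectedness and acyclicity in terms of predicates and ranks. -/
structure IsRankedTree (G : RGraph LV LE) : Prop where
  nonempty : Nonempty G.V
  in_unique : ∀ e e', G.t e = G.t e' → e = e'
  connected : ∀ P : G.V → Prop, (∀ e, P (G.s e) ↔ P (G.t e)) → ∀ u w, P u → P w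
  rank : ∃ ρ : G.V → ℕ, ∀ e, ρ (G.s e) < ρ (G.t e)
  branch : ∀ v, (∀ e, G.s e ≠ v) ∨ ∃ e e', e ≠ e' ∧ ∀ f, G.s f = v ↔ f = e ∨ f = e'

theorem indeg_le_one_iff : (∀ v, G.indeg v ≤ 1) ↔ ∀ e e', G.t e = G.t e' → e = e' := by
  have := G.finE
  constructor
  · intro h e e' he
    have h1 := h (G.t e')
    rw [indeg, Finite.card_le_one_iff_subsingleton] at h1
    exact congrArg Subtype.val (h1.elim ⟨e, he⟩ ⟨e', rfl⟩)
  · intro h v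
    rw [indeg, Finite.card_le_one_iff_subsingleton]
    exact ⟨fun e e' => Subtype.ext (h _ _ (e.2.trans e'.2.symm))⟩

/-- Indegrees at most one make the target map injective, so counting children is counting outgoing
edges. Hence the bound on outdegrees follows from the number of children. -/
theorem ncard_children (h : ∀ e e', G.t e = G.t e' → e = e') (v : G.V) :
    (G.children v).ncard = {e | G.s e = v}.ncard := by
  have : G.children v = G.t '' {e | G.s e = v} := rfl
  rw [this, Set.ncard_image_of_injective _ h]

theorem isFullBinaryTree_iff : G.IsFullBinaryTree ↔ G.IsRankedTree := by
  have := G.finE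
  constructor
  · rintro ⟨⟨⟨h1, h2, h3, h4⟩, -⟩, h6⟩
    rw [indeg_le_one_iff] at h4
    refine ⟨h1, h4, connected_iff_forall_invariant.1 h2, exists_rank h3, fun v => ?_⟩
    have := h6 v
    rw [ncard_children h4, Set.ncard_eq_zero (Set.toFinite _), Set.ncard_eq_two] at this
    rcases this with h | ⟨e, e', hne, h⟩
    · left
      intro e he
      have : e ∈ {e | G.s e = v} := he
      rw [h] at this
      exact this
    · right
      refine ⟨e, e', hne, fun f => ?_⟩
      change f ∈ {e | G.s e = v} ↔ _
      rw [h]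
      rfl
  · rintro ⟨h1, h2, h3, ⟨ρ, h4⟩, h5⟩
    have hc : ∀ v, {e | G.s e = v}.ncard = 0 ∨ {e | G.s e = v}.ncard = 2 := by
      intro v
      rw [Set.ncard_eq_zero (Set.toFinite _), Set.ncard_eq_two]
      rcases h5 v with h | ⟨e, e', hne, h⟩
      · left
        ext e
        simpa using h e
      · right
        refine ⟨e, e', hne, ?_⟩
        ext f
        exact h f
    refine ⟨⟨⟨h1, connected_iff_forall_invariant.2 h3, not_hasUCycle_of_rank h2 ρ h4,
      indeg_le_one_iff.2 h2⟩, fun v => ?_⟩, fun v => ?_⟩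
    · change {e | G.s e = v}.ncard ≤ 2
      rcases hc v with h | h <;> omega
    · rw [ncard_children h2]
      exact hc v

end Walks

-- Invariance of the tree property under steps

variable {G H : RGraph NLabel ELabel}

theorem IsRankedTree.of_bijective {LV LE LV' LE' : Type} {G : RGraph LV LE} {H : RGraph LV' LE'}
    (f : H.V → G.V) (k : H.E → G.E)
    (hf : Function.Bijective f) (hk : Function.Bijective k) (hs : ∀ e, f (H.s e) = G.s (k e))
    (ht : ∀ e, f (H.t e) = G.t (k e)) (h : G.IsRankedTree) : H.IsRankedTree := by
  obtain ⟨f', hf1, hf2⟩ := Function.bijective_iff_has_inverse.1 hf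
  obtain ⟨ρ, hρ⟩ := h.rank
  refine ⟨h.nonempty.map f', ?_, ?_, ⟨fun v => ρ (f v), ?_⟩, ?_⟩
  · intro e e' he
    apply hk.1
    apply h.in_unique
    rw [← ht, ← ht, he]
  · intro P hP u w hu
    have := h.connected (fun x => P (f' x)) (by
      intro e
      obtain ⟨e, rfl⟩ := hk.2 e
      rw [← hs, ← ht, hf1, hf1]
      exact hP e) (f u) (f w) (by rwa [hf1])
    rwa [hf1] at this
  · intro e
    beta_reduce
    rw [hs, ht]
    exact hρ _
  · intro v
    rcases h.branch (f v) with h1 | ⟨e, e', hne, h1⟩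
    · left
      rintro e rfl
      exact h1 (k e) (hs e).symm
    · right
      obtain ⟨e, rfl⟩ := hk.2 e
      obtain ⟨e', rfl⟩ := hk.2 e'
      refine ⟨e, e', fun h => hne (congrArg k h), fun d => ?_⟩
      rw [← hf.1.eq_iff, hs, h1, hk.1.eq_iff, hk.1.eq_iff]

/-- Removing the two leaves of a cherry from a full binary tree, or adding them, gives a full binary
tree. -/
theorem Cherry.isRankedTree_iff {v a₁ a₂ : G.V} {e₁ e₂ : G.E} {r z : G.V} {a : NLabel}
    (hc : Cherry G v a₁ a₂ e₁ e₂) {φ : H.V → G.V} {ψ : H.E → G.E}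
    (h : IsReduct G H {a₁, a₂} {e₁, e₂} r z a φ ψ) : G.IsRankedTree ↔ H.IsRankedTree := by
  have hφ : ∀ w, w ≠ a₁ → w ≠ a₂ → ∃ x, φ x = w := by
    intro w h1 h2
    have : w ∈ Set.range φ := by
      rw [h.rangeV]
      simp [h1, h2]
    exact this
  have hψ : ∀ f, f ≠ e₁ → f ≠ e₂ → ∃ x, ψ x = f := by
    intro w h1 h2
    have : w ∈ Set.range ψ := by
      rw [h.rangeE]
      simp [h1, h2]
    exact this
  have hφn : ∀ x, φ x ≠ a₁ ∧ φ x ≠ a₂ := by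
    intro x
    have : φ x ∈ Set.range φ := ⟨x, rfl⟩
    rw [h.rangeV] at this
    simpa using this
  have hψn : ∀ x, ψ x ≠ e₁ ∧ ψ x ≠ e₂ := by
    intro x
    have : ψ x ∈ Set.range ψ := ⟨x, rfl⟩
    rw [h.rangeE] at this
    simpa using this
  obtain ⟨v', hv'⟩ := hφ v hc.ne₁ hc.ne₂
  have hleaf : ∀ e, H.s e ≠ v' := by
    rintro e he
    have := h.map_s e
    rw [he, hv'] at this
    rcases hc.out _ this.symm with h1 | h1
    · exact (hψn e).1 h1
    · exact (hψn e).2 h1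
  -- the retraction of `G` onto `H` that collapses the cherry
  have hπ : ∀ w, ∃ x, φ x = w ∨ (w = a₁ ∨ w = a₂) ∧ x = v' := by
    intro w
    by_cases h1 : w = a₁ ∨ w = a₂
    · exact ⟨v', Or.inr ⟨h1, rfl⟩⟩
    · push Not at h1
      obtain ⟨x, hx⟩ := hφ w h1.1 h1.2
      exact ⟨x, Or.inl hx⟩
  choose π hπ using hπ
  have π_φ : ∀ x, π (φ x) = x := by
    intro x
    rcases hπ (φ x) with h1 | ⟨h1 | h1, -⟩
    · exact h.injV h1
    · exact absurd h1 (hφn x).1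
    · exact absurd h1 (hφn x).2
  have π_1 : π a₁ = v' := by
    rcases hπ a₁ with h1 | ⟨-, h1⟩
    · exact absurd h1 (hφn _).1
    · exact h1
  have π_2 : π a₂ = v' := by
    rcases hπ a₂ with h1 | ⟨-, h1⟩
    · exact absurd h1 (hφn _).2
    · exact h1
  constructor
  · intro hG
    obtain ⟨ρ, hρ⟩ := hG.rank
    refine ⟨⟨v'⟩, ?_, ?_, ⟨fun x => ρ (φ x), ?_⟩, ?_⟩
    · intro e e' he
      apply h.injE
      apply hG.in_unique
      rw [← h.map_t, ← h.map_t, he]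
    · intro P hP u w hu
      have := hG.connected (fun x => P (π x)) (by
        intro e
        by_cases h1 : e = e₁
        · rw [h1, hc.s₁, hc.t₁, π_1, ← hv', π_φ]
        by_cases h2 : e = e₂
        · rw [h2, hc.s₂, hc.t₂, π_2, ← hv', π_φ]
        obtain ⟨e, rfl⟩ := hψ e h1 h2
        rw [← h.map_s, ← h.map_t, π_φ, π_φ]
        exact hP e) (φ u) (φ w) (by rwa [π_φ])
      rwa [π_φ] at this
    · intro e
      beta_reduce
      rw [h.map_s, h.map_t]
      exact hρ _
    · intro x
      by_cases hx : x = v'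
      · rw [hx]
        exact Or.inl hleaf
      rcases hG.branch (φ x) with h1 | ⟨e, e', hne, h1⟩
      · left
        rintro e rfl
        exact h1 (ψ e) (h.map_s e).symm
      · right
        have hnot : ∀ f, G.s f = φ x → f ≠ e₁ ∧ f ≠ e₂ := by
          intro f hf
          have hne : G.s f ≠ v := by
            rw [hf, ← hv']
            exact fun h' => hx (h.injV h')
          constructor
          · rintro rfl
            exact hne hc.s₁
          · rintro rfl
            exact hne hc.s₂
        have he := hnot e ((h1 e).2 (Or.inl rfl))
        have he' := hnot e' ((h1 e').2 (Or.inr rfl))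
        obtain ⟨e, rfl⟩ := hψ e he.1 he.2
        obtain ⟨e', rfl⟩ := hψ e' he'.1 he'.2
        refine ⟨e, e', fun h => hne (congrArg ψ h), fun d => ?_⟩
        rw [← h.injV.eq_iff, h.map_s, h1, h.injE.eq_iff, h.injE.eq_iff]
  · intro hH
    obtain ⟨ρ, hρ⟩ := hH.rank
    refine ⟨⟨v⟩, ?_, ?_, ?_, ?_⟩
    · intro e e' he
      by_cases h1 : G.t e' = a₁
      · rw [hc.in₁ e (he.trans h1), hc.in₁ e' h1]
      by_cases h2 : G.t e' = a₂
      · rw [hc.in₂ e (he.trans h2), hc.in₂ e' h2]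
      have hn : ∀ f, G.t f = G.t e' → ∃ x, ψ x = f := by
        intro f hf
        apply hψ
        · rintro rfl
          exact h1 (hf.symm.trans hc.t₁)
        · rintro rfl
          exact h2 (hf.symm.trans hc.t₂)
      obtain ⟨x, rfl⟩ := hn e he
      obtain ⟨y, rfl⟩ := hn e' rfl
      congr 1
      apply hH.in_unique
      apply h.injV
      rw [h.map_t, h.map_t, he]
    · intro P hP u w hu
      -- The leaves are joined to `v` by an edge, so an edge-invariant predicate does not notice the
      -- collapse.
      have key : ∀ x, P x ↔ P (φ (π x)) := by
        intro x
        rcases hπ x with h1 | ⟨h1 | h1, h2⟩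
        · rw [h1]
        · rw [h2, hv', h1, ← hc.t₁, ← hP, hc.s₁]
        · rw [h2, hv', h1, ← hc.t₂, ← hP, hc.s₂]
      rw [key] at hu ⊢
      refine hH.connected (fun x => P (φ x)) (fun e => ?_) _ _ hu
      rw [h.map_s, h.map_t]
      exact hP _
    · classical
      -- The leaves collapse to `v`, so they receive the rank of `v` plus one.
      refine ⟨fun x => ρ (π x) + if x = a₁ ∨ x = a₂ then 1 else 0, fun e => ?_⟩
      have hs : ¬ (G.s e = a₁ ∨ G.s e = a₂) := by
        rintro (h1 | h1)
        · exact hc.out₁ e h1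
        · exact hc.out₂ e h1
      simp only [hs, if_false, Nat.add_zero]
      by_cases h1 : e = e₁
      · rw [h1, hc.s₁, hc.t₁, π_1, ← hv', π_φ]
        simp
      by_cases h2 : e = e₂
      · rw [h2, hc.s₂, hc.t₂, π_2, ← hv', π_φ]
        simp
      obtain ⟨e, rfl⟩ := hψ e h1 h2
      rw [← h.map_s, ← h.map_t, π_φ, π_φ]
      exact (hρ e).trans_le (Nat.le_add_right _ _)
    · intro x
      by_cases h1 : x = a₁
      · rw [h1]
        exact Or.inl hc.out₁
      by_cases h2 : x = a₂
      · rw [h2]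
        exact Or.inl hc.out₂
      by_cases h3 : x = v
      · right
        refine ⟨e₁, e₂, hc.neE, fun f => ?_⟩
        rw [h3]
        constructor
        · exact hc.out f
        · rintro (rfl | rfl)
          · exact hc.s₁
          · exact hc.s₂
      have hn : ∀ f, G.s f = x → ∃ x, ψ x = f := by
        intro f hf
        apply hψ
        · rintro rfl
          exact h3 (hf.symm.trans hc.s₁)
        · rintro rfl
          exact h3 (hf.symm.trans hc.s₂)
      obtain ⟨x, rfl⟩ := hφ x h1 h2
      rcases hH.branch x with h4 | ⟨e, e', hne, h4⟩
      · left
        intro f hf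
        obtain ⟨f, rfl⟩ := hn f hf
        rw [← h.map_s, h.injV.eq_iff] at hf
        exact h4 f hf
      · right
        refine ⟨ψ e, ψ e', h.injE.ne hne, fun f => ?_⟩
        constructor
        · intro hf
          obtain ⟨f, rfl⟩ := hn f hf
          rw [← h.map_s, h.injV.eq_iff, h4] at hf
          rwa [h.injE.eq_iff, h.injE.eq_iff]
        · rintro (rfl | rfl)
          · rw [← h.map_s, (h4 e).2 (Or.inl rfl)]
          · rw [← h.map_s, (h4 e').2 (Or.inr rfl)]

theorem IsReduct.isRankedTree_iff {v : G.V} {D : Set G.V} {F : Set G.E} {r z : G.V} {a : NLabel}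
    (hr : Redex G v D F r z a) {φ : H.V → G.V} {ψ : H.E → G.E}
    (h : IsReduct G H D F r z a φ ψ) : G.IsRankedTree ↔ H.IsRankedTree := by
  -- If nothing is deleted, the maps are bijections of the underlying graphs.
  have key : ∀ {r z : G.V} {a : NLabel}, IsReduct G H ∅ ∅ r z a φ ψ →
      (G.IsRankedTree ↔ H.IsRankedTree) := by
    intro r z a h
    have hf : Function.Bijective φ := ⟨h.injV, Set.range_eq_univ.1 (by simp [h.rangeV])⟩
    have hk : Function.Bijective ψ := ⟨h.injE, Set.range_eq_univ.1 (by simp [h.rangeE])⟩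
    refine ⟨fun hG => hG.of_bijective φ ψ hf hk h.map_s h.map_t, fun hH => ?_⟩
    obtain ⟨f', hf1, hf2⟩ := Function.bijective_iff_has_inverse.1 hf
    obtain ⟨k', hk1, hk2⟩ := Function.bijective_iff_has_inverse.1 hk
    refine hH.of_bijective f' k' ⟨hf2.injective, hf1.surjective⟩ ⟨hk2.injective, hk1.surjective⟩
      (fun e => hf.1 ?_) (fun e => hf.1 ?_)
    · rw [hf2, h.map_s, hk2]
    · rw [hf2, h.map_t, hk2]
  cases hr with
  | top hc _ => exact hc.isRankedTree_iff h
  | prune hc _ _ _ => exact hc.isRankedTree_iff h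
  | descend => exact key h
  | ascend => exact key h

end RGraph

/-! ## Invariants of derivations -/

namespace RGraph

open NLabel

variable {G H : RGraph NLabel ELabel} {v : G.V} {D : Set G.V} {F : Set G.E} {r z : G.V} {a : NLabel}
  {φ : H.V → G.V} {ψ : H.E → G.E}

/-- The root `v` has an outgoing edge or no incoming edge. -/
def HasExit (G : RGraph NLabel ELabel) (v : G.V) : Prop := (∃ e, G.s e = v) ∨ ∀ e, G.t e ≠ v

/-- The invariant of derivations from input graphs: from every triangle an edge leads to a triangle
or to the root, and the root has an exit as soon as there is a triangle. -/
structure IsMarkedAt (G : RGraph NLabel ELabel) (v : G.V) : Prop where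
  rootedAt : RootedAt G v
  chain : ∀ w, G.l w = some tri → ∃ e, G.s e = w ∧ (G.l (G.t e) = some tri ∨ G.t e = v)
  exit : HasExit G v ∨ ∀ w, G.l w = some box

theorem IsReduct.exists_eq (h : IsReduct G H D F r z a φ ψ) {w : G.V} (hw : w ∉ D) :
    ∃ x, φ x = w := by
  have : w ∈ Set.range φ := by
    rw [h.rangeV]
    exact hw
  exact this

theorem IsReduct.exists_edge_eq (h : IsReduct G H D F r z a φ ψ) {f : G.E} (hf : f ∉ F) :
    ∃ x, ψ x = f := by
  have : f ∈ Set.range ψ := by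
    rw [h.rangeE]
    exact hf
  exact this

theorem IsReduct.not_mem (h : IsReduct G H D F r z a φ ψ) (x : H.V) : φ x ∉ D := by
  have : φ x ∈ Set.range φ := ⟨x, rfl⟩
  rwa [h.rangeV] at this

theorem IsReduct.l_of_ne (h : IsReduct G H D F r z a φ ψ) {x : H.V} (hx : φ x ≠ z) :
    H.l x = G.l (φ x) := by
  rw [h.map_l, if_neg hx]

theorem IsReduct.l_of_eq (h : IsReduct G H D F r z a φ ψ) {x : H.V} (hx : φ x = z) :
    H.l x = some a := by
  rw [h.map_l, if_pos hx]

theorem Redex.root_not_mem (hr : Redex G v D F r z a) : r ∉ D := by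
  cases hr with
  | top hc => simp [hc.ne₁, hc.ne₂]
  | prune hc hs =>
    subst hs
    simp [hc.out₁, hc.out₂]
  | descend => simp
  | ascend => simp

/-- Descending turns the old root into a triangle with an edge to the new root, so edges that led to
the old root now lead to a triangle. When the root moves up, the only edge into the old root comes
from the new root, which is now a square, so no remaining triangle depended on it. After a step at
the top the root has no incoming edge; after the others it has an outgoing one. -/
theorem IsReduct.isMarkedAt (h : IsReduct G H D F r z a φ ψ) (hr : Redex G v D F r z a)
    (hG : IsMarkedAt G v) : ∃ w, IsMarkedAt H w ∧ HasExit H w := by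
  obtain ⟨w, hw⟩ := h.exists_eq hr.root_not_mem
  have hvt : ∀ {x}, G.l x = some tri → x ≠ v := by
    rintro _ hx rfl
    rw [hG.rootedAt.l_root] at hx
    simp at hx
  -- A triangle that is turned into a square becomes the root, so edges into it still fit the
  -- invariant.
  have target : ∀ e, r = z → G.l (G.t (ψ e)) = some tri → H.l (H.t e) = some tri ∨ H.t e = w := by
    intro e hrz he
    by_cases hz : φ (H.t e) = r
    · exact Or.inr (h.injV (hz.trans hw.symm))
    · left
      rw [h.l_of_ne (hrz ▸ hz), h.map_t, he]
  refine ⟨w, ?_⟩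
  cases hr with
  | @top a₁ a₂ e₁ e₂ hc hin =>
    have hex : HasExit H w := by
      right
      rintro e rfl
      rw [h.map_t] at hw
      exact hin _ hw
    refine ⟨⟨h.rootedAt hG.rootedAt.l_ne_none hw (by simp), fun x hx => ?_, Or.inl hex⟩, hex⟩
    have hxz : φ x ≠ v := by
      intro hz
      rw [h.l_of_eq hz] at hx
      simp at hx
    rw [h.l_of_ne hxz] at hx
    obtain ⟨e, hs, ht⟩ := hG.chain _ hx
    have he : e ∉ ({e₁, e₂} : Set G.E) := by
      rintro (rfl | rfl)
      · exact hxz (hs.symm.trans hc.s₁)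
      · exact hxz (hs.symm.trans hc.s₂)
    obtain ⟨e, rfl⟩ := h.exists_edge_eq he
    rw [← h.map_s, h.injV.eq_iff] at hs
    refine ⟨e, hs, ?_⟩
    rcases ht with ht | ht
    · exact target e rfl ht
    · exact absurd ht (hin _)
  | @prune _ a₁ a₂ e₀ e₁ e₂ hc hs₀ ht₀ hin =>
    have he₀ : e₀ ∉ ({e₁, e₂} : Set G.E) := by
      rintro (rfl | rfl)
      · exact hc.ne₁ (ht₀.symm.trans hc.t₁)
      · exact hc.ne₂ (ht₀.symm.trans hc.t₂)
    have hex : HasExit H w := by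
      obtain ⟨e, he⟩ := h.exists_edge_eq he₀
      left
      refine ⟨e, h.injV ?_⟩
      rw [h.map_s, he, hs₀, hw]
    refine ⟨⟨h.rootedAt hG.rootedAt.l_ne_none hw (by simp), fun x hx => ?_, Or.inl hex⟩, hex⟩
    have hxz : φ x ≠ r := by
      intro hz
      rw [h.l_of_eq hz] at hx
      simp at hx
    rw [h.l_of_ne hxz] at hx
    obtain ⟨e, hs, ht⟩ := hG.chain _ hx
    have he : e ∉ ({e₁, e₂} : Set G.E) := by
      rintro (rfl | rfl)
      · exact hvt hx (hs.symm.trans hc.s₁)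
      · exact hvt hx (hs.symm.trans hc.s₂)
    obtain ⟨e, rfl⟩ := h.exists_edge_eq he
    have hs' := hs
    rw [← h.map_s, h.injV.eq_iff] at hs
    refine ⟨e, hs, ?_⟩
    rcases ht with ht | ht
    · exact target e rfl ht
    · rw [hin _ ht] at hs'
      exact absurd (hs'.symm.trans hs₀) hxz
  | @descend _ y e₀ e' hs₀ ht₀ hs' ht' hvx hvy hxy hlx hly =>
    have hex : HasExit H w := by
      obtain ⟨e, he⟩ := h.exists_edge_eq (Set.notMem_empty e')
      left
      refine ⟨e, h.injV ?_⟩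
      rw [h.map_s, he, hs', hw]
    refine ⟨⟨h.rootedAt hG.rootedAt.l_ne_none hw (by simp [hvx.symm, hlx]), fun x hx => ?_,
      Or.inl hex⟩, hex⟩
    by_cases hxz : φ x = v
    · obtain ⟨e, rfl⟩ := h.exists_edge_eq (Set.notMem_empty e₀)
      refine ⟨e, h.injV ?_, Or.inr (h.injV ?_)⟩
      · rw [h.map_s, hs₀, hxz]
      · rw [h.map_t, ht₀, hw]
    · rw [h.l_of_ne hxz] at hx
      obtain ⟨e, hs, ht⟩ := hG.chain _ hx
      obtain ⟨e, rfl⟩ := h.exists_edge_eq (Set.notMem_empty e)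
      rw [← h.map_s, h.injV.eq_iff] at hs
      rw [← h.map_t] at ht
      refine ⟨e, hs, Or.inl ?_⟩
      rw [h.map_l]
      rcases ht with ht | ht
      · rw [ht]
        simp
      · rw [if_pos ht]
  | @ascend _ e₀ hs₀ ht₀ hl hout hin =>
    have hex : HasExit H w := by
      obtain ⟨e, he⟩ := h.exists_edge_eq (Set.notMem_empty e₀)
      left
      refine ⟨e, h.injV ?_⟩
      rw [h.map_s, he, hs₀, hw]
    refine ⟨⟨h.rootedAt hG.rootedAt.l_ne_none hw (by simp), fun x hx => ?_, Or.inl hex⟩, hex⟩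
    have hxz : φ x ≠ r := by
      intro hz
      rw [h.l_of_eq hz] at hx
      simp at hx
    rw [h.l_of_ne hxz] at hx
    obtain ⟨e, hs, ht⟩ := hG.chain _ hx
    obtain ⟨e, rfl⟩ := h.exists_edge_eq (Set.notMem_empty e)
    have hs' := hs
    rw [← h.map_s, h.injV.eq_iff] at hs
    refine ⟨e, hs, ?_⟩
    rcases ht with ht | ht
    · exact target e rfl ht
    · rw [hin _ ht] at hs'
      exact absurd (hs'.symm.trans hs₀) hxz

/-- The number of square nodes. -/
noncomputable def numBoxes (G : RGraph NLabel ELabel) : ℕ := {w | G.l w = some box}.ncard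

theorem numBoxes_le_order (G : RGraph NLabel ELabel) : G.numBoxes ≤ G.order := by
  have := G.finV
  exact Set.ncard_le_card _

/-- Every step removes a square, except a step upwards from a root without exit. -/
theorem IsReduct.numBoxes (h : IsReduct G H D F r z a φ ψ) (hr : Redex G v D F r z a)
    (hG : RootedAt G v) :
    H.numBoxes < G.numBoxes ∨ H.numBoxes = G.numBoxes ∧ ¬ HasExit G v := by
  have := G.finV
  have hc : H.numBoxes = (φ '' {w | H.l w = some box}).ncard :=
    (Set.ncard_image_of_injective _ h.injV).symm
  have hbox : ∀ x, H.l x = some box → φ x ≠ z → G.l (φ x) = some box := by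
    intro x hx hz
    rwa [h.l_of_ne hz] at hx
  rw [hc]
  cases hr with
  | @top a₁ a₂ e₁ e₂ hc hin =>
    left
    refine Set.ncard_lt_ncard (Set.ssubset_iff_of_subset ?_ |>.2 ⟨a₁, hc.l₁, ?_⟩)
    · rintro _ ⟨x, hx, rfl⟩
      by_cases hz : φ x = v
      · rw [hz]
        exact hG.l_root
      · exact hbox x hx hz
    · rintro ⟨x, -, hx⟩
      exact h.not_mem x (Or.inl hx)
  | @prune _ a₁ a₂ e₀ e₁ e₂ hc hs₀ ht₀ hin =>
    left
    -- The parent may be a new square, but two square leaves disappear.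
    have hsub : φ '' {w | H.l w = some box} ⊆
        insert r (({w | G.l w = some box} \ {a₁}) \ {a₂}) := by
      rintro _ ⟨x, hx, rfl⟩
      by_cases hz : φ x = r
      · exact Or.inl hz
      · exact Or.inr ⟨⟨hbox x hx hz, fun h1 => h.not_mem x (Or.inl h1)⟩,
          fun h1 => h.not_mem x (Or.inr h1)⟩
    have h1 := (Set.ncard_le_ncard hsub).trans (Set.ncard_insert_le _ _)
    have h2 : (({w | G.l w = some box} \ {a₁}) \ {a₂}).ncard <
        ({w | G.l w = some box} \ {a₁}).ncard :=
      Set.ncard_sdiff_singleton_lt_of_mem ⟨hc.l₂, hc.ne.symm⟩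
    have h3 : ({w | G.l w = some box} \ {a₁}).ncard < {w | G.l w = some box}.ncard :=
      Set.ncard_sdiff_singleton_lt_of_mem hc.l₁
    rw [RGraph.numBoxes]
    omega
  | @descend _ y e₀ e' hs₀ ht₀ hs' ht' hvx hvy hxy hlx hly =>
    left
    refine Set.ncard_lt_ncard (Set.ssubset_iff_of_subset ?_ |>.2 ⟨v, hG.l_root, ?_⟩)
    · rintro _ ⟨x, hx, rfl⟩
      refine hbox x hx fun hz => ?_
      rw [Set.mem_ofPred_eq, h.l_of_eq hz] at hx
      simp at hx
    · rintro ⟨x, hx, hz⟩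
      rw [Set.mem_ofPred_eq, h.l_of_eq hz] at hx
      simp at hx
  | @ascend _ e₀ hs₀ ht₀ hl hout hin =>
    right
    constructor
    · congr 1
      ext w
      constructor
      · rintro ⟨x, hx, rfl⟩
        by_cases hz : φ x = r
        · rw [hz]
          exact hl
        · exact hbox x hx hz
      · intro hw
        obtain ⟨x, rfl⟩ := h.exists_eq (Set.notMem_empty w)
        refine ⟨x, ?_, rfl⟩
        rw [Set.mem_ofPred_eq, h.map_l]
        split_ifs
        · rfl
        · exact hw
    · rintro (⟨e, he⟩ | he)
      · exact hout e he
      · exact he _ ht₀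

/-- Degree bounds pass to graphs with an injective map of edges and nodes. -/
theorem DegreeBounded.of_injective {b : ℕ} (hG : G.DegreeBounded b) (f : H.V → G.V) (k : H.E → G.E)
    (hk : Function.Injective k) (hs : ∀ e, f (H.s e) = G.s (k e))
    (ht : ∀ e, f (H.t e) = G.t (k e)) : H.DegreeBounded b := by
  have := G.finE
  intro w
  refine le_trans (Nat.add_le_add ?_ ?_) (hG (f w))
  · refine Nat.card_le_card_of_injective
      (fun e => (⟨k e.1, by rw [← ht, e.2]⟩ : {e : G.E // G.t e = f w})) ?_
    intro e e' he
    exact Subtype.ext (hk (congrArg Subtype.val he))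
  · refine Nat.card_le_card_of_injective
      (fun e => (⟨k e.1, by rw [← hs, e.2]⟩ : {e : G.E // G.s e = f w})) ?_
    intro e e' he
    exact Subtype.ext (hk (congrArg Subtype.val he))

end RGraph

namespace FBT

open NLabel RGraph

-- Length of derivations and existence of normal forms

variable {G H : RGraph NLabel ELabel}

theorem IsInput.exists_isMarkedAt (hG : IsInput G) : ∃ v, IsMarkedAt G v := by
  obtain ⟨h1, ⟨v, hv, hu⟩, h3, -⟩ := hG
  refine ⟨v, ⟨⟨h1.1, h3 v, hv, fun w hw => ?_⟩, fun w hw => ?_, Or.inr h3⟩⟩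
  · have h := h1.2 w
    have h' : G.p w ≠ some true := fun h' => hw (hu w h')
    rcases hp : G.p w with _ | _ | _
    · exact absurd hp h
    · rfl
    · exact absurd hp h'
  · rw [h3] at hw
    simp at hw

theorem IsInput.of_isomorphic (hG : IsInput G) (hi : G.Isomorphic H) : IsInput H := by
  obtain ⟨h1, ⟨v, hv, hu⟩, h3, -⟩ := hG
  obtain ⟨f, k, hf, hk, hs, ht, -, hl, hp⟩ := hi.exists_bijective h1
  refine ⟨⟨fun w => ?_, fun w => ?_⟩, ⟨f v, ?_, fun w hw => ?_⟩, fun w => ?_, fun _ => rfl⟩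
  · obtain ⟨w, rfl⟩ := hf.2 w
    rw [← hl]
    exact h1.1 w
  · obtain ⟨w, rfl⟩ := hf.2 w
    rw [← hp]
    exact h1.2 w
  · beta_reduce
    rw [← hp]
    exact hv
  · obtain ⟨w, rfl⟩ := hf.2 w
    rw [← hp] at hw
    rw [hu w hw]
  · obtain ⟨w, rfl⟩ := hf.2 w
    rw [← hl]
    exact h3 w

/-- What derivations from input graphs preserve, and the bound on their length. -/
theorem derivesIn_invariant (hG : IsInput G) {n : ℕ} (hd : DerivesIn rules n G H) :
    (∃ v, IsMarkedAt H v ∧ (n = 0 ∧ H.numBoxes ≤ G.order ∨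
      n + H.numBoxes ≤ G.order + 1 ∧ HasExit H v)) ∧
    (G.IsRankedTree ↔ H.IsRankedTree) ∧
    ∀ b, G.DegreeBounded b → H.DegreeBounded b := by
  induction hd with
  | @zero G H hi =>
    obtain ⟨v, hv⟩ := (hG.of_isomorphic hi).exists_isMarkedAt
    obtain ⟨f, k, hf, hk, hs, ht, -⟩ := hi.symm.exists_bijective (hG.of_isomorphic hi).1
    obtain ⟨f', k', hf', hk', hs', ht', -⟩ := hi.exists_bijective hG.1
    refine ⟨⟨v, hv, Or.inl ⟨rfl, ?_⟩⟩, ⟨fun h => h.of_bijective f k hf hk hs ht,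
      fun h => h.of_bijective f' k' hf' hk' hs' ht'⟩, fun b hb => hb.of_injective f k hk.1 hs ht⟩
    refine H.numBoxes_le_order.trans_eq ?_
    exact Nat.card_congr (Equiv.ofBijective f hf)
  | @succ n G H H' _ hd ih =>
    obtain ⟨⟨v, hv, hn⟩, ht, hb⟩ := ih hG
    obtain ⟨D, F, r, z, a, φ, ψ, hr, hH⟩ := (directlyDerives_iff hv.rootedAt).1 hd
    obtain ⟨w, hw, hw'⟩ := hH.isMarkedAt hr hv
    refine ⟨⟨w, hw, Or.inr ⟨?_, hw'⟩⟩, ht.trans (hH.isRankedTree_iff hr),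
      fun b h => (hb b h).of_injective φ ψ hH.injE hH.map_s hH.map_t⟩
    -- A step that keeps the number of squares starts from a root without exit, so it is the first
    -- step of the derivation; the extra `+ 1` pays for it.
    rcases hH.numBoxes hr hv.rootedAt with h1 | ⟨h1, h2⟩
    · rcases hn with ⟨h3, h4⟩ | ⟨h3, h4⟩ <;> omega
    · rcases hn with ⟨h3, h4⟩ | ⟨h3, h4⟩
      · omega
      · exact absurd h4 h2

theorem order_pos (hG : IsInput G) : 0 < G.order := by
  have := G.finV
  obtain ⟨v, -⟩ := hG.exists_isMarkedAt
  have : Nonempty G.V := ⟨v⟩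
  exact Nat.card_pos

/-- The invariant allows at most |V| + 1 steps, and there is at least one node. -/
theorem length_le (hG : IsInput G) {n : ℕ} (hd : DerivesIn rules n G H) : n ≤ 2 * G.order := by
  obtain ⟨⟨v, -, h⟩, -⟩ := derivesIn_invariant hG hd
  have := order_pos hG
  omega

theorem not_exists_infinite (hG : IsInput G) :
    ¬ ∃ f : ℕ → RGraph NLabel ELabel, f 0 = G ∧ ∀ i, DirectlyDerives rules (f i) (f (i + 1)) := by
  rintro ⟨f, h0, hf⟩
  have h : ∀ n, DerivesIn rules n G (f n) := by
    intro n
    induction n with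
    | zero =>
      rw [h0]
      exact .zero (Isomorphic.refl G)
    | succ n ih => exact .succ ih (hf n)
  have := length_le hG (h (2 * G.order + 1))
  omega

/-- Without normal forms every derivation could be prolonged beyond the length bound. -/
theorem exists_isNormalFormOf (hG : IsInput G) : ∃ H, IsNormalFormOf rules H G := by
  by_contra hc
  have h : ∀ n, ∃ H, DerivesIn rules n G H := by
    intro n
    induction n with
    | zero => exact ⟨G, .zero (Isomorphic.refl G)⟩
    | succ n ih =>
      obtain ⟨H, hH⟩ := ih
      by_contra hn
      exact hc ⟨H, ⟨n, hH⟩, fun H' h' => hn ⟨H', .succ hH h'⟩⟩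
  obtain ⟨H, hH⟩ := h (2 * G.order + 1)
  have := length_le hG hH
  omega

/-! ## Normal forms of full binary trees -/

/-- From a triangle ranked above the root, the marked chain only gains rank: it can neither reach
the root nor go on forever. -/
theorem l_eq_box_of_rank_lt {v : G.V} (hG : IsMarkedAt G v) (ρ : G.V → ℕ)
    (hρ : ∀ e, ρ (G.s e) < ρ (G.t e)) {w : G.V} (hw : ρ v < ρ w) : G.l w = some box := by
  have := G.finV
  rcases hl : G.l w with _ | _ | _
  · exact absurd hl (hG.rootedAt.l_ne_none w)
  · rfl
  · exfalso
    obtain ⟨x, ⟨hx1, hx2⟩, hx⟩ := Set.exists_max_image {w | G.l w = some tri ∧ ρ v < ρ w} ρ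
      (Set.toFinite _) ⟨w, hl, hw⟩
    obtain ⟨e, rfl, he⟩ := hG.chain x hx1
    have h1 := hρ e
    rcases he with he | he
    · have := hx _ ⟨he, hx2.trans h1⟩
      omega
    · rw [he] at h1
      omega

/-- In a tree some rule applies unless the root is isolated: a childless root with a parent ascends,
one with a grandchild descends, and two leaf children form a cherry. -/
theorem isomorphic_single {v : G.V} (hG : IsMarkedAt G v) (ht : G.IsRankedTree)
    (hn : InNormalForm rules G) : G.Isomorphic single := by
  rw [inNormalForm_iff hG.rootedAt] at hn
  obtain ⟨ρ, hρ⟩ := ht.rank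
  rcases ht.branch v with hleaf | ⟨e, e', hne, hout⟩
  · by_cases hin : ∃ e, G.t e = v
    · obtain ⟨e, he⟩ := hin
      -- A childless root with a parent has no exit, so the invariant leaves only the case without
      -- triangles.
      have hl : G.l (G.s e) = some box := by
        rcases hG.exit with (⟨f, hf⟩ | hf) | hf
        · exact absurd hf (hleaf f)
        · exact absurd he (hf e)
        · exact hf _
      exact absurd (.ascend rfl he hl hleaf fun f hf => ht.in_unique _ _ (hf.trans he.symm))
        (hn _ _ _ _ _)
    · push Not at hin
      -- No edge touches `v`, so being equal to `v` is an edge-invariant predicate.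
      have hV : ∀ w, v = w := fun w => ht.connected (fun x => v = x)
        (fun e => iff_of_false (hleaf e).symm (hin e).symm) v w rfl
      have hE : IsEmpty G.E := ⟨fun e => hleaf e (hV _).symm⟩
      refine isomorphic_of_bijective (fun _ => (0 : Fin 1)) (fun e => hE.elim e)
        ⟨fun x y _ => (hV x).symm.trans (hV y), fun i => ⟨v, Subsingleton.elim (α := Fin 1) _ _⟩⟩
        ⟨fun e => hE.elim e, fun i => Fin.elim0 i⟩ (fun e => hE.elim e) (fun e => hE.elim e)
        (fun e => hE.elim e) (fun w => ?_) (fun w => ?_)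
      · rw [← hV w]
        exact hG.rootedAt.l_root
      · rw [← hV w]
        exact hG.rootedAt.p_root
  · exfalso
    have hs : G.s e = v := (hout e).2 (Or.inl rfl)
    have hs' : G.s e' = v := (hout e').2 (Or.inr rfl)
    have hrank : ∀ f, G.s f = v → ρ v < ρ (G.t f) := by
      intro f hf
      rw [← hf]
      exact hρ f
    -- A grandchild would allow descending: ranks make the three nodes distinct, and nodes ranked
    -- above the root are squares.
    have hleaf : ∀ f, G.s f = v → ∀ d, G.s d ≠ G.t f := by
      intro f hf d hd
      have h1 := hrank f hf
      have h2 := hρ d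
      rw [hd] at h2
      refine hn _ _ _ _ _ (.descend hf rfl hd rfl ?_ ?_ ?_
        (l_eq_box_of_rank_lt hG ρ hρ h1) (l_eq_box_of_rank_lt hG ρ hρ (h1.trans h2)))
      · exact fun h => h1.ne (congrArg ρ h)
      · exact fun h => (h1.trans h2).ne (congrArg ρ h)
      · exact fun h => h2.ne (congrArg ρ h)
    have hc : Cherry G v (G.t e) (G.t e') e e' :=
      { ne := fun h => hne (ht.in_unique _ _ h)
        ne₁ := fun h => (hrank e hs).ne (congrArg ρ h)
        ne₂ := fun h => (hrank e' hs').ne (congrArg ρ h)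
        neE := hne
        s₁ := hs
        s₂ := hs'
        t₁ := rfl
        t₂ := rfl
        l₁ := l_eq_box_of_rank_lt hG ρ hρ (hrank e hs)
        l₂ := l_eq_box_of_rank_lt hG ρ hρ (hrank e' hs')
        out := fun f => (hout f).1
        out₁ := hleaf e hs
        out₂ := hleaf e' hs'
        in₁ := fun f => ht.in_unique f e
        in₂ := fun f => ht.in_unique f e' }
    by_cases hin : ∃ e, G.t e = v
    · obtain ⟨d, hd⟩ := hin
      exact hn _ _ _ _ _ (.prune hc rfl hd fun f hf => ht.in_unique _ _ (hf.trans hd.symm))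
    · push Not at hin
      exact hn _ _ _ _ _ (.top hc hin)

theorem isRankedTree_single : single.IsRankedTree where
  nonempty := ⟨(0 : Fin 1)⟩
  in_unique e := Fin.elim0 e
  connected P _ u w h := by
    rwa [← Subsingleton.elim (α := Fin 1) u w]
  rank := ⟨fun _ => 0, fun e => Fin.elim0 e⟩
  branch _ := Or.inl fun e => Fin.elim0 e

theorem isFullBinaryTree_unlabelled_iff (G : RGraph NLabel ELabel) :
    (unlabelled G).IsFullBinaryTree ↔ G.IsRankedTree :=
  isFullBinaryTree_iff.trans ⟨fun h => ⟨h.1, h.2, h.3, h.4, h.5⟩, fun h => ⟨h.1, h.2, h.3, h.4, h.5⟩⟩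

theorem isomorphic_single_iff (hG : IsInput G) (hH : IsNormalFormOf rules H G) :
    H.Isomorphic single ↔ (unlabelled G).IsFullBinaryTree := by
  obtain ⟨⟨n, hd⟩, hn⟩ := hH
  obtain ⟨⟨v, hv, -⟩, ht, -⟩ := derivesIn_invariant hG hd
  rw [isFullBinaryTree_unlabelled_iff, ht]
  constructor
  · intro hi
    obtain ⟨f, k, hf, hk, hs, ht, -⟩ := hi.exists_bijective hv.rootedAt.isTLRG
    exact isRankedTree_single.of_bijective f k hf hk hs ht
  · intro h
    exact isomorphic_single hv h hn

end FBT

/-! ## Copies of graphs in the store -/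

namespace GraphMachine

open NLabel RGraph

namespace Store

/-- The store `S` holds a copy of `G` under the names given by `f` and `h`. -/
structure IsCopy (S : Store NLabel ELabel) (G : RGraph NLabel ELabel) (f : G.V → ℕ) (h : G.E → ℕ) :
    Prop where
  injV : Function.Injective f
  injE : Function.Injective h
  rangeV : Set.range f = ↑S.nodes
  rangeE : Set.range h = ↑S.edges
  src : ∀ e, S.src (h e) = f (G.s e)
  tgt : ∀ e, S.tgt (h e) = f (G.t e)
  edgeLab : ∀ e, S.edgeLab (h e) = G.m e
  lab : ∀ v, G.l v = some (S.lab (f v))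
  root : ∀ v, G.p v = some (S.root (f v))

variable {S : Store NLabel ELabel} {G : RGraph NLabel ELabel} {f : G.V → ℕ} {h : G.E → ℕ}

theorem IsCopy.represents (hS : S.IsCopy G f h) : S.Represents G :=
  ⟨f, h, hS.injV, hS.injE, hS.rangeV, hS.rangeE, hS.src, hS.tgt, hS.edgeLab, hS.lab, hS.root⟩

theorem Represents.exists_isCopy (hS : S.Represents G) : ∃ f h, S.IsCopy G f h := by
  obtain ⟨f, h, h1, h2, h3, h4, h5, h6, h7, h8, h9⟩ := hS
  exact ⟨f, h, h1, h2, h3, h4, h5, h6, h7, h8, h9⟩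

namespace IsCopy

theorem mem_nodes (hS : S.IsCopy G f h) (v : G.V) : f v ∈ S.nodes := by
  rw [← Finset.mem_coe, ← hS.rangeV]
  exact ⟨v, rfl⟩

theorem mem_edges (hS : S.IsCopy G f h) (e : G.E) : h e ∈ S.edges := by
  rw [← Finset.mem_coe, ← hS.rangeE]
  exact ⟨e, rfl⟩

theorem exists_node (hS : S.IsCopy G f h) {x : ℕ} (hx : x ∈ S.nodes) : ∃ v, f v = x := by
  rw [← Finset.mem_coe, ← hS.rangeV] at hx
  exact hx

theorem exists_edge (hS : S.IsCopy G f h) {d : ℕ} (hd : d ∈ S.edges) : ∃ e, h e = d := by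
  rw [← Finset.mem_coe, ← hS.rangeE] at hd
  exact hd

theorem mem_nodes_iff (hS : S.IsCopy G f h) {x : ℕ} : x ∈ S.nodes ↔ ∃ v, f v = x :=
  ⟨hS.exists_node, by
    rintro ⟨v, rfl⟩
    exact hS.mem_nodes v⟩

theorem mem_edges_iff (hS : S.IsCopy G f h) {d : ℕ} : d ∈ S.edges ↔ ∃ e, h e = d :=
  ⟨hS.exists_edge, by
    rintro ⟨e, rfl⟩
    exact hS.mem_edges e⟩

/-- Lists of names become lists of edges of `G` without repetition; the degree tests of the machine
are interpreted through this. -/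
theorem exists_outEdges_eq_map (hS : S.IsCopy G f h) (v : G.V) :
    ∃ l : List G.E, l.Nodup ∧ (∀ e, e ∈ l ↔ G.s e = v) ∧ S.outEdges (f v) = l.map h := by
  have hmem : ∀ d, d ∈ S.outEdges (f v) ↔ d ∈ S.edges ∧ S.src d = f v := by
    simp [outEdges]
  have hr : S.outEdges (f v) ∈ Set.range (List.map h) := by
    rw [Set.range_list_map]
    intro d hd
    exact hS.exists_edge ((hmem d).1 hd).1
  obtain ⟨l, hl⟩ := hr
  refine ⟨l, ?_, fun e => ?_, hl.symm⟩
  · refine List.Nodup.of_map h ?_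
    rw [hl]
    exact Finset.sort_nodup _ _
  · rw [← List.mem_map_of_injective hS.injE, hl, hmem, hS.src, hS.injV.eq_iff]
    exact and_iff_right (hS.mem_edges e)

theorem exists_inEdges_eq_map (hS : S.IsCopy G f h) (v : G.V) :
    ∃ l : List G.E, l.Nodup ∧ (∀ e, e ∈ l ↔ G.t e = v) ∧ S.inEdges (f v) = l.map h := by
  have hmem : ∀ d, d ∈ S.inEdges (f v) ↔ d ∈ S.edges ∧ S.tgt d = f v := by
    simp [inEdges]
  have hr : S.inEdges (f v) ∈ Set.range (List.map h) := by
    rw [Set.range_list_map]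
    intro d hd
    exact hS.exists_edge ((hmem d).1 hd).1
  obtain ⟨l, hl⟩ := hr
  refine ⟨l, ?_, fun e => ?_, hl.symm⟩
  · refine List.Nodup.of_map h ?_
    rw [hl]
    exact Finset.sort_nodup _ _
  · rw [← List.mem_map_of_injective hS.injE, hl, hmem, hS.tgt, hS.injV.eq_iff]
    exact and_iff_right (hS.mem_edges e)

theorem length_outEdges_le (hS : S.IsCopy G f h) {b : ℕ} (hb : G.DegreeBounded b) (v : G.V) :
    (S.outEdges (f v)).length ≤ b := by
  classical
  obtain ⟨l, hn, hl, he⟩ := hS.exists_outEdges_eq_map v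
  have : G.outdeg v = l.length := by
    rw [outdeg, ← List.toFinset_card_of_nodup hn]
    exact Nat.subtype_card _ (by simpa using hl)
  rw [he, List.length_map, ← this]
  exact (Nat.le_add_left _ _).trans (hb v)

theorem length_outEdges_eq_zero (hS : S.IsCopy G f h) (v : G.V) :
    (S.outEdges (f v)).length = 0 ↔ ∀ e, G.s e ≠ v := by
  obtain ⟨l, hn, hl, he⟩ := hS.exists_outEdges_eq_map v
  simp only [he, List.length_map, List.length_eq_zero_iff, List.eq_nil_iff_forall_not_mem, hl, ne_eq]

theorem length_inEdges_eq_zero (hS : S.IsCopy G f h) (v : G.V) :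
    (S.inEdges (f v)).length = 0 ↔ ∀ e, G.t e ≠ v := by
  obtain ⟨l, hn, hl, he⟩ := hS.exists_inEdges_eq_map v
  simp only [he, List.length_map, List.length_eq_zero_iff, List.eq_nil_iff_forall_not_mem, hl, ne_eq]

theorem length_inEdges_eq_one (hS : S.IsCopy G f h) (v : G.V) :
    (S.inEdges (f v)).length = 1 ↔
      ∃ e, S.inEdges (f v) = [h e] ∧ G.t e = v ∧ ∀ d, G.t d = v → d = e := by
  constructor
  · intro h1
    obtain ⟨l, hn, hl, he⟩ := hS.exists_inEdges_eq_map v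
    rw [he, List.length_map, List.length_eq_one_iff] at h1
    obtain ⟨e, rfl⟩ := h1
    simp only [List.mem_singleton] at hl
    exact ⟨e, he, (hl e).1 rfl, fun d => (hl d).2⟩
  · rintro ⟨e, h1, -⟩
    rw [h1]
    rfl

theorem length_inEdges_eq_one_of_unique (hS : S.IsCopy G f h) {v : G.V} {e : G.E} (he : G.t e = v)
    (hu : ∀ d, G.t d = v → d = e) : (S.inEdges (f v)).length = 1 := by
  obtain ⟨l, hn, hl, hm⟩ := hS.exists_inEdges_eq_map v
  have hle : l.length ≤ 1 := by
    by_contra hc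
    have h0 := hu _ ((hl (l[0]'(by omega))).1 (List.getElem_mem _))
    have h1 := hu _ ((hl (l[1]'(by omega))).1 (List.getElem_mem _))
    have := (hn.getElem_inj_iff).1 (h0.trans h1.symm)
    omega
  have hpos : 0 < l.length := List.length_pos_of_mem ((hl e).2 he)
  rw [hm, List.length_map]
  omega

theorem length_outEdges_eq_two (hS : S.IsCopy G f h) {v : G.V}
    (h2 : (S.outEdges (f v)).length = 2) :
    ∃ e e', S.outEdges (f v) = [h e, h e'] ∧ e ≠ e' ∧ ∀ d, G.s d = v ↔ d = e ∨ d = e' := by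
  obtain ⟨l, hn, hl, he⟩ := hS.exists_outEdges_eq_map v
  rw [he, List.length_map, List.length_eq_two] at h2
  obtain ⟨e, e', rfl⟩ := h2
  refine ⟨e, e', he, by simpa using hn, fun d => ?_⟩
  rw [← hl]
  simp

theorem length_outEdges_eq_two_of (hS : S.IsCopy G f h) {v : G.V} {e e' : G.E} (hne : e ≠ e')
    (he : ∀ d, G.s d = v ↔ d = e ∨ d = e') : (S.outEdges (f v)).length = 2 := by
  classical
  obtain ⟨l, hn, hl, hm⟩ := hS.exists_outEdges_eq_map v
  have : l.toFinset = {e, e'} := by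
    ext d
    simp [hl, he]
  rw [hm, List.length_map, ← List.toFinset_card_of_nodup hn, this, Finset.card_pair hne]

theorem root_iff (hS : S.IsCopy G f h) {v : G.V} (hG : RootedAt G v) (w : G.V) :
    S.root (f w) = true ↔ w = v := by
  have h1 := hS.root w
  constructor
  · intro h2
    rw [h2] at h1
    exact hG.eq_of_p h1
  · rintro rfl
    rw [hG.p_root] at h1
    exact (Option.some.inj h1).symm

theorem lab_eq (hS : S.IsCopy G f h) {w : G.V} {a : NLabel} : S.lab (f w) = a ↔ G.l w = some a := by
  rw [hS.lab, Option.some.injEq]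

/-- Changing a label or the rootedness costs one step per root, so it takes constant time here. -/
theorem numRooted (hS : S.IsCopy G f h) {v : G.V} (hG : RootedAt G v) : S.numRooted = 1 := by
  have : S.nodes.filter (fun x => S.root x = true) = {f v} := by
    ext x
    rw [Finset.mem_filter, Finset.mem_singleton]
    constructor
    · rintro ⟨h1, h2⟩
      obtain ⟨w, rfl⟩ := hS.exists_node h1
      rw [(hS.root_iff hG w).1 h2]
    · rintro rfl
      exact ⟨hS.mem_nodes v, (hS.root_iff hG v).2 rfl⟩
  rw [Store.numRooted, this, Finset.card_singleton]

theorem nodesWith_box_true (hS : S.IsCopy G f h) {v : G.V} (hG : RootedAt G v) :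
    S.nodesWith box true = [f v] := by
  have : S.nodes.filter (fun x => S.lab x = box ∧ S.root x = true) = {f v} := by
    ext x
    rw [Finset.mem_filter, Finset.mem_singleton]
    constructor
    · rintro ⟨h1, -, h2⟩
      obtain ⟨w, rfl⟩ := hS.exists_node h1
      rw [(hS.root_iff hG w).1 h2]
    · rintro rfl
      exact ⟨hS.mem_nodes v, hS.lab_eq.2 hG.l_root, (hS.root_iff hG v).2 rfl⟩
  rw [nodesWith, this]
  simp

open Classical in
/-- A store that differs from a copy of `G` as a reduct differs from `G` holds a graph derived from
`G`. -/
theorem exists_directlyDerives (hS : S.IsCopy G f h) {v : G.V} (hG : RootedAt G v) {D : Set G.V}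
    {F : Set G.E} {r z : G.V} {a : NLabel} (hr : Redex G v D F r z a) {S' : Store NLabel ELabel}
    (hV : ∀ x, x ∈ S'.nodes ↔ ∃ w, w ∉ D ∧ f w = x) (hE : ∀ d, d ∈ S'.edges ↔ ∃ e, e ∉ F ∧ h e = d)
    (hs : S'.src = S.src) (ht : S'.tgt = S.tgt)
    (hl : ∀ w, S'.lab (f w) = if w = z then a else S.lab (f w))
    (hp : ∀ w, S'.root (f w) = decide (w = r)) :
    ∃ H, DirectlyDerives FBT.rules G H ∧ S'.Represents H := by
  -- Surviving edges must have surviving ends, so that the subtypes form a graph.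
  have hclosed : ∀ e, e ∉ F → G.s e ∉ D ∧ G.t e ∉ D := by
    cases hr with
    | top hc _ =>
      intro e he
      simp only [Set.mem_insert_iff, Set.mem_singleton_iff, not_or] at he ⊢
      exact ⟨⟨hc.out₁ e, hc.out₂ e⟩, fun h => he.1 (hc.in₁ e h), fun h => he.2 (hc.in₂ e h)⟩
    | prune hc _ _ _ =>
      intro e he
      simp only [Set.mem_insert_iff, Set.mem_singleton_iff, not_or] at he ⊢
      exact ⟨⟨hc.out₁ e, hc.out₂ e⟩, fun h => he.1 (hc.in₁ e h), fun h => he.2 (hc.in₂ e h)⟩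
    | descend => simp
    | ascend => simp
  let H : RGraph NLabel ELabel :=
    { V := {w : G.V // w ∉ D}
      E := {e : G.E // e ∉ F}
      finV := by
        have := G.finV
        infer_instance
      finE := by
        have := G.finE
        infer_instance
      s := fun e => ⟨G.s e.1, (hclosed e.1 e.2).1⟩
      t := fun e => ⟨G.t e.1, (hclosed e.1 e.2).2⟩
      l := fun w => if w.1 = z then some a else G.l w.1
      m := fun _ => ELabel.box
      p := fun w => some (decide (w.1 = r)) }
  have hH : IsReduct G H D F r z a Subtype.val Subtype.val :=
    { injV := Subtype.val_injective
      injE := Subtype.val_injective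
      rangeV := Subtype.range_coe
      rangeE := Subtype.range_coe
      map_s := fun _ => rfl
      map_t := fun _ => rfl
      map_l := fun _ => rfl
      map_p := fun _ => rfl }
  refine ⟨H, (FBT.directlyDerives_iff hG).2 ⟨D, F, r, z, a, _, _, hr, hH⟩, fun w => f w.1,
    fun e => h e.1, hS.injV.comp Subtype.val_injective, hS.injE.comp Subtype.val_injective,
    ?_, ?_, ?_, ?_, fun _ => rfl, ?_, ?_⟩
  · ext x
    rw [Finset.mem_coe, hV]
    constructor
    · rintro ⟨⟨w, hw⟩, rfl⟩
      exact ⟨w, hw, rfl⟩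
    · rintro ⟨w, hw, rfl⟩
      exact ⟨⟨w, hw⟩, rfl⟩
  · ext x
    rw [Finset.mem_coe, hE]
    constructor
    · rintro ⟨⟨w, hw⟩, rfl⟩
      exact ⟨w, hw, rfl⟩
    · rintro ⟨w, hw, rfl⟩
      exact ⟨⟨w, hw⟩, rfl⟩
  · intro e
    rw [hs]
    exact hS.src _
  · intro e
    rw [ht]
    exact hS.tgt _
  · intro w
    rw [hl]
    change (if w.1 = z then some a else G.l w.1) = _
    rw [hS.lab]
    split_ifs <;> rfl
  · intro w
    rw [hp]

end IsCopy

end Store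

/-! ## Rules for timed execution -/

section Ends

variable {P R : Cmd NLabel ELabel} {σ : State NLabel ELabel} {T T₁ T₂ : ℕ}
  {Q : State NLabel ELabel → Prop}

/-- From `σ`, the command `P` halts within `T` steps in a state with the property `Q`. -/
def Ends (P : Cmd NLabel ELabel) (σ : State NLabel ELabel) (T : ℕ)
    (Q : State NLabel ELabel → Prop) : Prop :=
  ∃ (t : ℕ) (σ' : State NLabel ELabel), Exec P σ t σ' ∧ t ≤ T ∧ Q σ'

theorem Ends.mono {Q' : State NLabel ELabel → Prop} (h : Ends P σ T₁ Q) (hT : T₁ ≤ T₂)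
    (hQ : ∀ σ', Q σ' → Q' σ') : Ends P σ T₂ Q' := by
  obtain ⟨t, σ', h1, h2, h3⟩ := h
  exact ⟨t, σ', h1, h2.trans hT, hQ _ h3⟩

theorem Ends.of_le (h : Ends P σ T₁ Q) (hT : T₁ ≤ T₂) : Ends P σ T₂ Q :=
  h.mono hT fun _ => id

/-- The postcondition of the first command is the termination of the second, so verifying a program
amounts to nesting these rules along it. -/
theorem Ends.seq (h : Ends P σ T₁ fun σ' => Ends R σ' T₂ Q) : Ends (.seq P R) σ (T₁ + T₂) Q := by
  obtain ⟨t, σ', h1, h2, t', σ'', h3, h4, h5⟩ := h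
  exact ⟨_, _, .seq _ _ _ _ _ _ _ h1 h3, Nat.add_le_add h2 h4, h5⟩

theorem Ends.ite {B : Test NLabel ELabel} (h1 : B.Holds σ → Ends P σ T Q)
    (h2 : ¬ B.Holds σ → Ends R σ T Q) : Ends (.ite B P R) σ (1 + T) Q := by
  by_cases hB : B.Holds σ
  · obtain ⟨t, σ', h3, h4, h5⟩ := h1 hB
    exact ⟨_, _, .iteTrue _ _ _ _ _ _ hB h3, Nat.add_le_add_left h4 1, h5⟩
  · obtain ⟨t, σ', h3, h4, h5⟩ := h2 hB
    exact ⟨_, _, .iteFalse _ _ _ _ _ _ hB h3, Nat.add_le_add_left h4 1, h5⟩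

theorem Ends.skip (h : Q σ) : Ends .skip σ 1 Q := ⟨_, _, .skip σ, le_rfl, h⟩

theorem Ends.setFlag {i : ℕ} {c : Bool} (h : Q { σ with flag := Function.update σ.flag i c }) :
    Ends (.setFlag i c) σ 1 Q := ⟨_, _, .setFlag σ i c, le_rfl, h⟩

theorem Ends.copyNode {x y : ℕ} (h : Q (σ.setNode x (σ.nreg y))) : Ends (.copyNode x y) σ 1 Q :=
  ⟨_, _, .copyNode σ x y, le_rfl, h⟩

theorem Ends.copyEdge {x y : ℕ} (h : Q (σ.setEdge x (σ.ereg y))) : Ends (.copyEdge x y) σ 1 Q :=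
  ⟨_, _, .copyEdge σ x y, le_rfl, h⟩

theorem Ends.source {x e : ℕ} (h : Q (σ.setNode x (σ.store.src (σ.ereg e)))) :
    Ends (.source x e) σ 1 Q := ⟨_, _, .source σ x e, le_rfl, h⟩

theorem Ends.target {x e : ℕ} (h : Q (σ.setNode x (σ.store.tgt (σ.ereg e)))) :
    Ends (.target x e) σ 1 Q := ⟨_, _, .target σ x e, le_rfl, h⟩

theorem Ends.relabel {x : ℕ} {a : NLabel} (hx : σ.nreg x ∈ σ.store.nodes)
    (hT : σ.store.numRooted ≤ T)
    (h : Q { σ with store :=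
      { σ.store with lab := Function.update σ.store.lab (σ.nreg x) a } }) :
    Ends (.relabel x a) σ (1 + T) Q :=
  ⟨_, _, .relabel σ x a hx, Nat.add_le_add_left hT 1, h⟩

theorem Ends.setRoot {x : ℕ} {c : Bool} (hx : σ.nreg x ∈ σ.store.nodes)
    (hT : σ.store.numRooted ≤ T)
    (h : Q { σ with store :=
      { σ.store with root := Function.update σ.store.root (σ.nreg x) c } }) :
    Ends (.setRoot x c) σ (1 + T) Q :=
  ⟨_, _, .setRoot σ x c hx, Nat.add_le_add_left hT 1, h⟩

theorem Ends.delNode {x : ℕ} (hx : σ.nreg x ∈ σ.store.nodes)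
    (hd : ∀ d ∈ σ.store.edges, σ.store.src d ≠ σ.nreg x ∧ σ.store.tgt d ≠ σ.nreg x)
    (h : Q { σ with store := { σ.store with nodes := σ.store.nodes.erase (σ.nreg x) } }) :
    Ends (.delNode x) σ 1 Q := ⟨_, _, .delNode σ x hx hd, le_rfl, h⟩

theorem Ends.delEdge {e : ℕ} (he : σ.ereg e ∈ σ.store.edges)
    (h : Q { σ with store := { σ.store with edges := σ.store.edges.erase (σ.ereg e) } }) :
    Ends (.delEdge e) σ 1 Q := ⟨_, _, .delEdge σ e he, le_rfl, h⟩

/-- Besides the body, one step enters the loop and one lists the single node. -/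
theorem Ends.forNodes_singleton {x v : ℕ} {a : NLabel}
    (hl : σ.store.nodesWith a true = [v]) (h : Ends P (σ.setNode x v) T Q) :
    Ends (.forNodes x a true P) σ (2 + T) Q := by
  obtain ⟨t, σ', h1, h2, h3⟩ := h
  refine ⟨1 + listTime σ.store a true + (t + 0), σ', .forNodes _ _ _ _ _ _ _ ?_, ?_, h3⟩
  · rw [hl]
    exact .cons _ _ _ _ _ _ _ _ _ h1 (.nil _ _ _)
  · simp only [listTime, if_true, hl, List.length_singleton]
    omega

theorem Ends.forIn_singleton {e x d : ℕ} (hl : σ.store.inEdges (σ.nreg x) = [d])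
    (h : Ends P (σ.setEdge e d) T Q) : Ends (.forIn e x P) σ (2 + T) Q := by
  obtain ⟨t, σ', h1, h2, h3⟩ := h
  refine ⟨1 + (σ.store.inEdges (σ.nreg x)).length + (t + 0), σ', .forIn _ _ _ _ _ _ ?_, ?_, h3⟩
  · rw [hl]
    exact .cons _ _ _ _ _ _ _ _ _ h1 (.nil _ _ _)
  · simp only [hl, List.length_singleton]
    omega

theorem Ends.forOut_pair {e x d d' : ℕ} (hl : σ.store.outEdges (σ.nreg x) = [d, d'])
    (h : Ends P (σ.setEdge e d) T₁ fun σ' => Ends P (σ'.setEdge e d') T₂ Q) :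
    Ends (.forOut e x P) σ (3 + T₁ + T₂) Q := by
  obtain ⟨t, σ', h1, h2, t', σ'', h3, h4, h5⟩ := h
  refine ⟨1 + (σ.store.outEdges (σ.nreg x)).length + (t + (t' + 0)), σ'',
    .forOut _ _ _ _ _ _ ?_, ?_, h5⟩
  · rw [hl]
    exact .cons _ _ _ _ _ _ _ _ _ h1 (.cons _ _ _ _ _ _ _ _ _ h3 (.nil _ _ _))
  · simp only [hl, List.length_cons, List.length_nil]
    omega

/-- Loops over edges, with an invariant that depends on the entries treated so far. -/
theorem exists_execEdges {e : ℕ} {I : List ℕ → State NLabel ELabel → Prop} (ds₀ ds : List ℕ)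
    (h0 : I ds₀ σ)
    (hI : ∀ ds' d σ', d ∈ ds → I ds' σ' → Ends P (σ'.setEdge e d) T (I (ds' ++ [d]))) :
    ∃ (t : ℕ) (σ' : State NLabel ELabel), ExecEdges e P ds σ t σ' ∧ t ≤ ds.length * T ∧
      I (ds₀ ++ ds) σ' := by
  induction ds generalizing ds₀ σ with
  | nil => exact ⟨0, σ, .nil _ _ _, by simp, by simpa using h0⟩
  | cons d ds ih =>
    obtain ⟨t, σ', h1, h2, h3⟩ := hI ds₀ d σ (by simp) h0
    obtain ⟨t', σ'', h4, h5, h6⟩ := ih (ds₀ ++ [d]) h3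
      (fun ds' d' σ' hd' => hI ds' d' σ' (List.mem_cons_of_mem _ hd'))
    refine ⟨_, _, .cons _ _ _ _ _ _ _ _ _ h1 h4, ?_, by simpa using h6⟩
    rw [List.length_cons, Nat.succ_mul]
    omega

theorem Ends.forOut {e x b : ℕ} {I : List ℕ → State NLabel ELabel → Prop}
    (hb : (σ.store.outEdges (σ.nreg x)).length ≤ b) (h0 : I [] σ)
    (hI : ∀ ds d σ', d ∈ σ.store.outEdges (σ.nreg x) → I ds σ' →
      Ends P (σ'.setEdge e d) T (I (ds ++ [d]))) :
    Ends (.forOut e x P) σ (1 + b + b * T) (I (σ.store.outEdges (σ.nreg x))) := by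
  obtain ⟨t, σ', h1, h2, h3⟩ := exists_execEdges [] _ h0 hI
  refine ⟨_, _, .forOut _ _ _ _ _ _ h1, ?_, h3⟩
  have := Nat.mul_le_mul_right T hb
  omega

/-- Execute `P` if all tests in a list succeed. -/
def guards (Bs : List (Test NLabel ELabel)) (P : Cmd NLabel ELabel) : Cmd NLabel ELabel :=
  Bs.foldr (fun B P => .ite B P .skip) P

/-- A failed test still executes `skip`, hence the condition `1 ≤ T`. -/
theorem Ends.guards {Bs : List (Test NLabel ELabel)} (hT : 1 ≤ T)
    (h1 : (∀ B ∈ Bs, B.Holds σ) → Ends P σ T Q) (h2 : (¬ ∀ B ∈ Bs, B.Holds σ) → Q σ) :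
    Ends (guards Bs P) σ (Bs.length + T) Q := by
  induction Bs with
  | nil => exact (h1 (by simp)).of_le (by simp)
  | cons B Bs ih =>
    refine (Ends.ite (T := Bs.length + T) ?_ ?_).of_le (by simp only [List.length_cons]; omega)
    · intro hB
      exact ih (fun h => h1 (by simpa using ⟨hB, h⟩)) (fun h => h2 (by simpa [hB] using h))
    · intro hB
      exact (Ends.skip (h2 fun h => hB (h B (by simp)))).of_le (by omega)

end Ends

end GraphMachine

/-! ## A program for single steps -/

namespace FBT

open NLabel RGraph GraphMachine

/-- Move the root from node register `0` to node register `1` and raise the flag `0`. -/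
def moveRootCmd : Cmd NLabel ELabel :=
  .seq (.setRoot 0 false) (.seq (.setRoot 1 true) (.setFlag 0 true))

/-- Try to move the root, in node register `0`, upwards. -/
def ascendCmd : Cmd NLabel ELabel :=
  .ite (.indegEq 0 1)
    -- The loop with empty body loads the only incoming edge into edge register `0`.
    (.seq (.forIn 0 0 .skip) (.seq (.source 1 0) (.ite (.hasLabel 1 box) moveRootCmd .skip))) .skip

/-- Test the edge in edge register `1` as the second edge of a path from the root. -/
def testPathCmd : Cmd NLabel ELabel :=
  .seq (.target 2 1) (.ite (.sameNode 2 0) .skip (.ite (.sameNode 2 1) .skip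
    -- Node register `1` is overwritten when the search goes on, so the middle of the path is saved
    -- in register `3`.
    (.ite (.hasLabel 2 box) (.seq (.copyNode 3 1) (.setFlag 1 true)) .skip)))

/-- Search for a path of three squares from the root; if there is one, raise the flag `1` and put the
second node of the path into node register `3`. -/
def searchCmd : Cmd NLabel ELabel :=
  .forOut 0 0 (.seq (.target 1 0) (.ite (.sameNode 1 0) .skip
    (.ite (.hasLabel 1 box) (.forOut 1 1 testPathCmd) .skip)))

/-- Move the root to node register `3` and leave a triangle. -/
def descendCmd : Cmd NLabel ELabel :=
  .seq (.copyNode 1 3) (.seq (.relabel 0 tri) moveRootCmd)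

/-- Delete the edges and leaves of the cherry. -/
def deleteCherryCmd : Cmd NLabel ELabel :=
  -- Edges go first, because only isolated nodes can be deleted.
  .seq (.delEdge 1) (.seq (.delEdge 2) (.seq (.delNode 3) (.delNode 4)))

/-- Delete the cherry and move the root to its parent, which becomes a square. -/
def pruneCmd : Cmd NLabel ELabel :=
  .seq (.forIn 0 0 .skip) (.seq (.source 1 0)
    (.seq deleteCherryCmd (.seq (.relabel 1 box) moveRootCmd)))

/-- Test whether the root has exactly two children, both of them square leaves, and prune them. -/
def cherryCmd : Cmd NLabel ELabel :=
  .ite (.outdegEq 0 2)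
    -- The body shifts edges through the registers: after two passes the first edge is in register
    -- `2` and the second in register `1`.
    (.seq (.forOut 0 0 (.seq (.copyEdge 2 1) (.copyEdge 1 0)))
      (.seq (.target 3 1) (.seq (.target 4 2)
        (guards [.hasLabel 3 box, .hasLabel 4 box, .outdegEq 3 0, .outdegEq 4 0, .indegEq 3 1,
            .indegEq 4 1]
          (.ite (.indegEq 0 0) (.seq deleteCherryCmd (.setFlag 0 true))
            (guards [.indegEq 0 1] pruneCmd)))))) .skip

/-- Perform one step, or take the flag `0` down. -/
def stepCmd : Cmd NLabel ELabel :=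
  -- The flag is down in advance, and only a branch that performs a step raises it again.
  .seq (.setFlag 0 false) (.forNodes 0 box true
    (.ite (.outdegEq 0 0) ascendCmd
      (.seq (.setFlag 1 false) (.seq searchCmd (.ite (.flag 1) descendCmd cherryCmd)))))

-- Correctness and running time of the program

variable {G : RGraph NLabel ELabel} {v : G.V} {S : Store NLabel ELabel} {f : G.V → ℕ} {h : G.E → ℕ}
  {σ : State NLabel ELabel} {b : ℕ}

/-- The required outcome of a step from a stored copy of `G`. -/
def IsOutcome (G : RGraph NLabel ELabel) (σ : State NLabel ELabel) : Prop :=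
  (σ.flag 0 = true ∧ ∃ H, DirectlyDerives rules G H ∧ σ.store.Represents H) ∨
    (σ.flag 0 = false ∧ InNormalForm rules G ∧ σ.store.Represents G)

/-- The state before the step: the store is `S`, the root is in node register `0`, and the flag `0` is
down. -/
structure IsReady (S : Store NLabel ELabel) (x : ℕ) (σ : State NLabel ELabel) : Prop where
  store : σ.store = S
  root : σ.nreg 0 = x
  flag : σ.flag 0 = false

theorem IsReady.isOutcome (hσ : IsReady S (f v) σ) (hS : S.IsCopy G f h) (hG : RootedAt G v)
    (hn : ∀ D F r z a, ¬ Redex G v D F r z a) : IsOutcome G σ := by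
  right
  refine ⟨hσ.flag, (inNormalForm_iff hG).2 hn, ?_⟩
  rw [hσ.store]
  exact hS.represents

theorem ends_moveRootCmd {T : ℕ} {Q : State NLabel ELabel → Prop} (h0 : σ.nreg 0 ∈ σ.store.nodes)
    (h1 : σ.nreg 1 ∈ σ.store.nodes) (hT : σ.store.numRooted ≤ T)
    (hQ : Q { σ with
      flag := Function.update σ.flag 0 true
      store := { σ.store with
        root := Function.update (Function.update σ.store.root (σ.nreg 0) false) (σ.nreg 1) true } }) :
    Ends moveRootCmd σ (2 * T + 3) Q := by
  refine Ends.of_le (Ends.seq (Ends.setRoot h0 hT (Ends.seq (Ends.setRoot (T := T) h1 ?_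
    (Ends.setFlag hQ))))) (by omega)
  -- The old root is unrooted first, so the number of roots has not grown when the second change is
  -- charged.
  refine le_trans (Finset.card_le_card fun x hx => ?_) hT
  simp only [Finset.mem_filter] at hx ⊢
  refine ⟨hx.1, ?_⟩
  by_cases hne : x = σ.nreg 0
  · simp [hne] at hx
  · rw [← hx.2, Function.update_of_ne hne]

open Classical in
theorem update_root_eq_decide (hS : S.IsCopy G f h) (hG : RootedAt G v) (r w : G.V) :
    Function.update (Function.update S.root (f v) false) (f r) true (f w) = decide (w = r) := by
  by_cases hr : w = r
  · simp [hr]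
  · rw [Function.update_of_ne (hS.injV.ne hr)]
    by_cases hv : w = v
    · rw [hv, Function.update_self]
      simp [← hv, hr]
    · rw [Function.update_of_ne (hS.injV.ne hv)]
      have := mt (hS.root_iff hG w).1 hv
      simp only [hr, decide_false]
      simpa using this

/-- All other redexes need an outgoing edge at the root, so if ascending fails, the graph is in
normal form. -/
theorem ends_ascendCmd (hS : S.IsCopy G f h) (hG : RootedAt G v) (hσ : IsReady S (f v) σ)
    (hout : ∀ e, G.s e ≠ v) : Ends ascendCmd σ 20 (IsOutcome G) := by
  have hno : (∀ e, G.t e = v → (∀ d, G.t d = v → d = e) → G.l (G.s e) ≠ some box) →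
      ∀ D F r z a, ¬ Redex G v D F r z a := by
    rintro hn D F r z a (⟨hc, -⟩ | ⟨hc, -⟩ | ⟨hs, -⟩ | ⟨rfl, ht, hl, -, hin⟩)
    · exact hout _ hc.s₁
    · exact hout _ hc.s₁
    · exact hout _ hs
    · exact hn _ ht hin hl
  refine (Ends.ite (T := 18) (fun h1 => ?_) (fun h1 => ?_)).of_le (by omega)
  · simp only [Test.Holds, hσ.store, hσ.root] at h1
    obtain ⟨e, he, ht, hu⟩ := (hS.length_inEdges_eq_one v).1 h1
    refine (Ends.seq (Ends.forIn_singleton (d := h e) (by rw [hσ.store, hσ.root, he])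
      (Ends.skip (Ends.seq (Ends.source (Ends.ite (T := 5) (fun h2 => ?_) (fun h2 => ?_))))))).of_le
        (by omega)
    all_goals
      simp [Test.Holds, State.setNode, State.setEdge, hσ.store, hS.src, hS.lab_eq] at h2
    · refine ends_moveRootCmd (T := 1) ?_ ?_ ?_ ?_
      · simp [State.setNode, State.setEdge, hσ.store, hσ.root, hS.mem_nodes]
      · simp [State.setNode, State.setEdge, hσ.store, hS.src, hS.mem_nodes]
      · simp [State.setNode, State.setEdge, hσ.store, hS.numRooted hG]
      · left
        refine ⟨by simp, hS.exists_directlyDerives hG (.ascend rfl ht h2 hout hu) ?_ ?_ ?_ ?_ ?_ ?_⟩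
        · simp [State.setNode, State.setEdge, hσ.store, hS.mem_nodes_iff]
        · simp [State.setNode, State.setEdge, hσ.store, hS.mem_edges_iff]
        · simp [State.setNode, State.setEdge, hσ.store]
        · simp [State.setNode, State.setEdge, hσ.store]
        · intro w
          simp only [State.setNode, State.setEdge, hσ.store]
          split_ifs with hw
          · rw [hw, hS.lab_eq, h2]
          · rfl
        · intro w
          simpa [State.setNode, State.setEdge, hσ.store, hσ.root, hS.src] using
            update_root_eq_decide hS hG _ w
    · refine (Ends.skip (IsReady.isOutcome ⟨?_, ?_, ?_⟩ hS hG (hno ?_))).of_le (by omega)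
      · simp [State.setNode, State.setEdge, hσ.store]
      · simp [State.setNode, State.setEdge, hσ.root]
      · simp [State.setNode, State.setEdge, hσ.flag]
      · intro d hd _
        rw [hu d hd]
        exact h2
  · simp only [Test.Holds, hσ.store, hσ.root] at h1
    refine (Ends.skip (hσ.isOutcome hS hG (hno ?_))).of_le (by omega)
    intro e he hu _
    exact h1 (hS.length_inEdges_eq_one_of_unique he hu)

/-- The edges `e`, `e'` form a path of three distinct squares from `v`. -/
structure IsPath (G : RGraph NLabel ELabel) (v : G.V) (e e' : G.E) : Prop where
  s : G.s e = v
  s' : G.s e' = G.t e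
  ne : G.t e ≠ v
  ne₁ : G.t e' ≠ v
  ne₂ : G.t e' ≠ G.t e
  l : G.l (G.t e) = some box
  l' : G.l (G.t e') = some box

/-- The invariant of the search for a path, when the pairs of edges in `A` have been tested. -/
structure IsSearching (G : RGraph NLabel ELabel) (v : G.V) (S : Store NLabel ELabel) (f : G.V → ℕ)
    (A : G.E → G.E → Prop) (σ : State NLabel ELabel) : Prop where
  ready : IsReady S (f v) σ
  found : σ.flag 1 = true → ∃ e e', IsPath G v e e' ∧ σ.nreg 3 = f (G.t e)
  not_found : σ.flag 1 = false → ∀ e e', A e e' → ¬ IsPath G v e e'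

theorem IsSearching.mono {A A' : G.E → G.E → Prop} (hσ : IsSearching G v S f A σ)
    (hA : ∀ e e', A' e e' → IsPath G v e e' → A e e') : IsSearching G v S f A' σ :=
  ⟨hσ.ready, hσ.found, fun h1 e e' h2 h3 => hσ.not_found h1 e e' (hA e e' h2 h3) h3⟩

/-- Node register `1` is tracked in the conclusion because the remaining passes of the inner loop
still need the middle node there. -/
theorem ends_testPathCmd (hS : S.IsCopy G f h) {A : G.E → G.E → Prop} {e e' : G.E}
    (hσ : IsSearching G v S f A σ) (h1 : σ.nreg 1 = f (G.t e)) (hs : G.s e = v) (hne : G.t e ≠ v)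
    (hl : G.l (G.t e) = some box) (hs' : G.s e' = G.t e) :
    Ends testPathCmd (σ.setEdge 1 (h e')) 6 fun σ' =>
      IsSearching G v S f (fun d d' => A d d' ∨ d = e ∧ d' = e') σ' ∧ σ'.nreg 1 = f (G.t e) := by
  obtain ⟨⟨hst, hroot, hflag⟩, hfound, hnot⟩ := hσ
  have fail : ¬ IsPath G v e e' →
      IsSearching G v S f (fun d d' => A d d' ∨ d = e ∧ d' = e')
        ((σ.setEdge 1 (h e')).setNode 2 (f (G.t e'))) := by
    intro hp
    refine ⟨⟨?_, ?_, ?_⟩, ?_, ?_⟩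
    · simpa [State.setNode, State.setEdge] using hst
    · simpa [State.setNode, State.setEdge] using hroot
    · simpa [State.setNode, State.setEdge] using hflag
    · simpa [State.setNode, State.setEdge] using hfound
    · rintro h2 d d' (h3 | ⟨rfl, rfl⟩)
      · exact hnot h2 d d' h3
      · exact hp
  have htgt : (σ.setEdge 1 (h e')).store.tgt ((σ.setEdge 1 (h e')).ereg 1) = f (G.t e') := by
    simp [State.setEdge, hst, hS.tgt]
  have hreg : ((σ.setEdge 1 (h e')).setNode 2 (f (G.t e'))).nreg 1 = f (G.t e) := by
    simpa [State.setNode, State.setEdge] using h1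
  refine Ends.of_le (Ends.seq (Ends.target ?_)) (le_refl (1 + 5))
  rw [htgt]
  refine Ends.ite (T := 4) (fun h2 => ?_) (fun h2 => Ends.ite (T := 3) (fun h3 => ?_)
    (fun h3 => Ends.ite (T := 2) (fun h4 => ?_) (fun h4 => ?_)))
  all_goals simp [Test.Holds, State.setNode, State.setEdge, hroot, hS.injV.eq_iff] at h2
  · exact (Ends.skip ⟨fail fun hp => hp.ne₁ h2, hreg⟩).of_le (by omega)
  all_goals simp [Test.Holds, State.setNode, State.setEdge, h1, hS.injV.eq_iff] at h3
  · exact (Ends.skip ⟨fail fun hp => hp.ne₂ h3, hreg⟩).of_le (by omega)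
  all_goals simp [Test.Holds, State.setNode, State.setEdge, hst, hS.lab_eq] at h4
  · refine Ends.seq (Ends.copyNode (Ends.setFlag ⟨⟨⟨?_, ?_, ?_⟩, ?_, ?_⟩, ?_⟩))
    · simpa [State.setNode, State.setEdge] using hst
    · simpa [State.setNode, State.setEdge] using hroot
    · simpa [State.setNode, State.setEdge] using hflag
    · intro _
      refine ⟨e, e', ⟨hs, hs', hne, h2, h3, hl, h4⟩, ?_⟩
      simpa [State.setNode, State.setEdge] using h1
    · intro h5
      simp at h5
    · simpa [State.setNode, State.setEdge] using h1
  · exact (Ends.skip ⟨fail fun hp => h4 hp.l', hreg⟩).of_le (by omega)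

/-- All pairs of consecutive edges from the root are tested, at most `b` first edges with at most
`b` second edges each; a lowered flag `1` therefore excludes descending. -/
theorem ends_searchCmd (hS : S.IsCopy G f h) (hb : G.DegreeBounded b) (hσ : IsReady S (f v) σ)
    (hflag : σ.flag 1 = false) :
    Ends searchCmd σ (1 + b + b * (1 + (1 + (1 + (1 + b + b * 6)))))
      (IsSearching G v S f fun _ _ => True) := by
  have hlen := hS.length_outEdges_le hb
  -- Outer invariant: the pairs whose first edge has been treated are settled.
  refine Ends.mono (Ends.forOut (b := b)
    (I := fun ds => IsSearching G v S f fun e _ => h e ∈ ds) ?_ ?_ ?_) le_rfl ?_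
  · rw [hσ.store, hσ.root]
    exact hlen v
  · exact ⟨hσ, fun h1 => by simp [hflag] at h1, by simp⟩
  · intro ds d σ' hd hI
    obtain ⟨l, -, hl, he⟩ := hS.exists_outEdges_eq_map v
    rw [hσ.store, hσ.root, he] at hd
    obtain ⟨e, hel, rfl⟩ := List.mem_map.1 hd
    have hs := (hl e).1 hel
    obtain ⟨⟨hst, hroot, hfl⟩, hfound, hnot⟩ := hI
    refine Ends.seq (Ends.target ?_)
    have htgt : (σ'.setEdge 0 (h e)).store.tgt ((σ'.setEdge 0 (h e)).ereg 0) = f (G.t e) := by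
      simp [State.setEdge, hst, hS.tgt]
    rw [htgt]
    set τ := (σ'.setEdge 0 (h e)).setNode 1 (f (G.t e)) with hτ
    have hτ1 : τ.nreg 1 = f (G.t e) := by simp [hτ, State.setNode, State.setEdge]
    have hτI : IsSearching G v S f (fun e _ => h e ∈ ds) τ := by
      refine ⟨⟨?_, ?_, ?_⟩, ?_, ?_⟩
      · simpa [hτ, State.setNode, State.setEdge] using hst
      · simpa [hτ, State.setNode, State.setEdge] using hroot
      · simpa [hτ, State.setNode, State.setEdge] using hfl
      · simpa [hτ, State.setNode, State.setEdge] using hfound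
      · simpa [hτ, State.setNode, State.setEdge] using hnot
    -- If no path starts with `e`, then `e` counts as treated without running the inner loop.
    have fail : (∀ e', ¬ IsPath G v e e') →
        IsSearching G v S f (fun d _ => h d ∈ ds ++ [h e]) τ := by
      intro hp
      refine hτI.mono fun d d' hd hpath => ?_
      rw [List.mem_append, List.mem_singleton, hS.injE.eq_iff] at hd
      rcases hd with hd | rfl
      · exact hd
      · exact absurd hpath (hp d')
    refine Ends.ite (T := 1 + (1 + b + b * 6)) (fun h2 => ?_) (fun h2 =>
      Ends.ite (T := 1 + b + b * 6) (fun h3 => ?_) (fun h3 => ?_))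
    all_goals simp only [Test.Holds, hτ1, hτI.ready.root, hS.injV.eq_iff] at h2
    · exact (Ends.skip (fail fun e' hp => hp.ne h2)).of_le (by omega)
    all_goals simp only [Test.Holds, hτ1, hτI.ready.store, hS.lab_eq] at h3
    -- Inner invariant: in addition, the pairs formed by `e` and a second edge treated so far are
    -- settled.
    · refine Ends.mono (Ends.forOut (b := b) (I := fun ds' σ'' =>
        IsSearching G v S f (fun d d' => h d ∈ ds ∨ d = e ∧ h d' ∈ ds') σ'' ∧
          σ''.nreg 1 = f (G.t e)) ?_ ?_ ?_) le_rfl ?_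
      · rw [hτI.ready.store, hτ1]
        exact hlen _
      · exact ⟨hτI.mono fun d d' hd _ => by simpa using hd, hτ1⟩
      · rintro ds' d' σ'' hd' ⟨hI', h1⟩
        obtain ⟨l', -, hl', he'⟩ := hS.exists_outEdges_eq_map (G.t e)
        rw [hτI.ready.store, hτ1, he'] at hd'
        obtain ⟨e', hel', rfl⟩ := List.mem_map.1 hd'
        refine (ends_testPathCmd hS hI' h1 hs h2 h3 ((hl' e').1 hel')).mono le_rfl ?_
        rintro ρ ⟨hρ, hρ1⟩
        refine ⟨hρ.mono fun d d' hd _ => ?_, hρ1⟩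
        rw [List.mem_append, List.mem_singleton, hS.injE.eq_iff] at hd
        tauto
      · rintro ρ ⟨hρ, -⟩
        refine hρ.mono fun d d' hd hpath => ?_
        rw [List.mem_append, List.mem_singleton, hS.injE.eq_iff] at hd
        refine hd.imp id fun hde => ⟨hde, ?_⟩
        obtain ⟨l', -, hl', he'⟩ := hS.exists_outEdges_eq_map (G.t e)
        rw [hτI.ready.store, hτ1, he']
        exact List.mem_map_of_mem ((hl' d').2 (by rw [hpath.s', hde]))
    · exact (Ends.skip (fail fun e' hp => h3 hp.l)).of_le (by omega)
  · intro ρ hρ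
    refine hρ.mono fun d d' _ hpath => ?_
    obtain ⟨l, -, hl, he⟩ := hS.exists_outEdges_eq_map v
    rw [hσ.store, hσ.root, he]
    exact List.mem_map_of_mem ((hl d).2 hpath.s)

theorem ends_descendCmd (hS : S.IsCopy G f h) (hG : RootedAt G v) (hσ : IsReady S (f v) σ)
    {e e' : G.E} (hp : IsPath G v e e') (h3 : σ.nreg 3 = f (G.t e)) :
    Ends descendCmd σ 8 (IsOutcome G) := by
  refine Ends.seq (Ends.copyNode (Ends.seq (T₂ := 5) (Ends.relabel (T := 1) ?_ ?_
    (ends_moveRootCmd (T := 1) ?_ ?_ ?_ ?_))))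
  · simp [State.setNode, hσ.store, hσ.root, hS.mem_nodes]
  · simp [State.setNode, hσ.store, hS.numRooted hG]
  · simp [State.setNode, hσ.store, hσ.root, hS.mem_nodes]
  · simp [State.setNode, hσ.store, h3, hS.mem_nodes]
  · have := hS.numRooted hG
    simpa [State.setNode, hσ.store, Store.numRooted] using this.le
  · left
    refine ⟨by simp, hS.exists_directlyDerives hG (.descend hp.s rfl hp.s' rfl hp.ne.symm
      hp.ne₁.symm hp.ne₂.symm hp.l hp.l') ?_ ?_ ?_ ?_ ?_ ?_⟩
    · simp [State.setNode, hσ.store, hS.mem_nodes_iff]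
    · simp [State.setNode, hσ.store, hS.mem_edges_iff]
    · simp [State.setNode, hσ.store]
    · simp [State.setNode, hσ.store]
    · intro w
      by_cases hw : w = v
      · simp [State.setNode, hσ.store, hσ.root, hw]
      · simp [State.setNode, hσ.store, hσ.root, hw, hS.injV.ne hw]
    · intro w
      simpa [State.setNode, hσ.store, hσ.root, h3] using update_root_eq_decide hS hG _ w

theorem Cherry.swap {a₁ a₂ : G.V} {e₁ e₂ : G.E} (hc : Cherry G v a₁ a₂ e₁ e₂) :
    Cherry G v a₂ a₁ e₂ e₁ :=
  ⟨hc.ne.symm, hc.ne₂, hc.ne₁, hc.neE.symm, hc.s₂, hc.s₁, hc.t₂, hc.t₁, hc.l₂, hc.l₁,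
    fun d hd => (hc.out d hd).symm, hc.out₂, hc.out₁, hc.in₂, hc.in₁⟩

/-- The cherry at a node is determined by any two outgoing edges of the node. -/
theorem Cherry.of_ne {a₁ a₂ : G.V} {e₁ e₂ e e' : G.E} (hc : Cherry G v a₁ a₂ e₁ e₂) (hne : e ≠ e')
    (hs : G.s e = v) (hs' : G.s e' = v) : Cherry G v (G.t e) (G.t e') e e' := by
  have h1 := hc
  obtain ⟨-, -, -, -, -, -, rfl, rfl, -⟩ := h1
  rcases hc.out e hs with rfl | rfl <;> rcases hc.out e' hs' with rfl | rfl
  · exact absurd rfl hne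
  · exact hc
  · exact Cherry.swap hc
  · exact absurd rfl hne

/-- The two edges are the only ones at the leaves, so the leaves are isolated once these are gone.
-/
theorem ends_deleteCherryCmd {Q : State NLabel ELabel → Prop} {a₁ a₂ : G.V} {e₁ e₂ : G.E}
    (hS : S.IsCopy G f h) (hc : Cherry G v a₁ a₂ e₁ e₂) (hst : σ.store = S)
    (he₁ : σ.ereg 1 = h e₁) (he₂ : σ.ereg 2 = h e₂) (ha₁ : σ.nreg 3 = f a₁) (ha₂ : σ.nreg 4 = f a₂)
    (hQ : Q { σ with store := { S with
      nodes := (S.nodes.erase (f a₁)).erase (f a₂)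
      edges := (S.edges.erase (h e₁)).erase (h e₂) } }) :
    Ends deleteCherryCmd σ 4 Q := by
  subst hst
  have key : ∀ d ∈ (σ.store.edges.erase (h e₁)).erase (h e₂),
      (σ.store.src d ≠ f a₁ ∧ σ.store.tgt d ≠ f a₁) ∧
        (σ.store.src d ≠ f a₂ ∧ σ.store.tgt d ≠ f a₂) := by
    intro d hd
    simp only [Finset.mem_erase] at hd
    obtain ⟨e, rfl⟩ := hS.exists_edge hd.2.2
    rw [hS.injE.ne_iff, hS.injE.ne_iff] at hd
    rw [hS.src, hS.tgt, hS.injV.ne_iff, hS.injV.ne_iff, hS.injV.ne_iff, hS.injV.ne_iff]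
    exact ⟨⟨hc.out₁ e, fun h => hd.2.1 (hc.in₁ e h)⟩, ⟨hc.out₂ e, fun h => hd.1 (hc.in₂ e h)⟩⟩
  refine Ends.seq (Ends.delEdge ?_ (Ends.seq (Ends.delEdge ?_
    (Ends.seq (T₁ := 1) (Ends.delNode ?_ ?_ (Ends.delNode ?_ ?_ ?_))))))
  · rw [he₁]
    exact hS.mem_edges _
  · simp [he₁, he₂, hS.injE.ne hc.neE.symm, hS.mem_edges]
  · simp [ha₁, hS.mem_nodes]
  · simp only [he₁, he₂, ha₁]
    exact fun d hd => (key d hd).1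
  · simp [ha₁, ha₂, hS.injV.ne hc.ne.symm, hS.mem_nodes]
  · simp only [he₁, he₂, ha₂]
    exact fun d hd => (key d hd).2
  · simpa only [he₁, he₂, ha₁, ha₂] using hQ

/-- The registers after the two outgoing edges of the root and their targets have been read. -/
structure HasCherryRegisters (G : RGraph NLabel ELabel) (S : Store NLabel ELabel) (f : G.V → ℕ)
    (h : G.E → ℕ) (v : G.V) (e₁ e₂ : G.E) (σ : State NLabel ELabel) : Prop where
  ready : IsReady S (f v) σ
  ereg₁ : σ.ereg 1 = h e₁
  ereg₂ : σ.ereg 2 = h e₂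
  nreg₁ : σ.nreg 3 = f (G.t e₁)
  nreg₂ : σ.nreg 4 = f (G.t e₂)

theorem ends_topCmd {e₁ e₂ : G.E} (hS : S.IsCopy G f h) (hG : RootedAt G v)
    (hσ : HasCherryRegisters G S f h v e₁ e₂ σ) (hc : Cherry G v (G.t e₁) (G.t e₂) e₁ e₂)
    (hin : ∀ e, G.t e ≠ v) :
    Ends (.seq deleteCherryCmd (.setFlag 0 true)) σ 5 (IsOutcome G) := by
  refine Ends.seq (ends_deleteCherryCmd hS hc hσ.ready.store hσ.ereg₁ hσ.ereg₂ hσ.nreg₁ hσ.nreg₂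
    (Ends.setFlag (Or.inl ⟨by simp,
      hS.exists_directlyDerives hG (.top hc hin) ?_ ?_ rfl rfl ?_ ?_⟩)))
  · intro x
    simp only [Finset.mem_erase, hS.mem_nodes_iff]
    constructor
    · rintro ⟨h2, h1, w, rfl⟩
      exact ⟨w, by simp [hS.injV.ne_iff.1 h1, hS.injV.ne_iff.1 h2], rfl⟩
    · rintro ⟨w, hw, rfl⟩
      simp only [Set.mem_insert_iff, Set.mem_singleton_iff, not_or] at hw
      exact ⟨hS.injV.ne hw.2, hS.injV.ne hw.1, w, rfl⟩
  · intro x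
    simp only [Finset.mem_erase, hS.mem_edges_iff]
    constructor
    · rintro ⟨h2, h1, w, rfl⟩
      exact ⟨w, by simp [hS.injE.ne_iff.1 h1, hS.injE.ne_iff.1 h2], rfl⟩
    · rintro ⟨w, hw, rfl⟩
      simp only [Set.mem_insert_iff, Set.mem_singleton_iff, not_or] at hw
      exact ⟨hS.injE.ne hw.2, hS.injE.ne hw.1, w, rfl⟩
  · intro w
    split_ifs with hw
    · rw [hw]
      exact hS.lab_eq.2 hG.l_root
    · rfl
  · intro w
    rw [Bool.eq_iff_iff]
    simpa using hS.root_iff hG w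

theorem ends_pruneCmd {e e₁ e₂ : G.E} (hS : S.IsCopy G f h) (hG : RootedAt G v)
    (hσ : HasCherryRegisters G S f h v e₁ e₂ σ) (hc : Cherry G v (G.t e₁) (G.t e₂) e₁ e₂)
    (he : S.inEdges (f v) = [h e]) (ht : G.t e = v) (hin : ∀ d, G.t d = v → d = e) :
    Ends pruneCmd σ 15 (IsOutcome G) := by
  obtain ⟨⟨hst, hroot, hflag⟩, hE₁, hE₂, hN₁, hN₂⟩ := hσ
  have hs₁ : G.s e ≠ G.t e₁ := hc.out₁ e
  have hs₂ : G.s e ≠ G.t e₂ := hc.out₂ e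
  refine Ends.of_le (Ends.seq (Ends.forIn_singleton (d := h e) (by rw [hst, hroot, he])
    (Ends.skip (Ends.seq (Ends.source (Ends.seq (ends_deleteCherryCmd hS hc ?_ ?_ ?_ ?_ ?_
      (Ends.seq (T₂ := 5) (Ends.relabel (T := 1) ?_ ?_
        (ends_moveRootCmd (T := 1) ?_ ?_ ?_ ?_)))))))))) (by omega)
  · simpa [State.setNode, State.setEdge] using hst
  · simpa [State.setNode, State.setEdge] using hE₁
  · simpa [State.setNode, State.setEdge] using hE₂
  · simpa [State.setNode, State.setEdge] using hN₁
  · simpa [State.setNode, State.setEdge] using hN₂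
  · simp [State.setNode, State.setEdge, hst, hS.src, hS.injV.ne hs₁, hS.injV.ne hs₂, hS.mem_nodes]
  · rw [← hS.numRooted hG]
    refine Finset.card_le_card (Finset.filter_subset_filter _ ?_)
    exact (Finset.erase_subset _ _).trans (Finset.erase_subset _ _)
  · simp [State.setNode, State.setEdge, hroot, hS.injV.ne hc.ne₁, hS.injV.ne hc.ne₂, hS.mem_nodes]
  · simp [State.setNode, State.setEdge, hst, hS.src, hS.injV.ne hs₁, hS.injV.ne hs₂, hS.mem_nodes]
  · rw [← hS.numRooted hG]
    refine Finset.card_le_card (Finset.filter_subset_filter _ ?_)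
    exact (Finset.erase_subset _ _).trans (Finset.erase_subset _ _)
  · refine Or.inl ⟨by simp,
      hS.exists_directlyDerives hG (.prune hc rfl ht hin) ?_ ?_ rfl rfl ?_ ?_⟩
    · intro x
      simp only [Finset.mem_erase, hS.mem_nodes_iff]
      constructor
      · rintro ⟨h2, h1, w, rfl⟩
        exact ⟨w, by simp [hS.injV.ne_iff.1 h1, hS.injV.ne_iff.1 h2], rfl⟩
      · rintro ⟨w, hw, rfl⟩
        simp only [Set.mem_insert_iff, Set.mem_singleton_iff, not_or] at hw
        exact ⟨hS.injV.ne hw.2, hS.injV.ne hw.1, w, rfl⟩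
    · intro x
      simp only [Finset.mem_erase, hS.mem_edges_iff]
      constructor
      · rintro ⟨h2, h1, w, rfl⟩
        exact ⟨w, by simp [hS.injE.ne_iff.1 h1, hS.injE.ne_iff.1 h2], rfl⟩
      · rintro ⟨w, hw, rfl⟩
        simp only [Set.mem_insert_iff, Set.mem_singleton_iff, not_or] at hw
        exact ⟨hS.injE.ne hw.2, hS.injE.ne hw.1, w, rfl⟩
    · intro w
      by_cases hw : w = G.s e
      · simp [State.setNode, State.setEdge, hst, hS.src, hw]
      · simp [State.setNode, State.setEdge, hst, hS.src, hw, hS.injV.ne hw]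
    · intro w
      simpa [State.setNode, State.setEdge, hst, hroot, hS.src] using
        update_root_eq_decide hS hG _ w

/-- An outgoing edge excludes ascending and the failed search excludes descending, so only a cherry
can give a step. -/
theorem ends_cherryCmd (hS : S.IsCopy G f h) (hG : RootedAt G v) (hσ : IsReady S (f v) σ)
    (hout : ∃ e, G.s e = v) (hp : ∀ e e', ¬ IsPath G v e e') :
    Ends cherryCmd σ 50 (IsOutcome G) := by
  have hno : (∀ a₁ a₂ e₁ e₂, Cherry G v a₁ a₂ e₁ e₂ →
      ¬ ((∀ e, G.t e ≠ v) ∨ ∃ e, G.t e = v ∧ ∀ d, G.t d = v → d = e)) →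
      ∀ D F r z a, ¬ Redex G v D F r z a := by
    rintro hn D F r z a (⟨hc, hin⟩ | ⟨hc, hs, ht, hin⟩ | ⟨hs, rfl, hs', rfl, h1, h2, h3, h4, h5⟩ |
      ⟨-, -, -, ho, -⟩)
    · exact hn _ _ _ _ hc (Or.inl hin)
    · exact hn _ _ _ _ hc (Or.inr ⟨_, ht, hin⟩)
    · exact hp _ _ ⟨hs, hs', h1.symm, h2.symm, h3.symm, h4, h5⟩
    · exact hout.elim ho
  refine (Ends.ite (T := 49) (fun h1 => ?_) (fun h1 => ?_)).of_le (by omega)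
  all_goals simp only [Test.Holds, hσ.store, hσ.root] at h1
  · obtain ⟨e₂, e₁, hl, hne, ho⟩ := hS.length_outEdges_eq_two h1
    have hs₁ : G.s e₁ = v := (ho e₁).2 (Or.inr rfl)
    have hs₂ : G.s e₂ = v := (ho e₂).2 (Or.inl rfl)
    refine Ends.of_le (Ends.seq (Ends.forOut_pair (d := h e₂) (d' := h e₁)
      (by rw [hσ.store, hσ.root, hl]) (Ends.seq (Ends.copyEdge (Ends.copyEdge
        (Ends.seq (Ends.copyEdge (Ends.copyEdge
          (Ends.seq (Ends.target (Ends.seq (Ends.target ?_))))))))))))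
      (show 3 + (1 + 1) + (1 + 1) + (1 + (1 + 30)) ≤ 49 by omega)
    generalize hτ : State.setNode _ 4 _ = τ
    have hreg : HasCherryRegisters G S f h v e₁ e₂ τ := by
      rw [← hτ]
      refine ⟨⟨?_, ?_, ?_⟩, ?_, ?_, ?_, ?_⟩
      · simp [State.setNode, State.setEdge, hσ.store]
      · simp [State.setNode, State.setEdge, hσ.root]
      · simp [State.setNode, State.setEdge, hσ.flag]
      · simp [State.setNode, State.setEdge]
      · simp [State.setNode, State.setEdge]
      · simp [State.setNode, State.setEdge, hσ.store, hS.tgt]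
      · simp [State.setNode, State.setEdge, hσ.store, hS.tgt]
    have htests : (∀ B ∈ ([.hasLabel 3 box, .hasLabel 4 box, .outdegEq 3 0, .outdegEq 4 0,
        .indegEq 3 1, .indegEq 4 1] : List (Test NLabel ELabel)), B.Holds τ) ↔
        Cherry G v (G.t e₁) (G.t e₂) e₁ e₂ := by
      simp only [List.forall_mem_cons, List.not_mem_nil, Test.Holds, hreg.ready.store, hreg.nreg₁,
        hreg.nreg₂, hS.lab_eq, hS.length_outEdges_eq_zero, IsEmpty.forall_iff, implies_true,
        and_true]
      constructor
      · rintro ⟨l₁, l₂, o₁, o₂, i₁, i₂⟩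
        obtain ⟨d₁, -, ht₁, hu₁⟩ := (hS.length_inEdges_eq_one _).1 i₁
        obtain ⟨d₂, -, ht₂, hu₂⟩ := (hS.length_inEdges_eq_one _).1 i₂
        obtain rfl := hu₁ e₁ rfl
        obtain rfl := hu₂ e₂ rfl
        -- The leaves differ because each has only one incoming edge, and they differ from the root
        -- because they have no outgoing edge.
        exact ⟨fun h => hne (hu₁ _ h.symm), fun h => o₁ _ (hs₁.trans h), fun h => o₂ _ (hs₂.trans h),
          hne.symm, hs₁, hs₂, rfl, rfl, l₁, l₂, fun d hd => ((ho d).1 hd).symm, o₁, o₂, hu₁, hu₂⟩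
      · intro hc
        exact ⟨hc.l₁, hc.l₂, hc.out₁, hc.out₂, hS.length_inEdges_eq_one_of_unique rfl hc.in₁,
          hS.length_inEdges_eq_one_of_unique rfl hc.in₂⟩
    refine Ends.of_le (Ends.guards (T := 20) (by omega) (fun h2 => ?_) (fun h2 => ?_))
      (by simp only [List.length_cons, List.length_nil]; omega)
    all_goals rw [htests] at h2
    · refine Ends.of_le (Ends.ite (T := 16) (fun h3 => ?_) (fun h3 => ?_)) (by omega)
      all_goals simp only [Test.Holds, hreg.ready.store, hreg.ready.root] at h3
      all_goals rw [hS.length_inEdges_eq_zero] at h3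
      · exact (ends_topCmd hS hG hreg h2 h3).of_le (by omega)
      · refine Ends.of_le (Ends.guards (T := 15) (by omega) (fun h4 => ?_) (fun h4 => ?_))
          (by simp)
        all_goals simp only [List.mem_singleton, forall_eq, Test.Holds, hreg.ready.store,
          hreg.ready.root] at h4
        · obtain ⟨e, he, ht, hu⟩ := (hS.length_inEdges_eq_one v).1 h4
          exact ends_pruneCmd hS hG hreg h2 he ht hu
        · refine hreg.ready.isOutcome hS hG (hno ?_)
          rintro a₁ a₂ d₁ d₂ - (h5 | ⟨e, ht, hu⟩)
          · exact h3 h5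
          · exact h4 (hS.length_inEdges_eq_one_of_unique ht hu)
    -- A cherry at the root is formed by any two distinct outgoing edges, in particular by those in
    -- the registers, so no other pair need be tested.
    · refine hreg.ready.isOutcome hS hG (hno ?_)
      intro a₁ a₂ d₁ d₂ hc _
      exact h2 (Cherry.of_ne hc hne.symm hs₁ hs₂)
  · refine (Ends.skip (hσ.isOutcome hS hG (hno ?_))).of_le (by omega)
    intro a₁ a₂ e₁ e₂ hc _
    refine h1 (hS.length_outEdges_eq_two_of hc.neE fun d => ⟨hc.out d, ?_⟩)
    rintro (rfl | rfl)
    · exact hc.s₁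
    · exact hc.s₂

/-- The search accounts for the part of the bound that depends on `b`; everything else costs a
constant, and the summands leave slack. -/
theorem ends_stepCmd (hG : RootedAt G v) (hb : G.DegreeBounded b) (hσ : σ.store.Represents G) :
    Ends stepCmd σ (100 + b + b * (10 + b + b * 6)) (IsOutcome G) := by
  obtain ⟨f, h, hS⟩ := hσ.exists_isCopy
  refine Ends.of_le (Ends.seq (Ends.setFlag (Ends.forNodes_singleton (v := f v)
    (T := 90 + b + b * (10 + b + b * 6)) (hS.nodesWith_box_true hG) ?_))) (by omega)
  generalize hτ : State.setNode _ 0 (f v) = τ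
  have hready : IsReady σ.store (f v) τ := by
    rw [← hτ]
    refine ⟨?_, ?_, ?_⟩ <;> simp [State.setNode]
  refine Ends.of_le (Ends.ite (T := 80 + b + b * (10 + b + b * 6)) (fun h1 => ?_) (fun h1 => ?_))
    (by omega)
  all_goals simp only [Test.Holds, hready.store, hready.root] at h1
  all_goals rw [hS.length_outEdges_eq_zero] at h1
  · exact (ends_ascendCmd hS hG hready h1).of_le (by omega)
  · push Not at h1
    refine Ends.of_le (Ends.seq (Ends.setFlag (Ends.seq (T₂ := 51)
      ((ends_searchCmd (v := v) hS hb ⟨?_, ?_, ?_⟩ ?_).mono le_rfl ?_)))) ?_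
    · exact hready.store
    · exact hready.root
    · simpa using hready.flag
    · simp
    · intro ρ hρ
      refine (Ends.ite (T := 50) (fun h2 => ?_) (fun h2 => ?_)).of_le (by omega)
      · obtain ⟨e, e', hp, h3⟩ := hρ.found h2
        exact (ends_descendCmd hS hG hρ.ready hp h3).of_le (by omega)
      · refine ends_cherryCmd hS hG hρ.ready h1 fun e e' => hρ.not_found ?_ e e' trivial
        simpa [Test.Holds] using h2
    · have : b * (1 + (1 + (1 + (1 + b + b * 6)))) ≤ b * (10 + b + b * 6) :=
        Nat.mul_le_mul_left b (by omega)
      omega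

end FBT

/-! ## The loop -/

namespace FBT

open NLabel RGraph GraphMachine

variable {G H : RGraph NLabel ELabel} {k : ℕ}

theorem performsStepWithin_stepCmd {b : ℕ} (hG : IsInput G) (hb : G.DegreeBounded b)
    (hH : Derives rules G H) :
    PerformsStepWithin rules stepCmd (100 + b + b * (10 + b + b * 6)) H := by
  intro σ hσ
  obtain ⟨n, hd⟩ := hH
  obtain ⟨⟨v, hv, -⟩, -, hb'⟩ := derivesIn_invariant hG hd
  exact ends_stepCmd hv.rootedAt (hb' b hb) hσ

/-- The number `m` is fuel: with `n` steps done and `2 * G.order < n + m`, the length bound makes it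
impossible to run out. Each pass costs at most `k` steps and a test; the last `1` is the failing
test. -/
theorem exec_while_of_performsStepWithin {B : Cmd NLabel ELabel} (hG : IsInput G)
    (hB : ∀ H, Derives rules G H → PerformsStepWithin rules B k H) (m : ℕ) {n : ℕ}
    (hm : 2 * G.order < n + m) {H : RGraph NLabel ELabel} (hd : DerivesIn rules n G H)
    {σ : State NLabel ELabel} (hf : σ.flag 0 = true) (hσ : σ.store.Represents H) :
    ∃ (t : ℕ) (σ' : State NLabel ELabel) (H' : RGraph NLabel ELabel),
      Exec (.while (.flag 0) B) σ t σ' ∧ t ≤ m * (k + 1) + 1 ∧ σ'.store.Represents H' ∧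
        IsNormalFormOf rules H' G := by
  induction m generalizing n H σ with
  | zero =>
    have := length_le hG hd
    omega
  | succ m ih =>
    obtain ⟨t, σ', h1, h2, ⟨h3, H', h4, h5⟩ | ⟨h3, h4, h5⟩⟩ := hB H ⟨n, hd⟩ σ hσ
    · obtain ⟨t', σ'', H'', h6, h7, h8⟩ := ih (by omega) (.succ hd h4) h3 h5
      refine ⟨_, σ'', H'', .whileTrue _ _ _ _ _ _ _ hf h1 h6, ?_, h8⟩
      rw [Nat.succ_mul]
      omega
    · refine ⟨_, σ', H, .whileTrue _ _ _ _ _ _ _ hf h1 (.whileFalse _ _ _ ?_), ?_, h5,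
        ⟨n, hd⟩, h4⟩
      · simp [Test.Holds, h3]
      · rw [Nat.succ_mul]
        omega

theorem exec_loop_of_performsStepWithin {B : Cmd NLabel ELabel} (hG : IsInput G)
    (hB : ∀ H, Derives rules G H → PerformsStepWithin rules B k H) {σ : State NLabel ELabel}
    (hσ : σ.store.Represents G) :
    ∃ (t : ℕ) (σ' : State NLabel ELabel) (H : RGraph NLabel ELabel),
      Exec (loop B) σ t σ' ∧ t ≤ (3 * (k + 1) + 2) * G.order ∧ σ'.store.Represents H ∧
        IsNormalFormOf rules H G := by
  obtain ⟨t, σ', H, h1, h2, h3⟩ := exec_while_of_performsStepWithin hG hB (2 * G.order + 1)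
    (n := 0) (by omega) (.zero (Isomorphic.refl G))
    (σ := { σ with flag := Function.update σ.flag 0 true }) (by simp) hσ
  refine ⟨_, σ', H, .seq _ _ _ _ _ _ _ (.setFlag σ 0 true) h1, ?_, h3⟩
  -- The surplus `k + 3` over `2 * G.order * (k + 1)` is absorbed because there is at least one
  -- node.
  have := order_pos hG
  nlinarith

end FBT

-- The main theorem

theorem mainTheorem9 :
    -- termination, and a linear bound on the length of every derivation
    (∃ c : ℕ, ∀ G : RGraph NLabel ELabel, FBT.IsInput G →
      ∀ (n : ℕ) (H : RGraph NLabel ELabel), RGraph.DerivesIn FBT.rules n G H → n ≤ c * G.order) ∧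
    -- normal forms exist, and each of them decides whether the input is a full binary tree
    (∀ G : RGraph NLabel ELabel, FBT.IsInput G →
      (¬ ∃ f : ℕ → RGraph NLabel ELabel,
        f 0 = G ∧ ∀ i, RGraph.DirectlyDerives FBT.rules (f i) (f (i + 1))) ∧
      (∃ H, RGraph.IsNormalFormOf FBT.rules H G) ∧
      ∀ H, RGraph.IsNormalFormOf FBT.rules H G →
        (H.Isomorphic FBT.single ↔ (FBT.unlabelled G).IsFullBinaryTree)) ∧
    -- on inputs of bounded degree, rewriting to a normal form takes linear time
    (∃ B : GraphMachine.Cmd NLabel ELabel, ∀ b : ℕ, ∃ k C : ℕ,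
      ∀ G : RGraph NLabel ELabel, FBT.IsInput G → G.DegreeBounded b →
        (∀ H, RGraph.Derives FBT.rules G H →
          GraphMachine.PerformsStepWithin FBT.rules B k H) ∧
        (∀ σ : GraphMachine.State NLabel ELabel, σ.store.Represents G →
          ∃ (t : ℕ) (σ' : GraphMachine.State NLabel ELabel) (H : RGraph NLabel ELabel),
            GraphMachine.Exec (GraphMachine.loop B) σ t σ' ∧ t ≤ C * G.order ∧
            σ'.store.Represents H ∧ RGraph.IsNormalFormOf FBT.rules H G)) := by
  refine ⟨⟨2, fun G hG n H hd => FBT.length_le hG hd⟩, fun G hG => ⟨FBT.not_exists_infinite hG,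
    FBT.exists_isNormalFormOf hG, fun H hH => FBT.isomorphic_single_iff hG hH⟩,
    FBT.stepCmd, fun b => ⟨_, _, fun G hG hb => ⟨fun H hH =>
      FBT.performsStepWithin_stepCmd hG hb hH, fun σ hσ =>
      FBT.exec_loop_of_performsStepWithin hG
        (fun H hH => FBT.performsStepWithin_stepCmd hG hb hH) hσ⟩⟩⟩
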